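/- **Proposition.** For $K\ge 1$ let $\mathcal E_K$ be the $\mathbb Q$-vector space with generators $G\binom{k}{d}$ ($k\ge1$, $d\ge0$, $k+d=K$) and $G\binom{k_1,k_2}{d_1,d_2}$, $P\binom{k_1,k_2}{d_1,d_2}$ ($k_1,k_2\ge1$, $d_1,d_2\ge0$, $k_1+k_2+d_1+d_2=K$), subject to the relations $$P\tbinom{k_1,k_2}{d_1,d_2}=G\tbinom{k_1,k_2}{d_1,d_2}+G\tbinom{k_2,k_1}{d_2,d_1}+G\tbinom{k_1+k_2}{d_1+d_2}$$ and $$\begin{aligned}P\tbinom{k_1,k_2}{d_1,d_2}=&\sum_{\substack{l_1+l_2=k_1+k_2,\ l_1,l_2\ge1\\ e_1+e_2=d_1+d_2,\ e_1,e_2\ge 0}}\Big(\tbinom{l_1-1}{k_1-1}\tbinom{d_1}{e_1}(-1)^{d_1-e_1}+\tbinom{l_1-1}{k_2-1}\tbinom{d_2}{e_1}(-1)^{d_2-e_1}\Big)G\tbinom{l_1,l_2}{e_1,e_2}\\&+\tfrac{d_1!\,d_2!}{(d_1+d_2+1)!}\tbinom{k_1+k_2-2}{k_1-1}G\tbinom{k_1+k_2-1}{d_1+d_2+1}.\end{aligned}$$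 Let $G_k\in\mathbb Q[[q]]$ be $0$ for odd $k\ge 1$ and $G_k=-\frac{B_k}{2k!}+\frac1{(k-1)!}\sum_{n\ge1}\frac{n^{k-1}q^n}{1-q^n}$ for even $k\ge2$, let $\widetilde{\mathcal M}=\mathbb Q[G_2,G_4,G_6]$, and let $\widetilde{\mathcal M}_k$ be its weight $k$ part, spanned by the $G_2^aG_4^bG_6^c$ with $2a+4b+6c=k$. Let $\mathfrak B_1\in\mathbb Q[[q]][[X,Y]]$ be the Kronecker function without its polar part $-\frac12(\frac1X+\frac1Y)$, $$\mathfrak B_1\tbinom XY=\sum_{\substack{r,s\ge0\\ r+s\text{ odd}}}\frac{|r-s|!}{r!}\Big(q\frac d{dq}\Big)^{\min\{r,s\}}G_{|r-s|+1}\,X^r\frac{Y^s}{s!},\qquad \mathfrak P\tbinom{X_1,X_2}{Y_1,Y_2}=\mathfrak B_1\tbinom{X_1}{Y_1}\mathfrak B_1\tbinom{X_2}{Y_2},$$ $$R^\ast=\frac{\mathfrak B_1\binom{X_1}{Y_1+Y_2}-\mathfrak B_1\binom{X_2}{Y_1+Y_2}}{X_1-X_2},\qquad R^{sh}=\frac{\mathfrak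 B_1\binom{X_1+X_2}{Y_1}-\mathfrak B_1\binom{X_1+X_2}{Y_2}}{Y_1-Y_2},$$ $$\mathfrak B_2=\tfrac13\,\mathfrak P|(1+T^{-1})-\tfrac1{12}R^\ast|(5-3U+U\epsilon)-\tfrac1{12}R^{sh}|\big(T^{-1}(5-3\epsilon+U)\big),$$ where $\epsilon=\left(\begin{smallmatrix}0&1\\1&0\end{smallmatrix}\right)$, $T=\left(\begin{smallmatrix}1&1\\0&1\end{smallmatrix}\right)$, $U=\left(\begin{smallmatrix}1&-1\\1&0\end{smallmatrix}\right)$, and $\gamma=\left(\begin{smallmatrix}a&b\\c&d\end{smallmatrix}\right)\in\mathrm{GL}_2(\mathbb Z)$ acts by $$(R|\gamma)\tbinom{X_1,X_2}{Y_1,Y_2}=R\tbinom{aX_1+bX_2,\;cX_1+dX_2}{\det(\gamma)(dY_1-cY_2),\;\det(\gamma)(-bY_1+aY_2)},$$ extended linearly to $\mathbb Z[\mathrm{GL}_2(\mathbb Z)]$. Then for every $k\ge1$ the following maps are well defined, and each is the unique one with the stated property: - the $\mathbb Q$-linear map $\partial_k:\mathcal E_k\to\mathcal E_{k+2}$ with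 $G\binom{m}{d}\mapsto m\,G\binom{m+1}{d+1}$ and $G\binom{k_1,k_2}{d_1,d_2}\mapsto k_1G\binom{k_1+1,k_2}{d_1+1,d_2}+k_2G\binom{k_1,k_2+1}{d_1,d_2+1}$; - the Kronecker realization in weights $K=k$ and $K=k+2$, i.e. the $\mathbb Q$-linear map $\rho^{\mathfrak K}_K:\mathcal E_K\to\widetilde{\mathcal M}_K$ that sends $G\binom{m}{d}$ to the coefficient of $X^{m-1}\frac{Y^d}{d!}$ in $\mathfrak B_1$, and $G\binom{k_1,k_2}{d_1,d_2}$, $P\binom{k_1,k_2}{d_1,d_2}$ to the coefficients of $X_1^{k_1-1}X_2^{k_2-1}\frac{Y_1^{d_1}}{d_1!}\frac{Y_2^{d_2}}{d_2!}$ in $\mathfrak B_2$ and $\mathfrak P$, respectively; - the restriction $q\frac d{dq}:\widetilde{\mathcal M}_k\to\widetilde{\mathcal M}_{k+2}$; and they satisfy $$\rho^{\mathfrak K}_{k+2}\circ\partial_k=q\frac{d}{dq}\circ\rho^{\mathfrak K}_k .$$ -/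

import Mathlib

open scoped PowerSeries

noncomputable section

namespace DoubleEisenstein

/-! ### The formal double Eisenstein space -/

/-- The formal symbols `G(k; d)`, `G(k₁,k₂; d₁,d₂)` and `P(k₁,k₂; d₁,d₂)`. -/
inductive Sym : Type
  | G₁ (k d : ℕ) : Sym
  | G₂ (k₁ k₂ d₁ d₂ : ℕ) : Sym
  | P (k₁ k₂ d₁ d₂ : ℕ) : Sym

/-- The symbols that are generators in weight `K`: all upper entries are at least `1`, and the
sum of all entries is `K`. -/
def Sym.IsGenerator (K : ℕ) : Sym → Prop
  | .G₁ k d => 1 ≤ k ∧ k + d = K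
  | .G₂ k₁ k₂ d₁ d₂ => 1 ≤ k₁ ∧ 1 ≤ k₂ ∧ k₁ + k₂ + d₁ + d₂ = K
  | .P k₁ k₂ d₁ d₂ => 1 ≤ k₁ ∧ 1 ≤ k₂ ∧ k₁ + k₂ + d₁ + d₂ = K

/-- The `ℚ`-vector space with basis the generators of weight `K`. -/
abbrev FreeSpace (K : ℕ) : Type := {s : Sym // s.IsGenerator K} →₀ ℚ

open Classical in
/-- The basis vector of a generator of weight `K` (and `0` for any other symbol). -/
def free (K : ℕ) (s : Sym) : FreeSpace K :=
  if h : s.IsGenerator K then Finsupp.single ⟨s, h⟩ 1 else 0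

/-- `G(k₁,k₂; d₁,d₂) + G(k₂,k₁; d₂,d₁) + G(k₁+k₂; d₁+d₂)`. -/
def stuffleSide (K k₁ k₂ d₁ d₂ : ℕ) : FreeSpace K :=
  free K (.G₂ k₁ k₂ d₁ d₂) + free K (.G₂ k₂ k₁ d₂ d₁) + free K (.G₁ (k₁ + k₂) (d₁ + d₂))

/-- The sum over `l₁ + l₂ = k₁ + k₂`, `l₁, l₂ ≥ 1`, and `e₁ + e₂ = d₁ + d₂` of
`(C(l₁-1,k₁-1) C(d₁,e₁) (-1)^(d₁-e₁) + C(l₁-1,k₂-1) C(d₂,e₁) (-1)^(d₂-e₁)) G(l₁,l₂; e₁,e₂)`, plus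
`d₁! d₂! / (d₁+d₂+1)! C(k₁+k₂-2,k₁-1) G(k₁+k₂-1; d₁+d₂+1)`. The exponents of `-1` may be truncated
subtractions, because `C(d,e) = 0` for `e > d`. -/
def shuffleSide (K k₁ k₂ d₁ d₂ : ℕ) : FreeSpace K :=
  (∑ l ∈ (Finset.HasAntidiagonal.antidiagonal (k₁ + k₂)).filter (fun l => 1 ≤ l.1 ∧ 1 ≤ l.2),
    ∑ e ∈ Finset.HasAntidiagonal.antidiagonal (d₁ + d₂),
      (((l.1 - 1).choose (k₁ - 1) : ℚ) * (d₁.choose e.1 : ℚ) * (-1) ^ (d₁ - e.1) +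
        ((l.1 - 1).choose (k₂ - 1) : ℚ) * (d₂.choose e.1 : ℚ) * (-1) ^ (d₂ - e.1)) •
          free K (.G₂ l.1 l.2 e.1 e.2)) +
    ((d₁.factorial : ℚ) * (d₂.factorial : ℚ) / ((d₁ + d₂ + 1).factorial : ℚ) *
      ((k₁ + k₂ - 2).choose (k₁ - 1) : ℚ)) • free K (.G₁ (k₁ + k₂ - 1) (d₁ + d₂ + 1))

/-- The span of the defining relations in weight `K`:
`P(k₁,k₂; d₁,d₂)` equals the stuffle side and equals the shuffle side. -/
def relations (K : ℕ) : Submodule ℚ (FreeSpace K) :=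
  Submodule.span ℚ {r | ∃ k₁ k₂ d₁ d₂ : ℕ, 1 ≤ k₁ ∧ 1 ≤ k₂ ∧ k₁ + k₂ + d₁ + d₂ = K ∧
    (r = free K (.P k₁ k₂ d₁ d₂) - stuffleSide K k₁ k₂ d₁ d₂ ∨
      r = free K (.P k₁ k₂ d₁ d₂) - shuffleSide K k₁ k₂ d₁ d₂)}

/-- The formal double Eisenstein space of weight `K`. -/
abbrev Space (K : ℕ) : Type := FreeSpace K ⧸ relations K

/-- The class in `Space K` of a generator of weight `K`. -/
def gen (K : ℕ) (s : Sym) : Space K := (relations K).mkQ (free K s)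

/-- `∂` is the derivation on weight `K`, given on the generators by `G(k; d) ↦ k G(k+1; d+1)` and
`G(k₁,k₂; d₁,d₂) ↦ k₁ G(k₁+1,k₂; d₁+1,d₂) + k₂ G(k₁,k₂+1; d₁,d₂+1)`.
(The `P`'s are sums of `G`'s by the relations.) -/
def IsDerivation (K : ℕ) (D : Space K →ₗ[ℚ] Space (K + 2)) : Prop :=
  (∀ k d : ℕ, 1 ≤ k → k + d = K →
    D (gen K (.G₁ k d)) = (k : ℚ) • gen (K + 2) (.G₁ (k + 1) (d + 1))) ∧
  (∀ k₁ k₂ d₁ d₂ : ℕ, 1 ≤ k₁ → 1 ≤ k₂ → k₁ + k₂ + d₁ + d₂ = K →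
    D (gen K (.G₂ k₁ k₂ d₁ d₂)) =
      (k₁ : ℚ) • gen (K + 2) (.G₂ (k₁ + 1) k₂ (d₁ + 1) d₂) +
        (k₂ : ℚ) • gen (K + 2) (.G₂ k₁ (k₂ + 1) d₁ (d₂ + 1)))

/-! ### Eisenstein series and quasimodular forms -/

/-- The operator `q d/dq` on `ℚ⟦q⟧`. -/
def qDeriv : ℚ⟦X⟧ →ₗ[ℚ] ℚ⟦X⟧ :=
  LinearMap.mulLeft ℚ (PowerSeries.X : ℚ⟦X⟧) ∘ₗ (PowerSeries.derivative (R := ℚ)).toLinearMap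

/-- The Eisenstein series of weight `k ≥ 1`: zero for odd `k`, and for even `k`
`-B_k / (2 k!) + 1/(k-1)! ∑_{n ≥ 1} n^(k-1) q^n / (1 - q^n)`, where the coefficient of `q^n` in the
last sum is `σ_{k-1}(n)`. -/
def eisenstein (k : ℕ) : ℚ⟦X⟧ :=
  if Odd k then 0 else PowerSeries.mk fun n =>
    if n = 0 then -(bernoulli k) / (2 * (k.factorial : ℚ))
    else (ArithmeticFunction.sigma (k - 1) n : ℚ) / ((k - 1).factorial : ℚ)

/-- The weight `k` part of `ℚ[G₂, G₄, G₆]`. -/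
def quasimodular (k : ℕ) : Submodule ℚ ℚ⟦X⟧ :=
  Submodule.span ℚ {f | ∃ a b c : ℕ, 2 * a + 4 * b + 6 * c = k ∧
    f = eisenstein 2 ^ a * eisenstein 4 ^ b * eisenstein 6 ^ c}

/-! ### Power series in `X₁, X₂, Y₁, Y₂` and the action of `GL₂(ℤ)` -/

/-- `ℚ⟦q⟧⟦X, Y⟧`, with the variables in this order. -/
abbrev Series₁ : Type := MvPowerSeries (Fin 2) ℚ⟦X⟧

/-- `ℚ⟦q⟧⟦X₁, X₂, Y₁, Y₂⟧`, with the variables in this order. -/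
abbrev Series₂ : Type := MvPowerSeries (Fin 4) ℚ⟦X⟧

/-- The exponent of the monomial `X^r Y^s`. -/
def exponent₁ (r s : ℕ) : Fin 2 →₀ ℕ := Finsupp.equivFunOnFinite.symm ![r, s]

/-- The exponent of the monomial `X₁^r₁ X₂^r₂ Y₁^s₁ Y₂^s₂`. -/
def exponent₂ (r₁ r₂ s₁ s₂ : ℕ) : Fin 4 →₀ ℕ := Finsupp.equivFunOnFinite.symm ![r₁, r₂, s₁, s₂]

def X₁ : Series₂ := MvPowerSeries.X 0
def X₂ : Series₂ := MvPowerSeries.X 1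
def Y₁ : Series₂ := MvPowerSeries.X 2
def Y₂ : Series₂ := MvPowerSeries.X 3

/-- The right action `R|γ` of `γ = (a b; c d) ∈ GL₂(ℤ)`:
`(R|γ)(X₁,X₂; Y₁,Y₂) = R(a X₁ + b X₂, c X₁ + d X₂; det γ (d Y₁ - c Y₂), det γ (-b Y₁ + a Y₂))`. -/
def slash (R : Series₂) (γ : GL (Fin 2) ℤ) : Series₂ :=
  MvPowerSeries.subst (S := ℚ⟦X⟧)
    ![γ.1 0 0 • X₁ + γ.1 0 1 • X₂,
      γ.1 1 0 • X₁ + γ.1 1 1 • X₂,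
      γ.1.det • (γ.1 1 1 • Y₁ - γ.1 1 0 • Y₂),
      γ.1.det • (-γ.1 0 1 • Y₁ + γ.1 0 0 • Y₂)] R

def matε : GL (Fin 2) ℤ := ⟨!![0, 1; 1, 0], !![0, 1; 1, 0], by decide, by decide⟩
def matT : GL (Fin 2) ℤ := ⟨!![1, 1; 0, 1], !![1, -1; 0, 1], by decide, by decide⟩
def matU : GL (Fin 2) ℤ := ⟨!![1, -1; 1, 0], !![0, 1; -1, 1], by decide, by decide⟩

/-- `(𝔗(X₁; Y₁+Y₂) - 𝔗(X₂; Y₁+Y₂)) / (X₁ - X₂)`. Since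
`(X₁^n - X₂^n) / (X₁ - X₂) = ∑_{i+j=n-1} X₁^i X₂^j`, its coefficient at `X₁^i X₂^j Y₁^a Y₂^b` is
`C(a+b,a)` times the coefficient of `𝔗` at `X^(i+j+1) Y^(a+b)`. -/
def stuffleQuotient (T : Series₁) : Series₂ := fun n =>
  ((n 2 + n 3).choose (n 2) : ℚ) •
    MvPowerSeries.coeff (exponent₁ (n 0 + n 1 + 1) (n 2 + n 3)) T

/-- `(𝔗(X₁+X₂; Y₁) - 𝔗(X₁+X₂; Y₂)) / (Y₁ - Y₂)`: its coefficient at `X₁^i X₂^j Y₁^a Y₂^b` is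
`C(i+j,i)` times the coefficient of `𝔗` at `X^(i+j) Y^(a+b+1)`. -/
def shuffleQuotient (T : Series₁) : Series₂ := fun n =>
  ((n 0 + n 1).choose (n 0) : ℚ) •
    MvPowerSeries.coeff (exponent₁ (n 0 + n 1) (n 2 + n 3 + 1)) T

/-! ### The Kronecker realization -/

/-- The Kronecker function without its polar part `-(1/X + 1/Y)/2`, i.e. the power series
`∑_{r,s ≥ 0, r+s odd} |r-s|!/r! (q d/dq)^min(r,s) G_{|r-s|+1} X^r Y^s/s!`. -/
def kronecker₁ : Series₁ := fun n =>
  if Odd (n 0 + n 1) then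
    (((Nat.dist (n 0) (n 1)).factorial : ℚ) / (((n 0).factorial : ℚ) * ((n 1).factorial : ℚ))) •
      (qDeriv ^ min (n 0) (n 1)) (eisenstein (Nat.dist (n 0) (n 1) + 1))
  else 0

/-- `𝔓(X₁,X₂; Y₁,Y₂) = 𝔅₁(X₁; Y₁) 𝔅₁(X₂; Y₂)`, where `𝔅₁` is `kronecker₁`. -/
def kroneckerP : Series₂ :=
  MvPowerSeries.subst (S := ℚ⟦X⟧) ![X₁, Y₁] kronecker₁ *
    MvPowerSeries.subst (S := ℚ⟦X⟧) ![X₂, Y₂] kronecker₁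

/-- `𝔅₂ = 1/3 𝔓|(1 + T⁻¹) - 1/12 R^*|(5 - 3U + Uε) - 1/12 R^ш|(T⁻¹(5 - 3ε + U))`, where `R^*` and
`R^ш` are the stuffle and the shuffle quotient of `kronecker₁`. -/
def kronecker₂ : Series₂ :=
  (1 / 3 : ℚ) • (kroneckerP + slash kroneckerP matT⁻¹) -
    (1 / 12 : ℚ) • ((5 : ℚ) • stuffleQuotient kronecker₁ -
      (3 : ℚ) • slash (stuffleQuotient kronecker₁) matU +
      slash (stuffleQuotient kronecker₁) (matU * matε)) -
    (1 / 12 : ℚ) • ((5 : ℚ) • slash (shuffleQuotient kronecker₁) matT⁻¹ -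
      (3 : ℚ) • slash (shuffleQuotient kronecker₁) (matT⁻¹ * matε) +
      slash (shuffleQuotient kronecker₁) (matT⁻¹ * matU))

/-- `ρ` is the Kronecker realization in weight `K`: the generators `G(k; d)`, `G(k₁,k₂; d₁,d₂)` and
`P(k₁,k₂; d₁,d₂)` go to the coefficients of `X^(k-1) Y^d/d!` in `kronecker₁`, and of
`X₁^(k₁-1) X₂^(k₂-1) Y₁^d₁/d₁! Y₂^d₂/d₂!` in `kronecker₂` and in `kroneckerP`. -/
def IsKroneckerRealization (K : ℕ) (ρ : Space K →ₗ[ℚ] quasimodular K) : Prop :=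
  (∀ k d : ℕ, 1 ≤ k → k + d = K →
    (ρ (gen K (.G₁ k d)) : ℚ⟦X⟧) =
      (d.factorial : ℚ) • MvPowerSeries.coeff (exponent₁ (k - 1) d) kronecker₁) ∧
  (∀ k₁ k₂ d₁ d₂ : ℕ, 1 ≤ k₁ → 1 ≤ k₂ → k₁ + k₂ + d₁ + d₂ = K →
    (ρ (gen K (.G₂ k₁ k₂ d₁ d₂)) : ℚ⟦X⟧) =
      ((d₁.factorial : ℚ) * (d₂.factorial : ℚ)) •
        MvPowerSeries.coeff (exponent₂ (k₁ - 1) (k₂ - 1) d₁ d₂) kronecker₂) ∧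
  (∀ k₁ k₂ d₁ d₂ : ℕ, 1 ≤ k₁ → 1 ≤ k₂ → k₁ + k₂ + d₁ + d₂ = K →
    (ρ (gen K (.P k₁ k₂ d₁ d₂)) : ℚ⟦X⟧) =
      ((d₁.factorial : ℚ) * (d₂.factorial : ℚ)) •
        MvPowerSeries.coeff (exponent₂ (k₁ - 1) (k₂ - 1) d₁ d₂) kroneckerP)

/-- `D` is the restriction of `q d/dq` to a map from weight `K` to weight `K + 2`. -/
def IsQDeriv (K : ℕ) (D : quasimodular K →ₗ[ℚ] quasimodular (K + 2)) : Prop :=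
  ∀ f : quasimodular K, (D f : ℚ⟦X⟧) = qDeriv (f : ℚ⟦X⟧)

end DoubleEisenstein

end

/-! Everything happens on generating series. Up to factorials, the relations of `Space K` for the
coefficients of `kronecker₂` say 𝔓 = 𝔅₂ + 𝔅₂|ε + R^* (`kronecker₂_stuffle`) and 𝔓 = 𝔅₂|T + 𝔅₂|Tε +
R^ш (`kronecker₂_shuffle`), because T acts on coefficients by the binomial sums of the shuffle
relation.

Both equations come from a single one, the Fay identity F(x₁,y₁)F(x₂,y₂) = F(x₁x₂,y₁)F(x₂,y₂/y₁) +
F(x₁x₂,y₂)F(x₁,y₁/y₂) for the Kronecker function F(x,y) = (1-xy)/((1-x)(1-y)) + ∑ (x^m y^n - x^(-m)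
y^(-n)) q^(mn). At x = e^X, y = e^Y one has F = 2𝔅₁ - 1/X - 1/Y. The polar parts satisfy the Fay
identity by themselves, and the mixed terms are six difference quotients, each a translate of R^* or
R^ш; this gives `kroneckerP_fay`. The weights in the definition of 𝔅₂ are such that this identity
and its translate by T⁻¹ yield the two equations above.

The Fay identity is elementary (`liouville_identity`, `kroneckerCoeff_fay`). In the coefficient of
q^N each product is a sum over m₁n₁ + m₂n₂ = N. Splitting by the sign of m₁ - m₂ or of n₁ - n₂ makes
the generic terms cancel, and the diagonal terms are geometric sums that account for the products
with the constant term of F.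

Quasimodularity is read off the same identity at Y₁ = Y₂ = 0. It expresses q d/dq of an Eisenstein
series through products and a higher Eisenstein series, and, after eliminating the derivative, every
G_k with even k ≥ 8 through products of lower ones.

The commuting square is a heat equation. On generating series ∂ corresponds to H = ∂²/∂X₁∂Y₁ +
∂²/∂X₂∂Y₂. Since `slash` acts on the Y's by the contragredient of its action on the X's, H commutes
with it (`heat_slash`). As 𝔅₁ satisfies ∂²𝔅₁/∂X∂Y = q d/dq 𝔅₁, the series 𝔓, R^*, R^ш and hence 𝔅₂
satisfy H R = q d/dq R. That ∂ respects the formal relations is checked separately by Pascal-type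
identities (`shuffleValue_derivationValue`). -/

noncomputable section

namespace DoubleEisenstein

/-! ### Linear maps out of the formal double Eisenstein space -/

section FormalSpace

variable {M : Type*} [AddCommGroup M] [Module ℚ M]

theorem sum_filter_one_le_antidiagonal {N : Type*} [AddCommMonoid N] (n : ℕ) (f : ℕ × ℕ → N) :
    ∑ l ∈ (Finset.HasAntidiagonal.antidiagonal (n + 2)).filter (fun l => 1 ≤ l.1 ∧ 1 ≤ l.2), f l =
      ∑ p ∈ Finset.HasAntidiagonal.antidiagonal n, f (p.1 + 1, p.2 + 1) := by
  symm
  refine Finset.sum_bij (fun p _ => (p.1 + 1, p.2 + 1)) ?_ ?_ ?_ ?_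
  · intro p hp
    simp only [Finset.mem_filter, Finset.HasAntidiagonal.mem_antidiagonal] at hp ⊢
    omega
  · intro p _ p' _ h
    simp only [Prod.mk.injEq] at h
    ext <;> omega
  · intro l hl
    simp only [Finset.mem_filter, Finset.HasAntidiagonal.mem_antidiagonal] at hl
    refine ⟨(l.1 - 1, l.2 - 1), ?_, ?_⟩
    · simp only [Finset.HasAntidiagonal.mem_antidiagonal]; omega
    · ext <;> simp <;> omega
  · intro p _; rfl

theorem gen_P_eq_stuffleSide {K k₁ k₂ d₁ d₂ : ℕ} (h₁ : 1 ≤ k₁) (h₂ : 1 ≤ k₂)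
    (h : k₁ + k₂ + d₁ + d₂ = K) :
    gen K (.P k₁ k₂ d₁ d₂) = (relations K).mkQ (stuffleSide K k₁ k₂ d₁ d₂) := by
  rw [gen, ← sub_eq_zero, ← map_sub, Submodule.mkQ_apply, Submodule.Quotient.mk_eq_zero]
  exact Submodule.subset_span ⟨k₁, k₂, d₁, d₂, h₁, h₂, h, Or.inl rfl⟩

theorem gen_P_eq_shuffleSide {K k₁ k₂ d₁ d₂ : ℕ} (h₁ : 1 ≤ k₁) (h₂ : 1 ≤ k₂)
    (h : k₁ + k₂ + d₁ + d₂ = K) :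
    gen K (.P k₁ k₂ d₁ d₂) = (relations K).mkQ (shuffleSide K k₁ k₂ d₁ d₂) := by
  rw [gen, ← sub_eq_zero, ← map_sub, Submodule.mkQ_apply, Submodule.Quotient.mk_eq_zero]
  exact Submodule.subset_span ⟨k₁, k₂, d₁, d₂, h₁, h₂, h, Or.inr rfl⟩

theorem gen_P_stuffle {K k₁ k₂ d₁ d₂ : ℕ} (h₁ : 1 ≤ k₁) (h₂ : 1 ≤ k₂)
    (h : k₁ + k₂ + d₁ + d₂ = K) :
    gen K (.P k₁ k₂ d₁ d₂) =
      gen K (.G₂ k₁ k₂ d₁ d₂) + gen K (.G₂ k₂ k₁ d₂ d₁) + gen K (.G₁ (k₁ + k₂) (d₁ + d₂)) := by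
  rw [gen_P_eq_stuffleSide h₁ h₂ h, stuffleSide, map_add, map_add]
  rfl

/-- One of the two halves of the coefficient of a double symbol in the shuffle relation, with
upper entries shifted by one. -/
def shuffleCoeff (i d l e : ℕ) : ℚ := (l.choose i : ℚ) * (d.choose e : ℚ) * (-1) ^ (d - e)

/-- The shuffle side of the relation for `P(i+1,j+1; d₁,d₂)` in terms of arbitrary values of
the symbols. -/
def shuffleValue (φ : Sym → M) (i j d₁ d₂ : ℕ) : M :=
  (∑ p ∈ Finset.HasAntidiagonal.antidiagonal (i + j),
    ∑ e ∈ Finset.HasAntidiagonal.antidiagonal (d₁ + d₂),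
      (shuffleCoeff i d₁ p.1 e.1 + shuffleCoeff j d₂ p.1 e.1) •
        φ (.G₂ (p.1 + 1) (p.2 + 1) e.1 e.2)) +
    ((d₁.factorial : ℚ) * (d₂.factorial : ℚ) / ((d₁ + d₂ + 1).factorial : ℚ) *
      ((i + j).choose i : ℚ)) • φ (.G₁ (i + j + 1) (d₁ + d₂ + 1))

theorem shuffleSide_eq (K i j d₁ d₂ : ℕ) :
    shuffleSide K (i + 1) (j + 1) d₁ d₂ = shuffleValue (free K) i j d₁ d₂ := by
  have e : i + 1 + (j + 1) = i + j + 2 := by omega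
  rw [shuffleSide, shuffleValue, e, sum_filter_one_le_antidiagonal]
  rfl

theorem map_shuffleValue {N : Type*} [AddCommGroup N] [Module ℚ N] (f : M →ₗ[ℚ] N) (φ : Sym → M)
    (i j d₁ d₂ : ℕ) : f (shuffleValue φ i j d₁ d₂) = shuffleValue (f ∘ φ) i j d₁ d₂ := by
  simp only [shuffleValue, map_add, map_sum, map_smul, Function.comp_apply]

theorem shuffleValue_congr {φ ψ : Sym → M} {K i j d₁ d₂ : ℕ} (hK : i + 1 + (j + 1) + d₁ + d₂ = K)
    (h : ∀ s : Sym, s.IsGenerator K → φ s = ψ s) :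
    shuffleValue φ i j d₁ d₂ = shuffleValue ψ i j d₁ d₂ := by
  unfold shuffleValue
  congr 1
  · refine Finset.sum_congr rfl fun p hp => Finset.sum_congr rfl fun e he => ?_
    rw [Finset.HasAntidiagonal.mem_antidiagonal] at hp he
    rw [h]
    exact ⟨by omega, by omega, by omega⟩
  · rw [h]
    exact ⟨by omega, by omega⟩

theorem gen_P_shuffle {K i j d₁ d₂ : ℕ} (h : i + 1 + (j + 1) + d₁ + d₂ = K) :
    gen K (.P (i + 1) (j + 1) d₁ d₂) = shuffleValue (gen K) i j d₁ d₂ := by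
  rw [gen_P_eq_shuffleSide (by omega) (by omega) h, shuffleSide_eq, map_shuffleValue]
  rfl

/-- Linear maps out of `Space K` are given by values on the symbols that satisfy the relations. -/
theorem exists_linearMap_of_relations (K : ℕ) (φ : Sym → M)
    (hst : ∀ i j d₁ d₂ : ℕ, i + 1 + (j + 1) + d₁ + d₂ = K →
      φ (.P (i + 1) (j + 1) d₁ d₂) = φ (.G₂ (i + 1) (j + 1) d₁ d₂) +
        φ (.G₂ (j + 1) (i + 1) d₂ d₁) + φ (.G₁ (i + j + 2) (d₁ + d₂)))
    (hsh : ∀ i j d₁ d₂ : ℕ, i + 1 + (j + 1) + d₁ + d₂ = K →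
      φ (.P (i + 1) (j + 1) d₁ d₂) = shuffleValue φ i j d₁ d₂) :
    ∃ f : Space K →ₗ[ℚ] M, ∀ s : Sym, s.IsGenerator K → f (gen K s) = φ s := by
  set F : FreeSpace K →ₗ[ℚ] M := Finsupp.linearCombination ℚ (fun s => φ s.1)
  have hF : ∀ s : Sym, s.IsGenerator K → F (free K s) = φ s := by
    intro s hs
    simp [F, free, dif_pos hs]
  have hle : relations K ≤ LinearMap.ker F := by
    rw [relations, Submodule.span_le]
    rintro r ⟨k₁, k₂, d₁, d₂, h₁, h₂, h, hr⟩
    obtain ⟨i, rfl⟩ : ∃ i, k₁ = i + 1 := ⟨k₁ - 1, by omega⟩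
    obtain ⟨j, rfl⟩ : ∃ j, k₂ = j + 1 := ⟨k₂ - 1, by omega⟩
    rw [SetLike.mem_coe, LinearMap.mem_ker]
    rcases hr with rfl | rfl
    · have e : i + 1 + (j + 1) = i + j + 2 := by omega
      rw [map_sub, hF (.P _ _ _ _) ⟨h₁, h₂, h⟩, hst i j d₁ d₂ h, stuffleSide, map_add, map_add,
        hF (.G₂ (i + 1) (j + 1) d₁ d₂) ⟨h₁, h₂, h⟩, hF (.G₂ (j + 1) (i + 1) d₂ d₁) ⟨h₂, h₁, by omega⟩,
        hF (.G₁ _ _) ⟨by omega, by omega⟩, e, sub_self]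
    · rw [map_sub, hF (.P _ _ _ _) ⟨h₁, h₂, h⟩, hsh i j d₁ d₂ h, shuffleSide_eq, map_shuffleValue, sub_eq_zero]
      exact (shuffleValue_congr h fun s hs => hF s hs).symm
  exact ⟨(relations K).liftQ F hle, fun s hs => by
    rw [gen, Submodule.mkQ_apply, Submodule.liftQ_apply, hF s hs]⟩

/-- A linear map out of `Space K` is determined by its values on the `G`'s. -/
theorem linearMap_ext_gen {K : ℕ} {f g : Space K →ₗ[ℚ] M}
    (h₁ : ∀ k d : ℕ, 1 ≤ k → k + d = K → f (gen K (.G₁ k d)) = g (gen K (.G₁ k d)))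
    (h₂ : ∀ k₁ k₂ d₁ d₂ : ℕ, 1 ≤ k₁ → 1 ≤ k₂ → k₁ + k₂ + d₁ + d₂ = K →
      f (gen K (.G₂ k₁ k₂ d₁ d₂)) = g (gen K (.G₂ k₁ k₂ d₁ d₂))) : f = g := by
  apply Submodule.linearMap_qext
  apply Finsupp.lhom_ext'
  rintro ⟨s, hs⟩
  ext
  have key : f (gen K s) = g (gen K s) := by
    cases s with
    | G₁ k d => exact h₁ k d hs.1 hs.2
    | G₂ k₁ k₂ d₁ d₂ => exact h₂ k₁ k₂ d₁ d₂ hs.1 hs.2.1 hs.2.2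
    | P k₁ k₂ d₁ d₂ =>
      obtain ⟨a, b, c⟩ := hs
      -- The stuffle relation eliminates the P's, so values on the G's determine the map.
      rw [gen_P_stuffle a b c]
      simp only [map_add]
      rw [h₂ _ _ _ _ a b c, h₂ _ _ _ _ b a (by omega), h₁ _ _ (by omega) (by omega)]
  simpa [gen, free, dif_pos hs] using key

end FormalSpace

/-! ### The derivation on the formal space -/

section Derivation

variable {M : Type*} [AddCommGroup M] [Module ℚ M]

/-- d - e and d + e have the same parity for e ≤ d, and the binomial vanishes otherwise. This
removes the truncated subtraction from later computations. -/
theorem shuffleCoeff_eq (i d l e : ℕ) :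
    shuffleCoeff i d l e = (l.choose i : ℚ) * (d.choose e : ℚ) * (-1) ^ (d + e) := by
  rw [shuffleCoeff]
  rcases le_or_gt e d with h | h
  · obtain ⟨c, rfl⟩ := Nat.exists_eq_add_of_le h
    have : e + c + e = c + 2 * e := by ring
    rw [Nat.add_sub_cancel_left, this, pow_add, pow_mul]
    simp
  · simp [Nat.choose_eq_zero_of_lt h]

theorem succ_mul_choose_succ_rat (l i : ℕ) :
    ((i : ℚ) + 1) * (l.choose (i + 1) : ℚ) = ((l : ℚ) - i) * (l.choose i : ℚ) := by
  rcases le_or_gt i l with h | h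
  · have := Nat.choose_succ_right_eq l i
    rw [← Nat.cast_sub h, ← Nat.cast_succ]
    rw [mul_comm, mul_comm _ (l.choose i : ℚ)]
    exact_mod_cast this
  · simp [Nat.choose_eq_zero_of_lt h, Nat.choose_eq_zero_of_lt (Nat.lt_succ_of_lt h)]

/-- The two halves of the shuffle coefficient never interact, so compatibility of ∂ with the shuffle
relation can be checked for one half. The other half is the same statement with i and j exchanged.
-/
theorem sum_shuffleCoeff_derivation (g : ℕ → ℕ → ℕ → ℕ → M) (i j d D : ℕ) (hD : d ≤ D) :
    ∑ p ∈ Finset.HasAntidiagonal.antidiagonal (i + j + 1),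
      ∑ e ∈ Finset.HasAntidiagonal.antidiagonal (D + 1),
        (((i : ℚ) + 1) * shuffleCoeff (i + 1) (d + 1) p.1 e.1 +
          ((j : ℚ) + 1) * shuffleCoeff i d p.1 e.1) • g p.1 p.2 e.1 e.2 =
    ∑ p ∈ Finset.HasAntidiagonal.antidiagonal (i + j),
      ∑ e ∈ Finset.HasAntidiagonal.antidiagonal D, shuffleCoeff i d p.1 e.1 •
        (((p.1 : ℚ) + 1) • g (p.1 + 1) p.2 (e.1 + 1) e.2 +
          ((p.2 : ℚ) + 1) • g p.1 (p.2 + 1) e.1 (e.2 + 1)) := by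
  -- Shifts p.1 and e.1 by one, using (l+1) C(l,i) = (i+1) C(l+1,i+1) and C(d,e) = C(d+1,e+1) -
  -- C(d,e+1). The extra boundary terms p.1 = 0 and e.1 = 0 vanish.
  have hA : ∑ p ∈ Finset.HasAntidiagonal.antidiagonal (i + j + 1),
      ∑ e ∈ Finset.HasAntidiagonal.antidiagonal (D + 1),
        (((i : ℚ) + 1) * (p.1.choose (i + 1) : ℚ) *
          (((d + 1).choose e.1 : ℚ) - (d.choose e.1 : ℚ)) * (-1) ^ (d + 1 + e.1)) •
            g p.1 p.2 e.1 e.2 =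
      ∑ p ∈ Finset.HasAntidiagonal.antidiagonal (i + j),
        ∑ e ∈ Finset.HasAntidiagonal.antidiagonal D, (shuffleCoeff i d p.1 e.1 *
          ((p.1 : ℚ) + 1)) • g (p.1 + 1) p.2 (e.1 + 1) e.2 := by
    rw [Finset.Nat.sum_antidiagonal_succ]
    simp only [Nat.choose_zero_succ, Nat.cast_zero, mul_zero, zero_mul, zero_smul,
      Finset.sum_const_zero, zero_add]
    refine Finset.sum_congr rfl fun p _ => ?_
    rw [Finset.Nat.sum_antidiagonal_succ]
    simp only [Nat.choose_zero_right, sub_self, mul_zero, zero_mul, zero_smul, zero_add]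
    refine Finset.sum_congr rfl fun e _ => ?_
    congr 1
    have h1 : ((i : ℚ) + 1) * ((p.1 + 1).choose (i + 1) : ℚ) = ((p.1 : ℚ) + 1) * p.1.choose i := by
      have := Nat.add_one_mul_choose_eq p.1 i
      rw [mul_comm]
      exact_mod_cast this.symm
    rw [h1, shuffleCoeff_eq, Nat.choose_succ_succ']
    push_cast
    ring
  have hB : ∑ p ∈ Finset.HasAntidiagonal.antidiagonal (i + j + 1),
      ∑ e ∈ Finset.HasAntidiagonal.antidiagonal (D + 1),
        ((p.2 : ℚ) * shuffleCoeff i d p.1 e.1) • g p.1 p.2 e.1 e.2 =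
      ∑ p ∈ Finset.HasAntidiagonal.antidiagonal (i + j),
        ∑ e ∈ Finset.HasAntidiagonal.antidiagonal D, (shuffleCoeff i d p.1 e.1 *
          ((p.2 : ℚ) + 1)) • g p.1 (p.2 + 1) e.1 (e.2 + 1) := by
    rw [Finset.Nat.sum_antidiagonal_succ']
    simp only [Nat.cast_zero, zero_mul, zero_smul, Finset.sum_const_zero, zero_add]
    refine Finset.sum_congr rfl fun p _ => ?_
    rw [Finset.Nat.sum_antidiagonal_succ']
    -- The boundary term e.2 = 0 has e.1 = D + 1; it disappears because d ≤ D.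
    have h0 : d.choose (D + 1) = 0 := Nat.choose_eq_zero_of_lt (by omega)
    simp only [shuffleCoeff_eq, h0, Nat.cast_zero, mul_zero, zero_mul, zero_smul, zero_add]
    refine Finset.sum_congr rfl fun e _ => ?_
    congr 1
    push_cast
    ring
  simp only [smul_add, smul_smul, Finset.sum_add_distrib]
  rw [← hA, ← hB, ← Finset.sum_add_distrib]
  refine Finset.sum_congr rfl fun p hp => ?_
  rw [← Finset.sum_add_distrib]
  refine Finset.sum_congr rfl fun e _ => ?_
  rw [← add_smul]
  congr 1
  rw [Finset.HasAntidiagonal.mem_antidiagonal] at hp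
  have hp' : (p.1 : ℚ) + p.2 = i + j + 1 := by exact_mod_cast hp
  rw [shuffleCoeff_eq, shuffleCoeff_eq]
  have h2 := succ_mul_choose_succ_rat p.1 i
  have h3 : (p.2 : ℚ) = i + j + 1 - p.1 := by linarith
  rw [h3]
  have h4 : ((-1 : ℚ)) ^ (d + 1 + e.1) = - (-1) ^ (d + e.1) := by ring
  rw [h4]
  linear_combination (-(-1 : ℚ) ^ (d + e.1) * (d.choose e.1 : ℚ)) * h2

/-- The image of a symbol under the derivation, in terms of arbitrary values of the symbols. -/
def derivationValue (φ : Sym → M) : Sym → M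
  | .G₁ k d => (k : ℚ) • φ (.G₁ (k + 1) (d + 1))
  | .G₂ k₁ k₂ d₁ d₂ => (k₁ : ℚ) • φ (.G₂ (k₁ + 1) k₂ (d₁ + 1) d₂) +
      (k₂ : ℚ) • φ (.G₂ k₁ (k₂ + 1) d₁ (d₂ + 1))
  | .P k₁ k₂ d₁ d₂ => (k₁ : ℚ) • φ (.P (k₁ + 1) k₂ (d₁ + 1) d₂) +
      (k₂ : ℚ) • φ (.P k₁ (k₂ + 1) d₁ (d₂ + 1))

/-- Says that ∂ may be applied to P by the same formula as to a double G without violating the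
shuffle relation. The values of φ are arbitrary, so this is purely an identity between coefficients.
-/
theorem shuffleValue_derivationValue (φ : Sym → M) (i j d₁ d₂ : ℕ) :
    shuffleValue (derivationValue φ) i j d₁ d₂ =
      ((i : ℚ) + 1) • shuffleValue φ (i + 1) j (d₁ + 1) d₂ +
        ((j : ℚ) + 1) • shuffleValue φ i (j + 1) d₁ (d₂ + 1) := by
  have e1 : i + 1 + j = i + j + 1 := by omega
  have e2 : i + (j + 1) = i + j + 1 := by omega
  have e3 : d₁ + 1 + d₂ = d₁ + d₂ + 1 := by omega
  have e4 : d₁ + (d₂ + 1) = d₁ + d₂ + 1 := by omega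
  set g : ℕ → ℕ → ℕ → ℕ → M := fun l l' e e' => φ (.G₂ (l + 1) (l' + 1) e e') with hg
  have k1 := sum_shuffleCoeff_derivation g i j d₁ (d₁ + d₂) (by omega)
  have k2 := sum_shuffleCoeff_derivation g j i d₂ (d₁ + d₂) (by omega)
  rw [show j + i = i + j by omega] at k2
  simp only [shuffleValue, e1, e2, e3, e4, derivationValue, Nat.cast_add, Nat.cast_one]
  rw [smul_add, smul_add, add_add_add_comm]
  congr 1
  · simp only [add_smul (shuffleCoeff _ _ _ _), Finset.sum_add_distrib (M := M)]
    rw [← k1, ← k2]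
    simp only [← Finset.sum_add_distrib, Finset.smul_sum]
    refine Finset.sum_congr rfl fun p _ => Finset.sum_congr rfl fun e _ => ?_
    simp only [hg]
    module
  · rw [smul_smul, smul_smul, smul_smul, ← add_smul]
    congr 1
    have h1 : ((i : ℚ) + 1) * ((i + j + 1).choose (i + 1) : ℚ) =
        ((i : ℚ) + j + 1) * (i + j).choose i := by
      have := Nat.add_one_mul_choose_eq (i + j) i
      rw [mul_comm]
      exact_mod_cast this.symm
    have h2 : ((j : ℚ) + 1) * ((i + j + 1).choose i : ℚ) =
        ((i : ℚ) + j + 1) * (i + j).choose i := by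
      have := Nat.add_one_mul_choose_eq (i + j) j
      rw [Nat.choose_symm_of_eq_add (show i + j + 1 = (j + 1) + i by omega),
        Nat.choose_symm_of_eq_add (show i + j = j + i by omega)] at this
      rw [mul_comm]
      exact_mod_cast this.symm
    have h3 : ((d₁ + d₂ + 1 + 1).factorial : ℚ) = (d₁ + d₂ + 2) * (d₁ + d₂ + 1).factorial := by
      rw [Nat.factorial_succ]; push_cast; ring
    have h4 : ((d₁ + d₂ + 1).factorial : ℚ) ≠ 0 := by positivity
    have h5 : (d₁ : ℚ) + d₂ + 2 ≠ 0 := by positivity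
    rw [h3, Nat.factorial_succ d₁, Nat.factorial_succ d₂]
    push_cast
    field_simp
    -- The two binomials reduce to the same one, and the weights d₁ + 1 and d₂ + 1 add up to the
    -- factor d₁ + d₂ + 2 by which the factorial in the denominator has grown.
    linear_combination (-((d₁ : ℚ) + 1)) * h1 - ((d₂ : ℚ) + 1) * h2

theorem exists_isDerivation (K : ℕ) : ∃ D, IsDerivation K D := by
  suffices h : ∃ f : Space K →ₗ[ℚ] Space (K + 2),
      ∀ s : Sym, s.IsGenerator K → f (gen K s) = derivationValue (gen (K + 2)) s by
    obtain ⟨f, hf⟩ := h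
    refine ⟨f, fun k d hk h => ?_, fun k₁ k₂ d₁ d₂ h₁ h₂ h => ?_⟩
    · rw [hf (.G₁ k d) ⟨hk, h⟩, derivationValue]
    · rw [hf (.G₂ k₁ k₂ d₁ d₂) ⟨h₁, h₂, h⟩, derivationValue]
  apply exists_linearMap_of_relations
  · intro i j d₁ d₂ h
    simp only [derivationValue]
    rw [gen_P_stuffle (by omega) (by omega) (by omega),
      gen_P_stuffle (by omega) (by omega) (by omega)]
    rw [show i + 1 + 1 + (j + 1) = i + j + 2 + 1 by omega,
      show i + 1 + (j + 1 + 1) = i + j + 2 + 1 by omega,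
      show d₁ + 1 + d₂ = d₁ + d₂ + 1 by omega, show d₁ + (d₂ + 1) = d₁ + d₂ + 1 by omega]
    push_cast
    module
  · intro i j d₁ d₂ h
    rw [shuffleValue_derivationValue, derivationValue]
    rw [gen_P_shuffle (by omega), gen_P_shuffle (by omega)]
    push_cast
    rfl

theorem isDerivation_unique {K : ℕ} {D D' : Space K →ₗ[ℚ] Space (K + 2)} (h : IsDerivation K D)
    (h' : IsDerivation K D') : D = D' :=
  linearMap_ext_gen (fun k d hk hd => by rw [h.1 k d hk hd, h'.1 k d hk hd])
    (fun k₁ k₂ d₁ d₂ a b c => by rw [h.2 _ _ _ _ a b c, h'.2 _ _ _ _ a b c])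

end Derivation

/-! ### Sums over solutions of `m₁ n₁ + m₂ n₂ = N` -/

section Liouville

open Finset

variable {M : Type*} [AddCommGroup M]

/-- The positive solutions `((m₁, n₁), (m₂, n₂))` of `m₁ n₁ + m₂ n₂ = N`. -/
def liouvilleSet (N : ℕ) : Finset ((ℕ × ℕ) × (ℕ × ℕ)) :=
  ((Icc 1 N ×ˢ Icc 1 N) ×ˢ (Icc 1 N ×ˢ Icc 1 N)).filter
    fun w => w.1.1 * w.1.2 + w.2.1 * w.2.2 = N

/-- The positive solutions `((c, m), (a, b))` of `c a + m a + m b = N`. -/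
def staircaseSet (N : ℕ) : Finset ((ℕ × ℕ) × (ℕ × ℕ)) :=
  ((Icc 1 N ×ˢ Icc 1 N) ×ˢ (Icc 1 N ×ˢ Icc 1 N)).filter
    fun u => u.1.1 * u.2.1 + u.1.2 * u.2.1 + u.1.2 * u.2.2 = N

/-- The pairs of positive integers with sum `n`. -/
def posAntidiagonal (n : ℕ) : Finset (ℕ × ℕ) :=
  (HasAntidiagonal.antidiagonal n).filter fun p => 1 ≤ p.1 ∧ 1 ≤ p.2

theorem mem_liouvilleSet {N : ℕ} {w : (ℕ × ℕ) × (ℕ × ℕ)} : w ∈ liouvilleSet N ↔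
    (1 ≤ w.1.1 ∧ 1 ≤ w.1.2 ∧ 1 ≤ w.2.1 ∧ 1 ≤ w.2.2) ∧ w.1.1 * w.1.2 + w.2.1 * w.2.2 = N := by
  simp only [liouvilleSet, mem_filter, mem_product, mem_Icc]
  constructor
  · rintro ⟨h, h'⟩; exact ⟨⟨h.1.1.1, h.1.2.1, h.2.1.1, h.2.2.1⟩, h'⟩
  · rintro ⟨⟨h1, h2, h3, h4⟩, h⟩
    have e1 := Nat.le_mul_of_pos_right w.1.1 h2
    have e2 := Nat.le_mul_of_pos_left w.1.2 h1
    have e3 := Nat.le_mul_of_pos_right w.2.1 h4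
    have e4 := Nat.le_mul_of_pos_left w.2.2 h3
    exact ⟨⟨⟨⟨h1, by omega⟩, ⟨h2, by omega⟩⟩, ⟨⟨h3, by omega⟩, ⟨h4, by omega⟩⟩⟩, h⟩

theorem mem_staircaseSet {N : ℕ} {u : (ℕ × ℕ) × (ℕ × ℕ)} : u ∈ staircaseSet N ↔
    (1 ≤ u.1.1 ∧ 1 ≤ u.1.2 ∧ 1 ≤ u.2.1 ∧ 1 ≤ u.2.2) ∧
      u.1.1 * u.2.1 + u.1.2 * u.2.1 + u.1.2 * u.2.2 = N := by
  simp only [staircaseSet, mem_filter, mem_product, mem_Icc]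
  constructor
  · rintro ⟨h, h'⟩; exact ⟨⟨h.1.1.1, h.1.2.1, h.2.1.1, h.2.2.1⟩, h'⟩
  · rintro ⟨⟨h1, h2, h3, h4⟩, h⟩
    have e1 := Nat.le_mul_of_pos_right u.1.1 h3
    have e2 := Nat.le_mul_of_pos_left u.2.1 h1
    have e3 := Nat.le_mul_of_pos_right u.1.2 h4
    have e4 := Nat.le_mul_of_pos_left u.2.2 h2
    exact ⟨⟨⟨⟨h1, by omega⟩, ⟨h2, by omega⟩⟩, ⟨⟨h3, by omega⟩, ⟨h4, by omega⟩⟩⟩, h⟩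

theorem mem_posAntidiagonal {n : ℕ} {p : ℕ × ℕ} :
    p ∈ posAntidiagonal n ↔ p.1 + p.2 = n ∧ 1 ≤ p.1 ∧ 1 ≤ p.2 := by
  simp [posAntidiagonal]

/-- The Cauchy product of two Lambert series: a splitting N = N₁ + N₂ with factorizations of N₁ and
N₂ is a solution of m₁n₁ + m₂n₂ = N. -/
theorem sum_antidiagonal_divisors (N : ℕ) (f : ℕ × ℕ → ℕ × ℕ → M) :
    ∑ i ∈ HasAntidiagonal.antidiagonal N, ∑ p ∈ i.1.divisorsAntidiagonal,
      ∑ r ∈ i.2.divisorsAntidiagonal, f p r = ∑ w ∈ liouvilleSet N, f w.1 w.2 := by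
  simp only [← sum_product', sum_sigma']
  refine sum_bij (fun s _ => s.2) ?_ ?_ ?_ ?_
  · rintro ⟨i, p, r⟩ h
    simp only [mem_sigma, HasAntidiagonal.mem_antidiagonal, mem_product,
      Nat.mem_divisorsAntidiagonal] at h
    obtain ⟨h0, ⟨h1, h1'⟩, h2, h2'⟩ := h
    rw [mem_liouvilleSet]
    refine ⟨⟨?_, ?_, ?_, ?_⟩, by simp only; omega⟩ <;> rw [Nat.one_le_iff_ne_zero] <;>
      rintro h3 <;> simp only at h3 <;> simp_all
  · rintro ⟨⟨i, i'⟩, p, r⟩ h ⟨⟨j, j'⟩, p', r'⟩ h' e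
    simp only [mem_sigma, HasAntidiagonal.mem_antidiagonal, mem_product,
      Nat.mem_divisorsAntidiagonal] at h h' e
    simp only [Prod.mk.injEq] at e
    obtain ⟨rfl, rfl⟩ := e
    obtain ⟨h0, ⟨h1, h1'⟩, h2, h2'⟩ := h
    obtain ⟨h0', ⟨h3, h3'⟩, h4, h4'⟩ := h'
    subst h1 h2 h3 h4
    rfl
  · rintro ⟨p, r⟩ h
    rw [mem_liouvilleSet] at h
    obtain ⟨⟨h1, h2, h3, h4⟩, h⟩ := h
    refine ⟨⟨(p.1 * p.2, r.1 * r.2), p, r⟩, ?_, rfl⟩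
    simp only [mem_sigma, HasAntidiagonal.mem_antidiagonal, mem_product,
      Nat.mem_divisorsAntidiagonal]
    simp only at h1 h2 h3 h4
    exact ⟨h, ⟨trivial, by positivity⟩, trivial, by positivity⟩
  · intros; rfl

/-- Splitting the solutions of `m₁ n₁ + m₂ n₂ = N` according to the sign of `m₁ - m₂`. -/
theorem sum_liouvilleSet_split_left (N : ℕ) (f : ℕ → ℕ → ℕ → ℕ → M) :
    ∑ w ∈ liouvilleSet N, f w.1.1 w.1.2 w.2.1 w.2.2 =
      ∑ u ∈ staircaseSet N, (f (u.1.1 + u.1.2) u.2.1 u.1.2 u.2.2 +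
        f u.1.2 u.2.2 (u.1.1 + u.1.2) u.2.1) +
      ∑ p ∈ N.divisorsAntidiagonal, ∑ q ∈ posAntidiagonal p.2, f p.1 q.1 p.1 q.2 := by
  rw [← sum_filter_add_sum_filter_not (liouvilleSet N) (fun w => w.1.1 = w.2.1),
    ← sum_filter_add_sum_filter_not ((liouvilleSet N).filter fun w => ¬ w.1.1 = w.2.1)
      (fun w => w.2.1 < w.1.1), filter_filter, filter_filter, add_comm, sum_add_distrib]
  congr 1
  · congr 1
    · symm
      refine sum_bij (fun u _ => ((u.1.1 + u.1.2, u.2.1), (u.1.2, u.2.2))) ?_ ?_ ?_ ?_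
      · rintro ⟨⟨c, m⟩, a, b⟩ h
        rw [mem_staircaseSet] at h
        simp only [mem_filter, mem_liouvilleSet] at h ⊢
        refine ⟨⟨⟨by omega, by omega, by omega, by omega⟩, ?_⟩, by omega, by omega⟩
        rw [← h.2]; ring
      · rintro ⟨⟨c, m⟩, a, b⟩ _ ⟨⟨c', m'⟩, a', b'⟩ _ e
        simp only [Prod.mk.injEq] at e ⊢
        omega
      · rintro ⟨⟨m₁, n₁⟩, m₂, n₂⟩ h
        simp only [mem_filter, mem_liouvilleSet] at h
        obtain ⟨c, rfl⟩ := Nat.exists_eq_add_of_lt h.2.2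
        refine ⟨((c + 1, m₂), (n₁, n₂)), ?_, ?_⟩
        · rw [mem_staircaseSet]
          dsimp only
          refine ⟨⟨by omega, by omega, by omega, by omega⟩, ?_⟩
          rw [← h.1.2]; ring
        · rw [show m₂ + c + 1 = c + 1 + m₂ by omega]
      · intros; rfl
    · symm
      refine sum_bij (fun u _ => ((u.1.2, u.2.2), (u.1.1 + u.1.2, u.2.1))) ?_ ?_ ?_ ?_
      · rintro ⟨⟨c, m⟩, a, b⟩ h
        rw [mem_staircaseSet] at h
        simp only [mem_filter, mem_liouvilleSet] at h ⊢
        refine ⟨⟨⟨by omega, by omega, by omega, by omega⟩, ?_⟩, by omega, by omega⟩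
        rw [← h.2]; ring
      · rintro ⟨⟨c, m⟩, a, b⟩ _ ⟨⟨c', m'⟩, a', b'⟩ _ e
        simp only [Prod.mk.injEq] at e ⊢
        omega
      · rintro ⟨⟨m₁, n₁⟩, m₂, n₂⟩ h
        simp only [mem_filter, mem_liouvilleSet] at h
        obtain ⟨c, rfl⟩ := Nat.exists_eq_add_of_lt (show m₁ < m₂ by omega)
        refine ⟨((c + 1, m₁), (n₂, n₁)), ?_, ?_⟩
        · rw [mem_staircaseSet]
          dsimp only
          refine ⟨⟨by omega, by omega, by omega, by omega⟩, ?_⟩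
          rw [← h.1.2]; ring
        · rw [show m₁ + c + 1 = c + 1 + m₁ by omega]
      · intros; rfl
  · symm
    rw [sum_sigma']
    refine sum_bij (fun s _ => ((s.1.1, s.2.1), (s.1.1, s.2.2))) ?_ ?_ ?_ ?_
    · rintro ⟨⟨m, n⟩, a, b⟩ h
      simp only [mem_sigma, Nat.mem_divisorsAntidiagonal, mem_posAntidiagonal] at h
      simp only [mem_filter, mem_liouvilleSet]
      obtain ⟨⟨h1, h2⟩, h3, h4⟩ := h
      have : 1 ≤ m := by
        rw [Nat.one_le_iff_ne_zero]; rintro rfl; simp at h1; exact h2 h1.symm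
      refine ⟨⟨⟨by omega, by omega, by omega, by omega⟩, ?_⟩, trivial⟩
      rw [← h1, ← h3]; ring
    · rintro ⟨⟨m, n⟩, a, b⟩ h ⟨⟨m', n'⟩, a', b'⟩ h' e
      simp only [mem_sigma, Nat.mem_divisorsAntidiagonal, mem_posAntidiagonal] at h h'
      simp only [Prod.mk.injEq] at e
      obtain ⟨⟨rfl, rfl⟩, -, rfl⟩ := e
      obtain rfl : n = n' := by rw [← h.2.1, ← h'.2.1]
      rfl
    · rintro ⟨⟨m₁, n₁⟩, m₂, n₂⟩ h
      simp only [mem_filter, mem_liouvilleSet] at h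
      obtain ⟨⟨h1, h2⟩, rfl⟩ := h
      refine ⟨⟨(m₁, n₁ + n₂), n₁, n₂⟩, ?_, rfl⟩
      simp only [mem_sigma, Nat.mem_divisorsAntidiagonal, mem_posAntidiagonal]
      have h3 : 0 < m₁ * n₁ := Nat.mul_pos h1.1 h1.2.1
      exact ⟨⟨by rw [← h2]; ring, by omega⟩, trivial, h1.2.1, h1.2.2.2⟩
    · intros; rfl

/-- Splitting the solutions of `m₁ n₁ + m₂ n₂ = N` according to the sign of `n₁ - n₂`. -/
theorem sum_liouvilleSet_split_right (N : ℕ) (f : ℕ → ℕ → ℕ → ℕ → M) :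
    ∑ w ∈ liouvilleSet N, f w.1.1 w.1.2 w.2.1 w.2.2 =
      ∑ u ∈ staircaseSet N, (f u.1.2 (u.2.1 + u.2.2) u.1.1 u.2.1 +
        f u.1.1 u.2.1 u.1.2 (u.2.1 + u.2.2)) +
      ∑ p ∈ N.divisorsAntidiagonal, ∑ q ∈ posAntidiagonal p.1, f q.1 p.2 q.2 p.2 := by
  -- Exchanging each mᵢ with nᵢ reduces this splitting to the previous one.
  have hW : ∑ w ∈ liouvilleSet N, f w.1.1 w.1.2 w.2.1 w.2.2 =
      ∑ w ∈ liouvilleSet N, f w.1.2 w.1.1 w.2.2 w.2.1 := by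
    refine sum_bij' (fun w _ => (w.1.swap, w.2.swap)) (fun w _ => (w.1.swap, w.2.swap))
      ?_ ?_ ?_ ?_ ?_
    · rintro ⟨⟨m₁, n₁⟩, m₂, n₂⟩ h
      simp only [mem_liouvilleSet, Prod.swap] at h ⊢
      exact ⟨by omega, by rw [← h.2]; ring⟩
    · rintro ⟨⟨m₁, n₁⟩, m₂, n₂⟩ h
      simp only [mem_liouvilleSet, Prod.swap] at h ⊢
      exact ⟨by omega, by rw [← h.2]; ring⟩
    · intros; rfl
    · intros; rfl
    · intros; rfl
  rw [hW, sum_liouvilleSet_split_left N fun m₁ n₁ m₂ n₂ => f n₁ m₁ n₂ m₂]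
  congr 1
  -- The staircase ca + ma + mb is an L-shape cut into rectangles; the exchange of mᵢ and nᵢ
  -- conjugates it, so both splittings are parametrized by the same set.
  · refine sum_bij' (fun u _ => ((u.2.2, u.2.1), (u.1.2, u.1.1)))
      (fun u _ => ((u.2.2, u.2.1), (u.1.2, u.1.1))) ?_ ?_ ?_ ?_ ?_
    · rintro ⟨⟨c, m⟩, a, b⟩ h
      simp only [mem_staircaseSet] at h ⊢
      exact ⟨by omega, by rw [← h.2]; ring⟩
    · rintro ⟨⟨c, m⟩, a, b⟩ h
      simp only [mem_staircaseSet] at h ⊢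
      exact ⟨by omega, by rw [← h.2]; ring⟩
    · intros; rfl
    · intros; rfl
    · rintro ⟨⟨c, m⟩, a, b⟩ _
      simp only [add_comm c m]
  · refine sum_bij' (fun p _ => p.swap) (fun p _ => p.swap) ?_ ?_ ?_ ?_ ?_
    · rintro ⟨m, n⟩ h
      simp only [Nat.mem_divisorsAntidiagonal, Prod.swap] at h ⊢
      exact ⟨by rw [← h.1]; ring, h.2⟩
    · rintro ⟨m, n⟩ h
      simp only [Nat.mem_divisorsAntidiagonal, Prod.swap] at h ⊢
      exact ⟨by rw [← h.1]; ring, h.2⟩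
    · intros; rfl
    · intros; rfl
    · intros; rfl

end Liouville

/-! ### The Fay identity for the Kronecker function over a field -/

section Fay

open Finset

/-- Each of the six sums is split along the sign of m₁ - m₂ or of n₁ - n₂, whichever makes its
differences of arguments reduce to a single staircase variable. This produces twelve sums over
`staircaseSet N` that cancel in pairs; only the diagonals m₁ = m₂ and n₁ = n₂ survive. -/
theorem liouville_identity {M : Type*} [AddCommGroup M] (N : ℕ) (g : ℤ → ℤ → ℤ → ℤ → M)
    (hg : ∀ a b c d, g (-a) (-b) (-c) (-d) = g a b c d) :
    ∑ w ∈ liouvilleSet N, (g w.1.1 w.1.2 w.2.1 w.2.2 - g w.1.1 w.1.2 (-w.2.1) (-w.2.2)) =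
      ∑ w ∈ liouvilleSet N, (g w.1.1 (w.1.2 - w.2.2) (w.1.1 + w.2.1) w.2.2 -
        g w.1.1 (w.1.2 + w.2.2) (w.1.1 - w.2.1) (-w.2.2)) +
      ∑ w ∈ liouvilleSet N, (g (w.1.1 + w.2.1) w.2.2 w.1.1 (w.1.2 - w.2.2) -
        g (w.1.1 - w.2.1) (-w.2.2) w.1.1 (w.1.2 + w.2.2)) +
      (∑ p ∈ N.divisorsAntidiagonal, ∑ q ∈ posAntidiagonal p.2,
        (g p.1 q.1 p.1 q.2 + g p.1 p.2 0 (-q.2) + g 0 (-q.2) p.1 p.2) -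
      ∑ p ∈ N.divisorsAntidiagonal, ∑ q ∈ posAntidiagonal p.1,
        (g q.1 p.2 (-q.2) (-p.2) + g q.1 0 p.1 p.2 + g p.1 p.2 q.1 0)) := by
  have c1 : ∀ p : ℕ × ℕ, ∀ q ∈ posAntidiagonal p.2, (q.1 : ℤ) + q.2 = p.2 := fun p q hq => by
    exact_mod_cast (mem_posAntidiagonal.1 hq).1
  have c2 : ∀ p : ℕ × ℕ, ∀ q ∈ posAntidiagonal p.1, (q.1 : ℤ) + q.2 = p.1 := fun p q hq => by
    exact_mod_cast (mem_posAntidiagonal.1 hq).1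
  have e1 : ∑ w ∈ liouvilleSet N, g w.1.1 w.1.2 w.2.1 w.2.2 =
      ∑ u ∈ staircaseSet N, (g (u.1.1 + u.1.2) u.2.1 u.1.2 u.2.2 +
        g u.1.2 u.2.2 (u.1.1 + u.1.2) u.2.1) +
      ∑ p ∈ N.divisorsAntidiagonal, ∑ q ∈ posAntidiagonal p.2, g p.1 q.1 p.1 q.2 := by
    rw [sum_liouvilleSet_split_left N fun a b c d => g a b c d]
    push_cast
    rfl
  have e2 : ∑ w ∈ liouvilleSet N, g w.1.1 w.1.2 (-w.2.1) (-w.2.2) =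
      ∑ u ∈ staircaseSet N, (g u.1.2 (u.2.1 + u.2.2) (-u.1.1) (-u.2.1) +
        g u.1.1 u.2.1 (-u.1.2) (-(u.2.1 + u.2.2))) +
      ∑ p ∈ N.divisorsAntidiagonal, ∑ q ∈ posAntidiagonal p.1, g q.1 p.2 (-q.2) (-p.2) := by
    rw [sum_liouvilleSet_split_right N fun a b c d => g a b (-c) (-d)]
    push_cast
    rfl
  have e3 : ∑ w ∈ liouvilleSet N, g w.1.1 (w.1.2 - w.2.2) (w.1.1 + w.2.1) w.2.2 =
      ∑ u ∈ staircaseSet N, (g u.1.2 u.2.2 (u.1.1 + u.1.2) u.2.1 +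
        g u.1.1 (-u.2.2) (u.1.1 + u.1.2) (u.2.1 + u.2.2)) +
      ∑ p ∈ N.divisorsAntidiagonal, ∑ q ∈ posAntidiagonal p.1, g q.1 0 p.1 p.2 := by
    rw [sum_liouvilleSet_split_right N fun a b c d => g a (b - d) (a + c) d]
    congr 1
    · refine sum_congr rfl fun u _ => ?_
      congr 2 <;> push_cast <;> ring
    · exact sum_congr rfl fun p _ => sum_congr rfl fun q hq => by rw [c2 p q hq, sub_self]
  have e4 : ∑ w ∈ liouvilleSet N, g w.1.1 (w.1.2 + w.2.2) (w.1.1 - w.2.1) (-w.2.2) =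
      ∑ u ∈ staircaseSet N, (g (u.1.1 + u.1.2) (u.2.1 + u.2.2) u.1.1 (-u.2.2) +
        g u.1.2 (u.2.1 + u.2.2) (-u.1.1) (-u.2.1)) +
      ∑ p ∈ N.divisorsAntidiagonal, ∑ q ∈ posAntidiagonal p.2, g p.1 p.2 0 (-q.2) := by
    rw [sum_liouvilleSet_split_left N fun a b c d => g a (b + d) (a - c) (-d)]
    congr 1
    · refine sum_congr rfl fun u _ => ?_
      congr 2 <;> push_cast <;> ring
    · exact sum_congr rfl fun p _ => sum_congr rfl fun q hq => by rw [c1 p q hq, sub_self]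
  have e5 : ∑ w ∈ liouvilleSet N, g (w.1.1 + w.2.1) w.2.2 w.1.1 (w.1.2 - w.2.2) =
      ∑ u ∈ staircaseSet N, (g (u.1.1 + u.1.2) u.2.1 u.1.2 u.2.2 +
        g (u.1.1 + u.1.2) (u.2.1 + u.2.2) u.1.1 (-u.2.2)) +
      ∑ p ∈ N.divisorsAntidiagonal, ∑ q ∈ posAntidiagonal p.1, g p.1 p.2 q.1 0 := by
    rw [sum_liouvilleSet_split_right N fun a b c d => g (a + c) d a (b - d)]
    congr 1
    · refine sum_congr rfl fun u _ => ?_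
      congr 2 <;> push_cast <;> ring
    · exact sum_congr rfl fun p _ => sum_congr rfl fun q hq => by rw [c2 p q hq, sub_self]
  have e6 : ∑ w ∈ liouvilleSet N, g (w.1.1 - w.2.1) (-w.2.2) w.1.1 (w.1.2 + w.2.2) =
      ∑ u ∈ staircaseSet N, (g u.1.1 (-u.2.2) (u.1.1 + u.1.2) (u.2.1 + u.2.2) +
        g u.1.1 u.2.1 (-u.1.2) (-(u.2.1 + u.2.2))) +
      ∑ p ∈ N.divisorsAntidiagonal, ∑ q ∈ posAntidiagonal p.2, g 0 (-q.2) p.1 p.2 := by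
    rw [sum_liouvilleSet_split_left N fun a b c d => g (a - c) (-d) a (b + d)]
    congr 1
    · refine sum_congr rfl fun u _ => ?_
      congr 1
      · congr 1; push_cast; ring
      -- The only cancellation that needs the evenness of g.
      · rw [← hg]; congr 1 <;> push_cast <;> ring
    · exact sum_congr rfl fun p _ => sum_congr rfl fun q hq => by rw [c1 p q hq, sub_self]
  simp only [sum_sub_distrib, sum_add_distrib] at e1 e2 e3 e4 e5 e6 ⊢
  rw [e1, e2, e3, e4, e5, e6]
  abel

variable {K : Type*} [Field K]

/-- `1 / (1 - u)`. -/
def geomTail (u : K) : K := (1 - u)⁻¹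

theorem geomTail_inv {u : K} (h0 : u ≠ 0) (h1 : u ≠ 1) : geomTail u⁻¹ = 1 - geomTail u := by
  have : 1 - u ≠ 0 := sub_ne_zero.2 h1.symm
  have h2 : 1 - u⁻¹ ≠ 0 := sub_ne_zero.2 fun h => h1 (by rw [← inv_inv u, ← h, inv_one])
  have h3 : u - 1 ≠ 0 := sub_ne_zero.2 h1
  unfold geomTail
  field_simp
  ring

/-- Partial fractions; used for the x's and for the y's, this is the part of the Fay identity that
does not involve q. -/
theorem geomTail_mul {u v : K} (hu : u ≠ 1) (hv : v ≠ 1) (huv : u * v ≠ 1) :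
    geomTail u * geomTail v = geomTail (u * v) * (geomTail u + geomTail v - 1) := by
  have h1 : 1 - u ≠ 0 := sub_ne_zero.2 hu.symm
  have h2 : 1 - v ≠ 0 := sub_ne_zero.2 hv.symm
  have h3 : 1 - u * v ≠ 0 := sub_ne_zero.2 huv.symm
  unfold geomTail
  field_simp
  ring

/-- Evaluates the diagonal terms of `liouville_identity`. Writing the geometric sum with `geomTail
(v / u)` produces the constant terms of F as coefficients. -/
theorem sum_posAntidiagonal_pow {u v : K} (hu : u ≠ 0) (h : v / u ≠ 1) {n : ℕ} (hn : n ≠ 0) :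
    ∑ q ∈ posAntidiagonal n, u ^ (q.1 : ℤ) * v ^ (q.2 : ℤ) =
      (geomTail (v / u) - 1) * u ^ (n : ℤ) - geomTail (v / u) * v ^ (n : ℤ) := by
  have h1 : 1 - v / u ≠ 0 := sub_ne_zero.2 h.symm
  have h2 : u - v ≠ 0 := fun e => h (by rw [sub_eq_zero.1 e, div_self]; rwa [← sub_eq_zero.1 e])
  simp only [zpow_natCast]
  obtain ⟨n, rfl⟩ := Nat.exists_eq_succ_of_ne_zero hn
  cases n with
  | zero =>
    have : posAntidiagonal (Nat.succ 0) = ∅ := by decide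
    rw [this, sum_empty, geomTail]
    field_simp
    ring
  | succ n =>
    have hs : ∑ q ∈ posAntidiagonal (n + 2), u ^ q.1 * v ^ q.2 =
        u * v * ∑ i ∈ range (n + 1), u ^ i * v ^ (n - i) := by
      rw [posAntidiagonal, sum_filter_one_le_antidiagonal (n := n) (fun q => u ^ q.1 * v ^ q.2),
        Nat.sum_antidiagonal_eq_sum_range_succ (fun i j => u ^ (i + 1) * v ^ (j + 1)), mul_sum]
      exact sum_congr rfl fun i _ => by ring
    have hg := (Commute.all u v).geom_sum₂_mul (n + 1)
    simp only [Nat.add_sub_cancel] at hg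
    have hgeom : geomTail (v / u) = u / (u - v) := by
      unfold geomTail; field_simp
    rw [hs, hgeom]
    apply mul_right_cancel₀ h2
    rw [mul_assoc, hg]
    rw [Nat.succ_eq_add_one]
    field_simp
    ring

/-- The coefficient of `q^N` in `Σ_{m, n ≥ 1} (x^m y^n - x^(-m) y^(-n)) q^(mn)`. -/
def lambertCoeff (x y : K) (N : ℕ) : K :=
  ∑ p ∈ N.divisorsAntidiagonal,
    (x ^ (p.1 : ℤ) * y ^ (p.2 : ℤ) - x ^ (-p.1 : ℤ) * y ^ (-p.2 : ℤ))

/-- The coefficient of `q^N` in the Kronecker function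
`(1 - xy) / ((1 - x)(1 - y)) + Σ_{m, n ≥ 1} (x^m y^n - x^(-m) y^(-n)) q^(mn)`. -/
def kroneckerCoeff (x y : K) (N : ℕ) : K :=
  (if N = 0 then geomTail x + geomTail y - 1 else 0) + lambertCoeff x y N

theorem sum_lambertCoeff_mul (x₁ y₁ x₂ y₂ : K) (N : ℕ) :
    ∑ i ∈ HasAntidiagonal.antidiagonal N, lambertCoeff x₁ y₁ i.1 * lambertCoeff x₂ y₂ i.2 =
      ∑ w ∈ liouvilleSet N,
        (x₁ ^ (w.1.1 : ℤ) * y₁ ^ (w.1.2 : ℤ) - x₁ ^ (-w.1.1 : ℤ) * y₁ ^ (-w.1.2 : ℤ)) *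
        (x₂ ^ (w.2.1 : ℤ) * y₂ ^ (w.2.2 : ℤ) - x₂ ^ (-w.2.1 : ℤ) * y₂ ^ (-w.2.2 : ℤ)) := by
  rw [← sum_antidiagonal_divisors N fun p r =>
    (x₁ ^ (p.1 : ℤ) * y₁ ^ (p.2 : ℤ) - x₁ ^ (-p.1 : ℤ) * y₁ ^ (-p.2 : ℤ)) *
        (x₂ ^ (r.1 : ℤ) * y₂ ^ (r.2 : ℤ) - x₂ ^ (-r.1 : ℤ) * y₂ ^ (-r.2 : ℤ))]
  refine sum_congr rfl fun i _ => ?_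
  rw [lambertCoeff, lambertCoeff, sum_mul_sum]

theorem sum_kroneckerCoeff_mul (x₁ y₁ x₂ y₂ : K) (N : ℕ) :
    ∑ i ∈ HasAntidiagonal.antidiagonal N, kroneckerCoeff x₁ y₁ i.1 * kroneckerCoeff x₂ y₂ i.2 =
      (if N = 0 then (geomTail x₁ + geomTail y₁ - 1) * (geomTail x₂ + geomTail y₂ - 1) else 0) +
      (geomTail x₁ + geomTail y₁ - 1) * lambertCoeff x₂ y₂ N +
      (geomTail x₂ + geomTail y₂ - 1) * lambertCoeff x₁ y₁ N +
      ∑ i ∈ HasAntidiagonal.antidiagonal N, lambertCoeff x₁ y₁ i.1 * lambertCoeff x₂ y₂ i.2 := by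
  simp only [kroneckerCoeff, add_mul, mul_add, sum_add_distrib]
  have s1 : ∀ (a : K) (f : ℕ → K), ∑ i ∈ HasAntidiagonal.antidiagonal N,
      (if i.1 = 0 then a else 0) * f i.2 = a * f N := fun a f => by
    rw [sum_eq_single (0, N)]
    · simp
    · rintro ⟨i, j⟩ hi hne
      rw [HasAntidiagonal.mem_antidiagonal] at hi
      have : i ≠ 0 := by rintro rfl; simp at hi; exact hne (by rw [hi])
      simp [this]
    · intro h; simp at h
  have s2 : ∀ (a : K) (f : ℕ → K), ∑ i ∈ HasAntidiagonal.antidiagonal N,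
      f i.1 * (if i.2 = 0 then a else 0) = a * f N := fun a f => by
    rw [sum_eq_single (N, 0)]
    · simp [mul_comm]
    · rintro ⟨i, j⟩ hi hne
      rw [HasAntidiagonal.mem_antidiagonal] at hi
      have : j ≠ 0 := by rintro rfl; simp at hi; exact hne (by rw [hi])
      simp [this]
    · intro h; simp at h
  rw [s1 _ fun j => if j = 0 then geomTail x₂ + geomTail y₂ - 1 else 0, s1, s2]
  split_ifs <;> ring

/-- The Fay identity without the products of two constant terms: the products constant times Lambert
are exactly what the diagonals of `liouville_identity` leave over. -/
theorem sum_lambertCoeff_fay {x₁ x₂ y₁ y₂ : K} (hx₁ : x₁ ≠ 0) (hx₂ : x₂ ≠ 0) (hy₁ : y₁ ≠ 0)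
    (hy₂ : y₂ ≠ 0) (hx₁' : x₁ ≠ 1) (hx₂' : x₂ ≠ 1) (hx : x₁ * x₂ ≠ 1) (hy₁' : y₁ ≠ 1)
    (hy₂' : y₂ ≠ 1) (hy : y₂ / y₁ ≠ 1) (N : ℕ) :
    (geomTail x₁ + geomTail y₁ - 1) * lambertCoeff x₂ y₂ N +
      (geomTail x₂ + geomTail y₂ - 1) * lambertCoeff x₁ y₁ N +
      ∑ i ∈ HasAntidiagonal.antidiagonal N, lambertCoeff x₁ y₁ i.1 * lambertCoeff x₂ y₂ i.2 =
    ((geomTail (x₁ * x₂) + geomTail y₁ - 1) * lambertCoeff x₂ (y₂ / y₁) N +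
      (geomTail x₂ + geomTail (y₂ / y₁) - 1) * lambertCoeff (x₁ * x₂) y₁ N +
      ∑ i ∈ HasAntidiagonal.antidiagonal N,
        lambertCoeff (x₁ * x₂) y₁ i.1 * lambertCoeff x₂ (y₂ / y₁) i.2) +
    ((geomTail (x₁ * x₂) + geomTail y₂ - 1) * lambertCoeff x₁ (y₁ / y₂) N +
      (geomTail x₁ + geomTail (y₁ / y₂) - 1) * lambertCoeff (x₁ * x₂) y₂ N +
      ∑ i ∈ HasAntidiagonal.antidiagonal N,
        lambertCoeff (x₁ * x₂) y₂ i.1 * lambertCoeff x₁ (y₁ / y₂) i.2) := by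
  -- A monomial plus its inverse. Expanding a product of two Lambert terms gives two such even
  -- functions, and x₁x₂ and y₂/y₁ turn into sums and differences of exponents.
  set g : ℤ → ℤ → ℤ → ℤ → K := fun a b c d => x₁ ^ a * y₁ ^ b * (x₂ ^ c * y₂ ^ d) +
    x₁ ^ (-a) * y₁ ^ (-b) * (x₂ ^ (-c) * y₂ ^ (-d)) with hgdef
  have key := liouville_identity N g fun a b c d => by
    simp only [hgdef, neg_neg]; ring
  rw [sum_lambertCoeff_mul, sum_lambertCoeff_mul, sum_lambertCoeff_mul]
  have k1 : ∀ w : (ℕ × ℕ) × (ℕ × ℕ),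
      (x₁ ^ (w.1.1 : ℤ) * y₁ ^ (w.1.2 : ℤ) - x₁ ^ (-w.1.1 : ℤ) * y₁ ^ (-w.1.2 : ℤ)) *
        (x₂ ^ (w.2.1 : ℤ) * y₂ ^ (w.2.2 : ℤ) - x₂ ^ (-w.2.1 : ℤ) * y₂ ^ (-w.2.2 : ℤ)) =
      g w.1.1 w.1.2 w.2.1 w.2.2 - g w.1.1 w.1.2 (-w.2.1) (-w.2.2) := fun w => by
    simp only [hgdef, neg_neg]; ring
  have k2 : ∀ w : (ℕ × ℕ) × (ℕ × ℕ),
      ((x₁ * x₂) ^ (w.1.1 : ℤ) * y₁ ^ (w.1.2 : ℤ) - (x₁ * x₂) ^ (-w.1.1 : ℤ) * y₁ ^ (-w.1.2 : ℤ)) *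
        (x₂ ^ (w.2.1 : ℤ) * (y₂ / y₁) ^ (w.2.2 : ℤ) -
          x₂ ^ (-w.2.1 : ℤ) * (y₂ / y₁) ^ (-w.2.2 : ℤ)) =
      g w.1.1 (w.1.2 - w.2.2) (w.1.1 + w.2.1) w.2.2 -
        g w.1.1 (w.1.2 + w.2.2) (w.1.1 - w.2.1) (-w.2.2) := fun w => by
    simp only [hgdef, mul_zpow, div_zpow, zpow_add₀ hx₂, zpow_sub₀ hx₂,
      zpow_add₀ hy₁, zpow_sub₀ hy₁, zpow_neg]
    field_simp
    ring
  have k3 : ∀ w : (ℕ × ℕ) × (ℕ × ℕ),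
      ((x₁ * x₂) ^ (w.1.1 : ℤ) * y₂ ^ (w.1.2 : ℤ) - (x₁ * x₂) ^ (-w.1.1 : ℤ) * y₂ ^ (-w.1.2 : ℤ)) *
        (x₁ ^ (w.2.1 : ℤ) * (y₁ / y₂) ^ (w.2.2 : ℤ) -
          x₁ ^ (-w.2.1 : ℤ) * (y₁ / y₂) ^ (-w.2.2 : ℤ)) =
      g (w.1.1 + w.2.1) w.2.2 w.1.1 (w.1.2 - w.2.2) -
        g (w.1.1 - w.2.1) (-w.2.2) w.1.1 (w.1.2 + w.2.2) := fun w => by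
    simp only [hgdef, mul_zpow, div_zpow, zpow_add₀ hx₁, zpow_sub₀ hx₁,
      zpow_add₀ hy₂, zpow_sub₀ hy₂, zpow_neg]
    field_simp
    ring
  simp only [k1, k2, k3]
  rw [key]
  simp only [lambertCoeff]
  have hyi : y₁ / y₂ = (y₂ / y₁)⁻¹ := (inv_div _ _).symm
  have hyi' : y₁ / y₂ ≠ 1 := by rw [hyi]; exact inv_ne_one.2 hy
  have gy : geomTail (y₁ / y₂) = 1 - geomTail (y₂ / y₁) := by
    rw [hyi]; exact geomTail_inv (div_ne_zero hy₂ hy₁) hy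
  have gx₁ := geomTail_inv hx₁ hx₁'
  have gx₂ := geomTail_inv hx₂ hx₂'
  have gy₁ := geomTail_inv hy₁ hy₁'
  have gy₂ := geomTail_inv hy₂ hy₂'
  have gx := geomTail_inv (mul_ne_zero hx₁ hx₂) hx
  -- The diagonal terms match for each factorization N = mn separately.
  have boundary : ∀ p ∈ N.divisorsAntidiagonal,
      ∑ q ∈ posAntidiagonal p.2, (g p.1 q.1 p.1 q.2 + g p.1 p.2 0 (-q.2) + g 0 (-q.2) p.1 p.2) -
        ∑ q ∈ posAntidiagonal p.1, (g q.1 p.2 (-q.2) (-p.2) + g q.1 0 p.1 p.2 + g p.1 p.2 q.1 0) =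
      (geomTail (x₁ * x₂) + geomTail y₁ - 1) * (x₂ ^ (p.1 : ℤ) * (y₂ / y₁) ^ (p.2 : ℤ) -
        x₂ ^ (-p.1 : ℤ) * (y₂ / y₁) ^ (-p.2 : ℤ)) +
      (geomTail x₂ + geomTail (y₂ / y₁) - 1) * ((x₁ * x₂) ^ (p.1 : ℤ) * y₁ ^ (p.2 : ℤ) -
        (x₁ * x₂) ^ (-p.1 : ℤ) * y₁ ^ (-p.2 : ℤ)) +
      ((geomTail (x₁ * x₂) + geomTail y₂ - 1) * (x₁ ^ (p.1 : ℤ) * (y₁ / y₂) ^ (p.2 : ℤ) -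
        x₁ ^ (-p.1 : ℤ) * (y₁ / y₂) ^ (-p.2 : ℤ)) +
      (geomTail x₁ + geomTail (y₁ / y₂) - 1) * ((x₁ * x₂) ^ (p.1 : ℤ) * y₂ ^ (p.2 : ℤ) -
        (x₁ * x₂) ^ (-p.1 : ℤ) * y₂ ^ (-p.2 : ℤ))) -
      ((geomTail x₁ + geomTail y₁ - 1) * (x₂ ^ (p.1 : ℤ) * y₂ ^ (p.2 : ℤ) -
        x₂ ^ (-p.1 : ℤ) * y₂ ^ (-p.2 : ℤ)) +
      (geomTail x₂ + geomTail y₂ - 1) * (x₁ ^ (p.1 : ℤ) * y₁ ^ (p.2 : ℤ) -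
        x₁ ^ (-p.1 : ℤ) * y₁ ^ (-p.2 : ℤ))) := by
    rintro ⟨m, n⟩ hp
    obtain ⟨rfl, hN⟩ := Nat.mem_divisorsAntidiagonal.1 hp
    have hm : m ≠ 0 := fun h => hN (by simp [h])
    have hn : n ≠ 0 := fun h => hN (by simp [h])
    -- Three values of g, each with two monomials, give six geometric sums; pulling out the factor
    -- that does not depend on q makes `sum_posAntidiagonal_pow` applicable.
    have b₁ : ∑ q ∈ posAntidiagonal n,
        (g m q.1 m q.2 + g m n 0 (-q.2) + g 0 (-q.2) m n) =
        (x₁ ^ (m : ℤ) * x₂ ^ (m : ℤ)) * ∑ q ∈ posAntidiagonal n, y₁ ^ (q.1 : ℤ) * y₂ ^ (q.2 : ℤ) +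
        (x₁ ^ (m : ℤ) * x₂ ^ (m : ℤ))⁻¹ *
          ∑ q ∈ posAntidiagonal n, y₁⁻¹ ^ (q.1 : ℤ) * y₂⁻¹ ^ (q.2 : ℤ) +
        (x₁ ^ (m : ℤ) * y₁ ^ (n : ℤ)) *
          ∑ q ∈ posAntidiagonal n, (1 : K) ^ (q.1 : ℤ) * y₂⁻¹ ^ (q.2 : ℤ) +
        (x₁ ^ (m : ℤ) * y₁ ^ (n : ℤ))⁻¹ *
          ∑ q ∈ posAntidiagonal n, (1 : K) ^ (q.1 : ℤ) * y₂ ^ (q.2 : ℤ) +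
        (x₂ ^ (m : ℤ) * y₂ ^ (n : ℤ)) *
          ∑ q ∈ posAntidiagonal n, (1 : K) ^ (q.1 : ℤ) * y₁⁻¹ ^ (q.2 : ℤ) +
        (x₂ ^ (m : ℤ) * y₂ ^ (n : ℤ))⁻¹ *
          ∑ q ∈ posAntidiagonal n, (1 : K) ^ (q.1 : ℤ) * y₁ ^ (q.2 : ℤ) := by
      simp only [mul_sum, ← sum_add_distrib]
      refine sum_congr rfl fun q _ => ?_
      simp only [hgdef, zpow_zero, one_zpow, zpow_neg, inv_zpow, mul_inv, inv_inv]
      ring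
    have b₂ : ∑ q ∈ posAntidiagonal m,
        (g q.1 n (-q.2) (-n) + g q.1 0 m n + g m n q.1 0) =
        (y₁ ^ (n : ℤ) * (y₂ ^ (n : ℤ))⁻¹) *
          ∑ q ∈ posAntidiagonal m, x₁ ^ (q.1 : ℤ) * x₂⁻¹ ^ (q.2 : ℤ) +
        ((y₁ ^ (n : ℤ))⁻¹ * y₂ ^ (n : ℤ)) *
          ∑ q ∈ posAntidiagonal m, x₁⁻¹ ^ (q.1 : ℤ) * x₂ ^ (q.2 : ℤ) +
        (x₂ ^ (m : ℤ) * y₂ ^ (n : ℤ)) *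
          ∑ q ∈ posAntidiagonal m, x₁ ^ (q.1 : ℤ) * (1 : K) ^ (q.2 : ℤ) +
        (x₂ ^ (m : ℤ) * y₂ ^ (n : ℤ))⁻¹ *
          ∑ q ∈ posAntidiagonal m, x₁⁻¹ ^ (q.1 : ℤ) * (1 : K) ^ (q.2 : ℤ) +
        (x₁ ^ (m : ℤ) * y₁ ^ (n : ℤ)) *
          ∑ q ∈ posAntidiagonal m, x₂ ^ (q.1 : ℤ) * (1 : K) ^ (q.2 : ℤ) +
        (x₁ ^ (m : ℤ) * y₁ ^ (n : ℤ))⁻¹ *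
          ∑ q ∈ posAntidiagonal m, x₂⁻¹ ^ (q.1 : ℤ) * (1 : K) ^ (q.2 : ℤ) := by
      simp only [mul_sum, ← sum_add_distrib]
      refine sum_congr rfl fun q _ => ?_
      simp only [hgdef, zpow_zero, one_zpow, zpow_neg, inv_zpow, mul_inv, inv_inv]
      ring
    have w₁ : y₂⁻¹ / y₁⁻¹ = y₁ / y₂ := by field_simp
    have w₂ : x₂⁻¹ / x₁ = (x₁ * x₂)⁻¹ := by field_simp
    have w₃ : x₂ / x₁⁻¹ = x₁ * x₂ := by field_simp
    have w₄ : 1 / x₁ = x₁⁻¹ := one_div _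
    have w₅ : 1 / x₂ = x₂⁻¹ := one_div _
    have w₆ : 1 / x₁⁻¹ = x₁ := by field_simp
    have w₇ : 1 / x₂⁻¹ = x₂ := by field_simp
    dsimp only
    rw [b₁, b₂, sum_posAntidiagonal_pow hy₁ hy hn,
      sum_posAntidiagonal_pow (inv_ne_zero hy₁) (by rwa [w₁]) hn,
      sum_posAntidiagonal_pow one_ne_zero (by rw [div_one]; exact inv_ne_one.2 hy₂') hn,
      sum_posAntidiagonal_pow one_ne_zero (by rwa [div_one]) hn,
      sum_posAntidiagonal_pow one_ne_zero (by rw [div_one]; exact inv_ne_one.2 hy₁') hn,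
      sum_posAntidiagonal_pow one_ne_zero (by rwa [div_one]) hn,
      sum_posAntidiagonal_pow hx₁ (by rw [w₂]; exact inv_ne_one.2 hx) hm,
      sum_posAntidiagonal_pow (inv_ne_zero hx₁) (by rwa [w₃]) hm,
      sum_posAntidiagonal_pow hx₁ (by rw [w₄]; exact inv_ne_one.2 hx₁') hm,
      sum_posAntidiagonal_pow (inv_ne_zero hx₁) (by rwa [w₆]) hm,
      sum_posAntidiagonal_pow hx₂ (by rw [w₅]; exact inv_ne_one.2 hx₂') hm,
      sum_posAntidiagonal_pow (inv_ne_zero hx₂) (by rwa [w₇]) hm]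
    simp only [w₁, w₂, w₃, w₄, w₅, w₆, w₇, div_one, gx₁, gx₂, gy₁, gy₂, gx, gy, zpow_neg, mul_zpow,
      div_zpow, inv_zpow, one_zpow]
    have u₁ : x₁ ^ (m : ℤ) ≠ 0 := zpow_ne_zero _ hx₁
    have u₂ : x₂ ^ (m : ℤ) ≠ 0 := zpow_ne_zero _ hx₂
    have u₃ : y₁ ^ (n : ℤ) ≠ 0 := zpow_ne_zero _ hy₁
    have u₄ : y₂ ^ (n : ℤ) ≠ 0 := zpow_ne_zero _ hy₂
    generalize x₁ ^ (m : ℤ) = P₁ at *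
    generalize x₂ ^ (m : ℤ) = P₂ at *
    generalize y₁ ^ (n : ℤ) = Q₁ at *
    generalize y₂ ^ (n : ℤ) = Q₂ at *
    simp only [mul_inv, inv_inv, div_eq_mul_inv]
    ring
  rw [← sum_sub_distrib, sum_congr rfl boundary]
  simp only [sum_sub_distrib, sum_add_distrib, ← mul_sum]
  ring

/-- The Fay identity for the Kronecker function. -/
theorem kroneckerCoeff_fay {x₁ x₂ y₁ y₂ : K} (hx₁ : x₁ ≠ 0) (hx₂ : x₂ ≠ 0) (hy₁ : y₁ ≠ 0)
    (hy₂ : y₂ ≠ 0) (hx₁' : x₁ ≠ 1) (hx₂' : x₂ ≠ 1) (hx : x₁ * x₂ ≠ 1) (hy₁' : y₁ ≠ 1)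
    (hy₂' : y₂ ≠ 1) (hy : y₂ / y₁ ≠ 1) (N : ℕ) :
    ∑ i ∈ HasAntidiagonal.antidiagonal N, kroneckerCoeff x₁ y₁ i.1 * kroneckerCoeff x₂ y₂ i.2 =
      ∑ i ∈ HasAntidiagonal.antidiagonal N,
        kroneckerCoeff (x₁ * x₂) y₁ i.1 * kroneckerCoeff x₂ (y₂ / y₁) i.2 +
      ∑ i ∈ HasAntidiagonal.antidiagonal N,
        kroneckerCoeff (x₁ * x₂) y₂ i.1 * kroneckerCoeff x₁ (y₁ / y₂) i.2 := by
  simp only [sum_kroneckerCoeff_mul]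
  have key := sum_lambertCoeff_fay hx₁ hx₂ hy₁ hy₂ hx₁' hx₂' hx hy₁' hy₂' hy N
  have gy : geomTail (y₁ / y₂) = 1 - geomTail (y₂ / y₁) := by
    rw [← inv_div y₂ y₁]; exact geomTail_inv (div_ne_zero hy₂ hy₁) hy
  have r₁ := geomTail_mul hx₁' hx₂' hx
  -- Taken at u = y₁ and v = y₂/y₁, so that uv = y₂. It is needed, like `r₁`, only for N = 0.
  have r₂ := geomTail_mul hy₁' hy (by rwa [mul_div_cancel₀ _ hy₁])
  rw [mul_div_cancel₀ _ hy₁] at r₂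
  split_ifs
  · rw [gy] at key ⊢
    linear_combination key + r₁ - r₂
  · linear_combination key

end Fay

/-! ### Exponents -/

section Exponents

@[simp] theorem exponent₁_zero (r s : ℕ) : exponent₁ r s 0 = r := rfl
@[simp] theorem exponent₁_one (r s : ℕ) : exponent₁ r s 1 = s := rfl
@[simp] theorem exponent₂_zero (i j a b : ℕ) : exponent₂ i j a b 0 = i := rfl
@[simp] theorem exponent₂_one (i j a b : ℕ) : exponent₂ i j a b 1 = j := rfl
@[simp] theorem exponent₂_two (i j a b : ℕ) : exponent₂ i j a b 2 = a := rfl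
@[simp] theorem exponent₂_three (i j a b : ℕ) : exponent₂ i j a b 3 = b := rfl

theorem exponent₁_eq (n : Fin 2 →₀ ℕ) : exponent₁ (n 0) (n 1) = n := by
  ext i; fin_cases i <;> rfl

theorem exponent₂_eq (n : Fin 4 →₀ ℕ) : exponent₂ (n 0) (n 1) (n 2) (n 3) = n := by
  ext i; fin_cases i <;> rfl

theorem exponent₁_inj {r s r' s' : ℕ} :
    exponent₁ r s = exponent₁ r' s' ↔ r = r' ∧ s = s' := by
  constructor
  · intro h
    exact ⟨by simpa using DFunLike.congr_fun h 0, by simpa using DFunLike.congr_fun h 1⟩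
  · rintro ⟨rfl, rfl⟩; rfl

theorem exponent₂_inj {i j a b i' j' a' b' : ℕ} :
    exponent₂ i j a b = exponent₂ i' j' a' b' ↔ i = i' ∧ j = j' ∧ a = a' ∧ b = b' := by
  constructor
  · intro h
    exact ⟨by simpa using DFunLike.congr_fun h 0, by simpa using DFunLike.congr_fun h 1,
      by simpa using DFunLike.congr_fun h 2, by simpa using DFunLike.congr_fun h 3⟩
  · rintro ⟨rfl, rfl, rfl, rfl⟩; rfl

theorem exponent₂_add (i j a b i' j' a' b' : ℕ) :
    exponent₂ i j a b + exponent₂ i' j' a' b' =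
      exponent₂ (i + i') (j + j') (a + a') (b + b') := by
  ext k; fin_cases k <;> rfl

theorem degree_exponent₂ (i j a b : ℕ) : (exponent₂ i j a b).degree = i + j + a + b := by
  rw [Finsupp.degree_eq_sum, Fin.sum_univ_four]; rfl

theorem single_eq_exponent₂_zero (n : ℕ) : Finsupp.single (0 : Fin 4) n = exponent₂ n 0 0 0 := by
  ext k; fin_cases k <;> simp [exponent₂]
theorem single_eq_exponent₂_one (n : ℕ) : Finsupp.single (1 : Fin 4) n = exponent₂ 0 n 0 0 := by
  ext k; fin_cases k <;> simp [exponent₂]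
theorem single_eq_exponent₂_two (n : ℕ) : Finsupp.single (2 : Fin 4) n = exponent₂ 0 0 n 0 := by
  ext k; fin_cases k <;> simp [exponent₂]
theorem single_eq_exponent₂_three (n : ℕ) : Finsupp.single (3 : Fin 4) n = exponent₂ 0 0 0 n := by
  ext k; fin_cases k <;> simp [exponent₂]

theorem ext_exponent₁ {R : Type*} [Semiring R] {f g : MvPowerSeries (Fin 2) R}
    (h : ∀ r s, MvPowerSeries.coeff (exponent₁ r s) f = MvPowerSeries.coeff (exponent₁ r s) g) :
    f = g := by
  ext n; rw [← exponent₁_eq n, h]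

theorem ext_exponent₂ {R : Type*} [Semiring R] {f g : MvPowerSeries (Fin 4) R}
    (h : ∀ i j a b, MvPowerSeries.coeff (exponent₂ i j a b) f =
      MvPowerSeries.coeff (exponent₂ i j a b) g) : f = g := by
  ext n; rw [← exponent₂_eq n, h]

theorem monomial_exponent₂ {R : Type*} [CommSemiring R] (i j a b : ℕ) (c : R) :
    MvPolynomial.monomial (exponent₂ i j a b) c =
      MvPolynomial.C c * (MvPolynomial.X 0 ^ i * MvPolynomial.X 1 ^ j * MvPolynomial.X 2 ^ a *
        MvPolynomial.X 3 ^ b) := by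
  rw [MvPolynomial.monomial_eq, Finsupp.prod_fintype _ _ (by simp), Fin.prod_univ_four]
  rfl

end Exponents

/-! ### The chain rule for substitution of power series -/

section ChainRule

open MvPowerSeries

open scoped MvPowerSeries.WithPiTopology in
theorem continuous_pderiv {σ R : Type*} [CommRing R] [TopologicalSpace R] [IsTopologicalRing R]
    (s : σ) : Continuous (pderiv R s : MvPowerSeries σ R → MvPowerSeries σ R) := by
  refine continuous_pi fun n => ?_
  have : (fun g : MvPowerSeries σ R => (pderiv R s g) n) =
      fun g : MvPowerSeries σ R => coeff (n + Finsupp.single s 1) g * ((n s : R) + 1) := by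
    ext g; exact coeff_pderiv g n
  rw [this]
  exact (WithPiTopology.continuous_coeff R _).mul continuous_const

theorem pderiv_subst {σ τ R : Type*} [Fintype σ] [Finite τ] [CommRing R]
    {a : σ → MvPowerSeries τ R} (ha : ∀ s, constantCoeff (a s) = 0) (f : MvPowerSeries σ R)
    (i : τ) : pderiv R i (subst a f) = ∑ s, subst a (pderiv R s f) * pderiv R i (a s) := by
  classical
  have hs : HasSubst a := hasSubst_of_constantCoeff_zero ha
  -- With the discrete topology on R both sides are continuous in f for the product topology, so it
  -- suffices to treat polynomials, which are dense.
  let _ : UniformSpace R := ⊥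
  have : DiscreteUniformity R := ⟨rfl⟩
  open scoped MvPowerSeries.WithPiTopology in
  have hl : Continuous fun g : MvPowerSeries σ R => pderiv R i (subst a g) :=
    (continuous_pderiv i).comp (continuous_subst hs)
  open scoped MvPowerSeries.WithPiTopology in
  have hr : Continuous fun g : MvPowerSeries σ R =>
      ∑ s, subst a (pderiv R s g) * pderiv R i (a s) :=
    continuous_finsetSum _ fun s _ =>
      ((continuous_subst hs).comp (continuous_pderiv s)).mul continuous_const
  open scoped MvPowerSeries.WithPiTopology in
  have key : (fun g : MvPowerSeries σ R => pderiv R i (subst a g)) =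
      fun g => ∑ s, subst a (pderiv R s g) * pderiv R i (a s) := by
    refine WithPiTopology.denseRange_toMvPowerSeries.equalizer hl hr ?_
    ext1 p
    simp only [Function.comp_apply]
    induction p using MvPolynomial.induction_on with
    | C r =>
      rw [MvPolynomial.coe_C, subst_C, pderiv_C]
      refine (Finset.sum_eq_zero fun s _ => ?_).symm
      rw [pderiv_C, ← coe_substAlgHom hs, map_zero, zero_mul]
    | add p q hp hq =>
      simp only [MvPolynomial.coe_add, map_add, subst_add hs, hp, hq, add_mul,
        Finset.sum_add_distrib]
    | mul_X p t hp =>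
      rw [MvPolynomial.coe_mul, MvPolynomial.coe_X, subst_mul hs, subst_X hs, Derivation.leibniz,
        hp]
      simp only [Derivation.leibniz, subst_add hs, smul_eq_mul, subst_mul hs, subst_X hs, add_mul,
        Finset.sum_add_distrib, Finset.mul_sum]
      congr 1
      · rw [Finset.sum_eq_single t]
        · rw [pderiv_X_self, ← coe_substAlgHom hs, map_one, mul_one]
        · intro s _ hst
          rw [pderiv_X_of_ne hst.symm, ← coe_substAlgHom hs, map_zero, mul_zero, zero_mul]
        · simp
      · exact Finset.sum_congr rfl fun s _ => by ring
  exact congrFun key f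

end ChainRule

/-! ### Substitution of linear forms with rational coefficients -/

section LinearSubst

open MvPowerSeries

variable {σ τ : Type*} [Fintype σ]

/-- A polynomial over `ℚ` as a power series over `ℚ⟦q⟧`. -/
def polyToSeries (p : MvPolynomial τ ℚ) : MvPowerSeries τ ℚ⟦X⟧ :=
  ((MvPolynomial.map (algebraMap ℚ ℚ⟦X⟧) p : MvPolynomial τ ℚ⟦X⟧) : MvPowerSeries τ ℚ⟦X⟧)

theorem coeff_polyToSeries (p : MvPolynomial τ ℚ) (e : τ →₀ ℕ) :
    coeff e (polyToSeries p) = algebraMap ℚ ℚ⟦X⟧ (MvPolynomial.coeff e p) := by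
  rw [polyToSeries, MvPolynomial.coeff_coe, MvPolynomial.coeff_map]

/-- `polyToSeries` as a ring homomorphism. -/
def polyToSeriesHom : MvPolynomial τ ℚ →+* MvPowerSeries τ ℚ⟦X⟧ :=
  MvPolynomial.coeToMvPowerSeries.ringHom.comp (MvPolynomial.map (algebraMap ℚ ℚ⟦X⟧))

theorem polyToSeriesHom_apply (p : MvPolynomial τ ℚ) : polyToSeriesHom p = polyToSeries p := rfl

theorem polyToSeries_X (t : τ) : polyToSeries (MvPolynomial.X t) = X t := by
  rw [polyToSeries, MvPolynomial.map_X, MvPolynomial.coe_X]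

/-- Substitution of polynomials over `ℚ` into a power series over `ℚ⟦q⟧`. -/
def ratSubst (a : σ → MvPolynomial τ ℚ) (f : MvPowerSeries σ ℚ⟦X⟧) : MvPowerSeries τ ℚ⟦X⟧ :=
  subst (S := ℚ⟦X⟧) (fun s => polyToSeries (a s)) f

theorem hasSubst_polyToSeries {a : σ → MvPolynomial τ ℚ} (ha : ∀ s, (a s).IsHomogeneous 1) :
    HasSubst fun s => polyToSeries (a s) := by
  refine hasSubst_of_constantCoeff_zero fun s => ?_
  rw [← coeff_zero_eq_constantCoeff_apply, coeff_polyToSeries,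
    (ha s).coeff_eq_zero (by simp), map_zero]

/-- The scalars are rational and do not involve q. Hence linear substitutions preserve ℚ-subspaces
of coefficients and commute with extracting the coefficient of q^N, the two facts for which
`ratSubst` is introduced. -/
theorem coeff_ratSubst {a : σ → MvPolynomial τ ℚ} (ha : ∀ s, (a s).IsHomogeneous 1)
    (f : MvPowerSeries σ ℚ⟦X⟧) (e : τ →₀ ℕ) :
    coeff e (ratSubst a f) =
      ∑ᶠ d : σ →₀ ℕ, MvPolynomial.coeff e (∏ s, a s ^ d s) • coeff d f := by
  rw [ratSubst, coeff_subst (hasSubst_polyToSeries ha)]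
  refine finsum_congr fun d => ?_
  rw [Finsupp.prod_fintype _ _ (by simp)]
  have : ∏ s, polyToSeries (a s) ^ d s = polyToSeries (∏ s, a s ^ d s) := by
    simp only [← polyToSeriesHom_apply, map_prod, map_pow]
  rw [this, coeff_polyToSeries, smul_eq_mul, mul_comm, ← Algebra.smul_def]

theorem coeff_prod_pow_eq_zero {a : σ → MvPolynomial τ ℚ} (ha : ∀ s, (a s).IsHomogeneous 1)
    {d : σ →₀ ℕ} {e : τ →₀ ℕ} (h : e.degree ≠ d.degree) :
    MvPolynomial.coeff e (∏ s, a s ^ d s) = 0 := by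
  have : (∏ s, a s ^ d s).IsHomogeneous (∑ s, 1 * d s) :=
    MvPolynomial.IsHomogeneous.prod _ _ _ fun s _ => (ha s).pow _
  refine this.coeff_eq_zero ?_
  rwa [← Finset.mul_sum, one_mul, ← Finsupp.degree_eq_sum]

/-- The coefficients of total degree `n` after a linear substitution are linear combinations
of coefficients of total degree `n`. -/
theorem coeff_ratSubst_mem {a : σ → MvPolynomial τ ℚ} (ha : ∀ s, (a s).IsHomogeneous 1)
    {f : MvPowerSeries σ ℚ⟦X⟧} {W : ℕ → Submodule ℚ ℚ⟦X⟧}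
    (hf : ∀ d, coeff d f ∈ W d.degree) (e : τ →₀ ℕ) : coeff e (ratSubst a f) ∈ W e.degree := by
  rw [coeff_ratSubst ha]
  refine finsum_induction _ (Submodule.zero_mem _) (fun x y => Submodule.add_mem _) fun d => ?_
  by_cases h : e.degree = d.degree
  · exact Submodule.smul_mem _ _ (h ▸ hf d)
  · rw [coeff_prod_pow_eq_zero ha h, zero_smul]
    exact Submodule.zero_mem _

end LinearSubst

/-! ### Explicit coefficients after signed permutations and after the shear T. -/

section CoeffFormulas

open MvPowerSeries

/-- Meant for substitutions that preserve the degree in the X's and the degree in the Y's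
separately. -/
theorem finsum_exponent₂ {M : Type*} [AddCommMonoid M] (F : (Fin 4 →₀ ℕ) → M) (m n : ℕ)
    (hF : ∀ l l' e e', ¬ (l + l' = m ∧ e + e' = n) → F (exponent₂ l l' e e') = 0) :
    ∑ᶠ d, F d = ∑ l ∈ Finset.HasAntidiagonal.antidiagonal m,
      ∑ e ∈ Finset.HasAntidiagonal.antidiagonal n, F (exponent₂ l.1 l.2 e.1 e.2) := by
  classical
  rw [← Finset.sum_product', ← Finset.sum_image (f := F)
    (g := fun p : (ℕ × ℕ) × (ℕ × ℕ) => exponent₂ p.1.1 p.1.2 p.2.1 p.2.2)]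
  · refine finsum_eq_sum_of_support_subset _ fun d hd => ?_
    rw [← exponent₂_eq d] at hd ⊢
    by_cases h : d 0 + d 1 = m ∧ d 2 + d 3 = n
    · rw [Finset.coe_image]
      refine ⟨((d 0, d 1), (d 2, d 3)), ?_, rfl⟩
      simpa using h
    · exact absurd (hF _ _ _ _ h) hd
  · rintro ⟨⟨l, l'⟩, e, e'⟩ _ ⟨⟨l₂, l₂'⟩, e₂, e₂'⟩ _ h
    simp only [exponent₂_inj] at h
    obtain ⟨rfl, rfl, rfl, rfl⟩ := h
    rfl

/-- Substitution of signed variables. -/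
theorem coeff_ratSubst_signed (c : Fin 4 → ℚ) (π : Equiv.Perm (Fin 4))
    (f : MvPowerSeries (Fin 4) ℚ⟦X⟧) (e : Fin 4 →₀ ℕ) :
    coeff e (ratSubst (fun s => MvPolynomial.C (c s) * MvPolynomial.X (π s)) f) =
      (∏ s, c s ^ e (π s)) • coeff (Finsupp.equivFunOnFinite.symm fun s => e (π s)) f := by
  have ha : ∀ s : Fin 4, (MvPolynomial.C (c s) * MvPolynomial.X (R := ℚ) (π s)).IsHomogeneous 1 :=
    fun s => by
      simpa using (MvPolynomial.isHomogeneous_C (Fin 4) (c s)).mul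
        (MvPolynomial.isHomogeneous_X ℚ (π s))
  have hprod : ∀ d : Fin 4 →₀ ℕ, ∏ s, (MvPolynomial.C (c s) * MvPolynomial.X (π s)) ^ d s =
      MvPolynomial.monomial (Finsupp.equivFunOnFinite.symm fun s => d (π.symm s))
        (∏ s, c s ^ d s) := fun d => by
    rw [MvPolynomial.monomial_eq, Finsupp.prod_fintype _ _ (fun _ => pow_zero _), map_prod,
      ← Equiv.prod_comp π (fun s => MvPolynomial.X (R := ℚ) s ^
        (Finsupp.equivFunOnFinite.symm fun s => d (π.symm s) : Fin 4 →₀ ℕ) s),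
      ← Finset.prod_mul_distrib]
    refine Finset.prod_congr rfl fun s _ => ?_
    rw [Finsupp.coe_equivFunOnFinite_symm, Equiv.symm_apply_apply, mul_pow, map_pow]
  rw [coeff_ratSubst ha, finsum_eq_single _ (Finsupp.equivFunOnFinite.symm fun s => e (π s))]
  · rw [hprod, MvPolynomial.coeff_monomial, if_pos]
    · simp
    · ext s; simp
  · intro d hd
    rw [hprod, MvPolynomial.coeff_monomial, if_neg, zero_smul]
    rintro rfl
    exact hd (by ext s; simp)

theorem sum_antidiagonal_ite (n m i j : ℕ) (c : ℕ × ℕ → ℚ) :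
    ∑ p ∈ Finset.HasAntidiagonal.antidiagonal n, (if p.1 = i ∧ p.2 + m = j then c p else 0) =
      if n + m = i + j ∧ i ≤ n then c (i, n - i) else 0 := by
  split_ifs with h
  · rw [Finset.sum_eq_single (i, n - i)]
    · rw [if_pos ⟨rfl, by omega⟩]
    · rintro ⟨p, q⟩ hp hne
      rw [Finset.HasAntidiagonal.mem_antidiagonal] at hp
      rw [if_neg]
      rintro ⟨rfl, h'⟩
      exact hne (by ext <;> simp <;> omega)
    · intro hn; exact absurd (by simp; omega) hn
  · refine Finset.sum_eq_zero fun p hp => ?_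
    rw [Finset.HasAntidiagonal.mem_antidiagonal] at hp
    rw [if_neg]
    omega

/-- Two independent binomial expansions, one in the X's and one in the Y's. The cases i > d₀ and b >
d₃ need no extra condition because the binomials vanish. -/
theorem coeff_shear_prod (d₀ d₁ d₂ d₃ i j a b : ℕ) :
    MvPolynomial.coeff (exponent₂ i j a b)
      ((MvPolynomial.X 0 + MvPolynomial.X 1) ^ d₀ * MvPolynomial.X 1 ^ d₁ *
        MvPolynomial.X 2 ^ d₂ * (MvPolynomial.X 3 - MvPolynomial.X 2) ^ d₃ :
          MvPolynomial (Fin 4) ℚ) =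
      if d₀ + d₁ = i + j ∧ d₂ + d₃ = a + b then
        (d₀.choose i : ℚ) * ((d₃.choose b : ℚ) * (-1) ^ (d₃ - b)) else 0 := by
  have hexp : ((MvPolynomial.X 0 + MvPolynomial.X 1) ^ d₀ * MvPolynomial.X 1 ^ d₁ *
        MvPolynomial.X 2 ^ d₂ * (MvPolynomial.X 3 - MvPolynomial.X 2) ^ d₃ :
          MvPolynomial (Fin 4) ℚ) =
      ∑ p ∈ Finset.HasAntidiagonal.antidiagonal d₀, ∑ r ∈ Finset.HasAntidiagonal.antidiagonal d₃,
        MvPolynomial.monomial (exponent₂ p.1 (p.2 + d₁) (r.2 + d₂) r.1)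
          ((d₀.choose p.1 : ℚ) * ((d₃.choose r.1 : ℚ) * (-1) ^ r.2)) := by
    rw [sub_eq_add_neg, (Commute.all _ _).add_pow', (Commute.all _ _).add_pow']
    simp only [Finset.sum_mul, Finset.mul_sum]
    rw [Finset.sum_comm]
    refine Finset.sum_congr rfl fun p _ => Finset.sum_congr rfl fun r _ => ?_
    rw [monomial_exponent₂]
    simp only [map_mul, map_natCast, map_pow, map_neg, map_one, nsmul_eq_mul]
    rw [neg_pow (MvPolynomial.X 2 : MvPolynomial (Fin 4) ℚ)]
    ring
  rw [hexp]
  simp only [MvPolynomial.coeff_sum, MvPolynomial.coeff_monomial, exponent₂_inj]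
  have hsplit : ∀ p r : ℕ × ℕ, (if p.1 = i ∧ p.2 + d₁ = j ∧ r.2 + d₂ = a ∧ r.1 = b then
      (d₀.choose p.1 : ℚ) * ((d₃.choose r.1 : ℚ) * (-1) ^ r.2) else 0) =
      (if p.1 = i ∧ p.2 + d₁ = j then (d₀.choose p.1 : ℚ) else 0) *
        (if r.1 = b ∧ r.2 + d₂ = a then (d₃.choose r.1 : ℚ) * (-1) ^ r.2 else 0) := fun p r => by
    by_cases h1 : p.1 = i <;> by_cases h2 : p.2 + d₁ = j <;> by_cases h3 : r.2 + d₂ = a <;>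
      by_cases h4 : r.1 = b <;> simp [h1, h2, h3, h4]
  simp only [hsplit]
  rw [← Finset.sum_mul_sum,
    sum_antidiagonal_ite d₀ d₁ i j (fun p => (d₀.choose p.1 : ℚ)),
    sum_antidiagonal_ite d₃ d₂ b a (fun r => (d₃.choose r.1 : ℚ) * (-1) ^ r.2)]
  have hi : ¬ i ≤ d₀ → (d₀.choose i : ℚ) = 0 := fun h => by
    rw [Nat.choose_eq_zero_of_lt (by omega), Nat.cast_zero]
  have hb : ¬ b ≤ d₃ → (d₃.choose b : ℚ) = 0 := fun h => by
    rw [Nat.choose_eq_zero_of_lt (by omega), Nat.cast_zero]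
  rw [add_comm d₂ d₃, add_comm a b]
  by_cases h1 : i ≤ d₀ <;> by_cases h2 : b ≤ d₃ <;> by_cases h3 : d₀ + d₁ = i + j <;>
    by_cases h4 : d₃ + d₂ = b + a <;> simp [h1, h2, h3, h4, hi, hb]

end CoeffFormulas

/-! ### The slash action -/

section Slash

open MvPowerSeries

/-- The linear forms substituted by `slash`. -/
def slashVec (γ : GL (Fin 2) ℤ) : Fin 4 → Series₂ :=
  ![γ.1 0 0 • X₁ + γ.1 0 1 • X₂, γ.1 1 0 • X₁ + γ.1 1 1 • X₂,
    γ.1.det • (γ.1 1 1 • Y₁ - γ.1 1 0 • Y₂), γ.1.det • (-γ.1 0 1 • Y₁ + γ.1 0 0 • Y₂)]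

theorem slash_eq_subst (R : Series₂) (γ : GL (Fin 2) ℤ) :
    slash R γ = subst (S := ℚ⟦X⟧) (slashVec γ) R := rfl

theorem constantCoeff_slashVec (γ : GL (Fin 2) ℤ) (s : Fin 4) :
    constantCoeff (slashVec γ s) = 0 := by
  fin_cases s <;> simp [slashVec, X₁, X₂, Y₁, Y₂]

theorem hasSubst_slashVec (γ : GL (Fin 2) ℤ) : HasSubst (slashVec γ) :=
  hasSubst_of_constantCoeff_zero (constantCoeff_slashVec γ)

/-- `slash` by a fixed matrix as an algebra homomorphism. -/
def slashHom (γ : GL (Fin 2) ℤ) : Series₂ →ₐ[ℚ⟦X⟧] Series₂ := substAlgHom (hasSubst_slashVec γ)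

theorem slashHom_apply (γ : GL (Fin 2) ℤ) (R : Series₂) : slashHom γ R = slash R γ := by
  rw [slashHom, substAlgHom_apply, slash_eq_subst]

theorem slash_add (R S : Series₂) (γ : GL (Fin 2) ℤ) :
    slash (R + S) γ = slash R γ + slash S γ := by simp only [← slashHom_apply, map_add]
theorem slash_sub (R S : Series₂) (γ : GL (Fin 2) ℤ) :
    slash (R - S) γ = slash R γ - slash S γ := by simp only [← slashHom_apply, map_sub]
theorem slash_neg (R : Series₂) (γ : GL (Fin 2) ℤ) :
    slash (-R) γ = -slash R γ := by simp only [← slashHom_apply, map_neg]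
theorem slash_mul (R S : Series₂) (γ : GL (Fin 2) ℤ) :
    slash (R * S) γ = slash R γ * slash S γ := by simp only [← slashHom_apply, map_mul]
theorem slash_smul (c : ℚ) (R : Series₂) (γ : GL (Fin 2) ℤ) :
    slash (c • R) γ = c • slash R γ := by
  simp only [← slashHom_apply, AlgHom.map_smul_of_tower]

theorem slash_X₁ (γ : GL (Fin 2) ℤ) : slash X₁ γ = γ.1 0 0 • X₁ + γ.1 0 1 • X₂ := by
  rw [slash_eq_subst, X₁, subst_X (hasSubst_slashVec γ)]; rfl
theorem slash_X₂ (γ : GL (Fin 2) ℤ) : slash X₂ γ = γ.1 1 0 • X₁ + γ.1 1 1 • X₂ := by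
  rw [slash_eq_subst, X₂, subst_X (hasSubst_slashVec γ)]; rfl
theorem slash_Y₁ (γ : GL (Fin 2) ℤ) :
    slash Y₁ γ = γ.1.det • (γ.1 1 1 • Y₁ - γ.1 1 0 • Y₂) := by
  rw [slash_eq_subst, Y₁, subst_X (hasSubst_slashVec γ)]; rfl
theorem slash_Y₂ (γ : GL (Fin 2) ℤ) :
    slash Y₂ γ = γ.1.det • (-γ.1 0 1 • Y₁ + γ.1 0 0 • Y₂) := by
  rw [slash_eq_subst, Y₂, subst_X (hasSubst_slashVec γ)]; rfl

/-- The X's are transformed by γ and the Y's by det γ times its cofactor matrix; both are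
multiplicative in γ. -/
theorem slash_slash (R : Series₂) (γ γ' : GL (Fin 2) ℤ) :
    slash (slash R γ) γ' = slash R (γ * γ') := by
  rw [slash_eq_subst R γ, slash_eq_subst _ γ',
    subst_comp_subst_apply (hasSubst_slashVec γ) (hasSubst_slashVec γ'), slash_eq_subst]
  congr 1
  funext s
  have e : (γ * γ').1 = γ.1 * γ'.1 := rfl
  rw [← slash_eq_subst, ← slashHom_apply]
  fin_cases s
  · simp only [slashVec, Fin.zero_eta, Matrix.cons_val_zero, map_add, map_zsmul, slashHom_apply,
      slash_X₁, slash_X₂, e, Matrix.mul_apply, Fin.sum_univ_two]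
    module
  · simp only [slashVec, Fin.mk_one, Matrix.cons_val_one, Matrix.cons_val_zero, map_add, map_zsmul,
      slashHom_apply, slash_X₁, slash_X₂, e, Matrix.mul_apply, Fin.sum_univ_two]
    module
  · simp only [slashVec, Fin.reduceFinMk, Matrix.cons_val, map_sub, map_zsmul,
      slashHom_apply, slash_Y₁, slash_Y₂, e, Matrix.mul_apply, Fin.sum_univ_two, Matrix.det_mul]
    module
  · simp only [slashVec, Fin.reduceFinMk, Matrix.cons_val, map_add, map_zsmul,
      slashHom_apply, slash_Y₁, slash_Y₂, e, Matrix.mul_apply, Fin.sum_univ_two, Matrix.det_mul]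
    module

theorem slash_one (R : Series₂) : slash R 1 = R := by
  have : slashVec 1 = MvPowerSeries.X := by
    funext s
    fin_cases s <;> simp [slashVec, X₁, X₂, Y₁, Y₂]
  rw [slash_eq_subst, this, subst_self, id]

/-- The linear forms substituted by `slash`, as polynomials. -/
def slashPoly (γ : GL (Fin 2) ℤ) : Fin 4 → MvPolynomial (Fin 4) ℚ :=
  ![γ.1 0 0 • MvPolynomial.X 0 + γ.1 0 1 • MvPolynomial.X 1,
    γ.1 1 0 • MvPolynomial.X 0 + γ.1 1 1 • MvPolynomial.X 1,
    γ.1.det • (γ.1 1 1 • MvPolynomial.X 2 - γ.1 1 0 • MvPolynomial.X 3),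
    γ.1.det • (-γ.1 0 1 • MvPolynomial.X 2 + γ.1 0 0 • MvPolynomial.X 3)]

theorem slash_eq_ratSubst (R : Series₂) (γ : GL (Fin 2) ℤ) :
    slash R γ = ratSubst (slashPoly γ) R := by
  rw [slash_eq_subst, ratSubst]
  congr 1
  funext s
  have hX : ∀ t : Fin 4, polyToSeriesHom (MvPolynomial.X t) = (X t : Series₂) := polyToSeries_X
  rw [← polyToSeriesHom_apply]
  fin_cases s <;> simp [slashVec, slashPoly, hX, X₁, X₂, Y₁, Y₂]

theorem isHomogeneous_slashPoly (γ : GL (Fin 2) ℤ) (s : Fin 4) :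
    (slashPoly γ s).IsHomogeneous 1 := by
  have hX : ∀ (c : ℤ) (t : Fin 4),
      (c • MvPolynomial.X t : MvPolynomial (Fin 4) ℚ) ∈ MvPolynomial.homogeneousSubmodule _ ℚ 1 :=
    fun c t => zsmul_mem (MvPolynomial.isHomogeneous_X ℚ t) c
  rw [← MvPolynomial.mem_homogeneousSubmodule]
  fin_cases s
  · exact add_mem (hX _ _) (hX _ _)
  · exact add_mem (hX _ _) (hX _ _)
  · exact zsmul_mem (sub_mem (hX _ _) (hX _ _)) _
  · exact zsmul_mem (add_mem (hX _ _) (hX _ _)) _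

theorem coeff_slash_mem {R : Series₂} {W : ℕ → Submodule ℚ ℚ⟦X⟧}
    (hR : ∀ d, coeff d R ∈ W d.degree) (γ : GL (Fin 2) ℤ) (e : Fin 4 →₀ ℕ) :
    coeff e (slash R γ) ∈ W e.degree := by
  rw [slash_eq_ratSubst]
  exact coeff_ratSubst_mem (isHomogeneous_slashPoly γ) hR e

/-! ### Coefficients after the action of particular matrices -/

/-- The matrix `diag(1, -1)`. -/
def matδ : GL (Fin 2) ℤ := ⟨!![1, 0; 0, -1], !![1, 0; 0, -1], by decide, by decide⟩

/-- Up to factorials this is one half of the double sum in the shuffle relation, which is why that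
relation becomes an equation involving 𝔅₂|T. -/
theorem coeff_slash_matT (R : Series₂) (i j a b : ℕ) :
    coeff (exponent₂ i j a b) (slash R matT) =
      ∑ l ∈ Finset.HasAntidiagonal.antidiagonal (i + j),
        ∑ e ∈ Finset.HasAntidiagonal.antidiagonal (a + b),
          ((l.1.choose i : ℚ) * ((e.2.choose b : ℚ) * (-1) ^ (e.2 - b))) •
            coeff (exponent₂ l.1 l.2 e.1 e.2) R := by
  have hprod : ∀ d : Fin 4 →₀ ℕ, ∏ s, slashPoly matT s ^ d s =
      (MvPolynomial.X 0 + MvPolynomial.X 1) ^ d 0 * MvPolynomial.X 1 ^ d 1 *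
        MvPolynomial.X 2 ^ d 2 * (MvPolynomial.X 3 - MvPolynomial.X 2) ^ d 3 := fun d => by
    simp [Fin.prod_univ_four, slashPoly, matT, Matrix.det_fin_two, neg_add_eq_sub]
  rw [slash_eq_ratSubst, coeff_ratSubst (isHomogeneous_slashPoly _),
    finsum_exponent₂ _ (i + j) (a + b)]
  · refine Finset.sum_congr rfl fun l hl => Finset.sum_congr rfl fun e he => ?_
    rw [Finset.HasAntidiagonal.mem_antidiagonal] at hl he
    rw [hprod]
    simp only [exponent₂_zero, exponent₂_one, exponent₂_two, exponent₂_three]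
    rw [coeff_shear_prod, if_pos ⟨hl, he⟩]
  · intro l l' e e' h
    rw [hprod]
    simp only [exponent₂_zero, exponent₂_one, exponent₂_two, exponent₂_three]
    rw [coeff_shear_prod, if_neg h, zero_smul]

theorem coeff_slash_matε (R : Series₂) (i j a b : ℕ) :
    coeff (exponent₂ i j a b) (slash R matε) = coeff (exponent₂ j i b a) R := by
  have h : slashPoly matε = fun s => MvPolynomial.C ((fun _ => 1 : Fin 4 → ℚ) s) *
      MvPolynomial.X ((Equiv.swap 0 1 * Equiv.swap 2 3 : Equiv.Perm (Fin 4)) s) := by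
    funext s
    fin_cases s <;> simp [slashPoly, matε, Matrix.det_fin_two] <;> congr 1
  rw [slash_eq_ratSubst, h, coeff_ratSubst_signed]
  simp only [one_pow, Finset.prod_const_one, one_smul]
  congr 2
  ext s; fin_cases s <;> rfl

theorem coeff_slash_matδ (R : Series₂) (i j a b : ℕ) :
    coeff (exponent₂ i j a b) (slash R matδ) =
      ((-1) ^ (j + b) : ℚ) • coeff (exponent₂ i j a b) R := by
  have h : slashPoly matδ = fun s => MvPolynomial.C ((![1, -1, 1, -1] : Fin 4 → ℚ) s) *
      MvPolynomial.X ((Equiv.refl _ : Equiv.Perm (Fin 4)) s) := by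
    funext s
    fin_cases s <;> simp [slashPoly, matδ, Matrix.det_fin_two]
  rw [slash_eq_ratSubst, h, coeff_ratSubst_signed]
  simp [Fin.prod_univ_four, pow_add]

theorem coeff_slash_neg_one (R : Series₂) (i j a b : ℕ) :
    coeff (exponent₂ i j a b) (slash R (-1)) =
      ((-1) ^ (i + j + a + b) : ℚ) • coeff (exponent₂ i j a b) R := by
  have h : slashPoly (-1) = fun s => MvPolynomial.C ((fun _ => -1 : Fin 4 → ℚ) s) *
      MvPolynomial.X ((Equiv.refl _ : Equiv.Perm (Fin 4)) s) := by
    funext s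
    fin_cases s <;> simp [slashPoly, Matrix.det_fin_two]
  rw [slash_eq_ratSubst, h, coeff_ratSubst_signed]
  simp [Fin.prod_univ_four, pow_add]

/-! ### The heat operator -/

/-- The operator `∂²/∂X₁∂Y₁ + ∂²/∂X₂∂Y₂`. -/
def heat (R : Series₂) : Series₂ :=
  pderiv _ 0 (pderiv _ 2 R) + pderiv _ 1 (pderiv _ 3 R)

theorem coeff_heat (R : Series₂) (i j a b : ℕ) :
    coeff (exponent₂ i j a b) (heat R) =
      (((i : ℚ) + 1) * ((a : ℚ) + 1)) • coeff (exponent₂ (i + 1) j (a + 1) b) R +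
      (((j : ℚ) + 1) * ((b : ℚ) + 1)) • coeff (exponent₂ i (j + 1) a (b + 1)) R := by
  have hQ : ∀ (m n : ℕ) (x : ℚ⟦X⟧), x * ((n : ℚ⟦X⟧) + 1) * ((m : ℚ⟦X⟧) + 1) =
      (((m : ℚ) + 1) * ((n : ℚ) + 1)) • x := fun m n x => by
    rw [Algebra.smul_def]
    simp only [map_mul, map_add, map_natCast, map_one]
    ring
  rw [heat, map_add, coeff_pderiv, coeff_pderiv, coeff_pderiv, coeff_pderiv,
    single_eq_exponent₂_zero, single_eq_exponent₂_one, single_eq_exponent₂_two,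
    single_eq_exponent₂_three]
  simp only [exponent₂_add, exponent₂_zero, exponent₂_one, exponent₂_two, exponent₂_three,
    add_zero, hQ]

theorem pderiv_slash (R : Series₂) (γ : GL (Fin 2) ℤ) :
    pderiv _ 0 (slash R γ) = γ.1 0 0 • slash (pderiv _ 0 R) γ + γ.1 1 0 • slash (pderiv _ 1 R) γ ∧
    pderiv _ 1 (slash R γ) = γ.1 0 1 • slash (pderiv _ 0 R) γ + γ.1 1 1 • slash (pderiv _ 1 R) γ ∧
    pderiv _ 2 (slash R γ) = γ.1.det •
      (γ.1 1 1 • slash (pderiv _ 2 R) γ - γ.1 0 1 • slash (pderiv _ 3 R) γ) ∧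
    pderiv _ 3 (slash R γ) = γ.1.det •
      (-γ.1 1 0 • slash (pderiv _ 2 R) γ + γ.1 0 0 • slash (pderiv _ 3 R) γ) := by
  have h := fun i => pderiv_subst (constantCoeff_slashVec γ) R i
  simp only [← slash_eq_subst, Fin.sum_univ_four] at h
  have e : ∀ i : Fin 4,
      pderiv ℚ⟦X⟧ i (slashVec γ 0) = γ.1 0 0 • pderiv _ i X₁ + γ.1 0 1 • pderiv _ i X₂ ∧
      pderiv ℚ⟦X⟧ i (slashVec γ 1) = γ.1 1 0 • pderiv _ i X₁ + γ.1 1 1 • pderiv _ i X₂ ∧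
      pderiv ℚ⟦X⟧ i (slashVec γ 2) =
        γ.1.det • (γ.1 1 1 • pderiv _ i Y₁ - γ.1 1 0 • pderiv _ i Y₂) ∧
      pderiv ℚ⟦X⟧ i (slashVec γ 3) =
        γ.1.det • (-γ.1 0 1 • pderiv _ i Y₁ + γ.1 0 0 • pderiv _ i Y₂) := by
    intro i
    refine ⟨?_, ?_, ?_, ?_⟩ <;> simp [slashVec]
  have hx : ∀ i j : Fin 4, pderiv ℚ⟦X⟧ i (MvPowerSeries.X j : Series₂) = if i = j then 1 else 0 := by
    intro i j
    split_ifs with hij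
    · rw [hij, pderiv_X_self]
    · rw [pderiv_X_of_ne (Ne.symm hij)]
  refine ⟨?_, ?_, ?_, ?_⟩ <;>
  · rw [h, (e _).1, (e _).2.1, (e _).2.2.1, (e _).2.2.2]
    simp only [X₁, X₂, Y₁, Y₂, hx, Fin.reduceEq, if_true, if_false, smul_zero, add_zero, zero_add,
      mul_zero, sub_zero, zero_sub, smul_neg, zsmul_eq_mul]
    push_cast
    ring

/-- The operator pairs the X-derivatives with the Y-derivatives, and these transform by mutually
dual representations since det γ = ±1. -/
theorem heat_slash (R : Series₂) (γ : GL (Fin 2) ℤ) : heat (slash R γ) = slash (heat R) γ := by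
  obtain ⟨-, -, h2, h3⟩ := pderiv_slash R γ
  obtain ⟨a0, a1, -, -⟩ := pderiv_slash (pderiv _ 2 R) γ
  obtain ⟨b0, b1, -, -⟩ := pderiv_slash (pderiv _ 3 R) γ
  have hdet : γ.1.det * γ.1.det = 1 := by
    have := γ.isUnit.map (Matrix.detMonoidHom)
    exact Int.isUnit_mul_self this
  -- One determinant is part of the action on the Y's, the other is the ad - bc that comes from
  -- contracting the derivatives; keeping them apart makes this a polynomial identity in a, b, c, d.
  have key : heat (slash R γ) = (γ.1.det * γ.1.det) • slash (heat R) γ := by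
    conv_rhs => rw [Matrix.det_fin_two]
    rw [heat, h2, h3, Matrix.det_fin_two]
    simp only [map_zsmul, map_sub, map_add, a0, a1, b0, b1, heat, slash_add]
    module
  rw [key, hdet, one_smul]

end Slash

/-! ### Substitution of two linear forms -/

section PairSubst

open MvPowerSeries

/-- Substitution of two polynomials into a power series in two variables. -/
def pairSubst (a b : MvPolynomial (Fin 4) ℚ) (T : Series₁) : Series₂ := ratSubst ![a, b] T

theorem isHomogeneous_pair {a b : MvPolynomial (Fin 4) ℚ} (ha : a.IsHomogeneous 1)
    (hb : b.IsHomogeneous 1) (s : Fin 2) : ((![a, b] : Fin 2 → MvPolynomial (Fin 4) ℚ) s).IsHomogeneous 1 := by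
  fin_cases s
  · exact ha
  · exact hb

theorem polyToSeries_add {τ : Type*} (p q : MvPolynomial τ ℚ) :
    polyToSeries (p + q) = polyToSeries p + polyToSeries q := by
  simp only [← polyToSeriesHom_apply, map_add]
theorem polyToSeries_sub {τ : Type*} (p q : MvPolynomial τ ℚ) :
    polyToSeries (p - q) = polyToSeries p - polyToSeries q := by
  simp only [← polyToSeriesHom_apply, map_sub]
theorem polyToSeries_mul {τ : Type*} (p q : MvPolynomial τ ℚ) :
    polyToSeries (p * q) = polyToSeries p * polyToSeries q := by
  simp only [← polyToSeriesHom_apply, map_mul]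

theorem slash_polyToSeries (p : MvPolynomial (Fin 4) ℚ) (γ : GL (Fin 2) ℤ) :
    slash (polyToSeries p) γ = polyToSeries (MvPolynomial.aeval (slashPoly γ) p) := by
  have hs := hasSubst_polyToSeries (isHomogeneous_slashPoly γ)
  have hc : ∀ (r : ℚ) , polyToSeries (MvPolynomial.C r : MvPolynomial (Fin 4) ℚ) =
      algebraMap ℚ⟦X⟧ Series₂ (algebraMap ℚ ℚ⟦X⟧ r) := fun r => by
    rw [polyToSeries, MvPolynomial.map_C, MvPolynomial.coe_C]; rfl
  induction p using MvPolynomial.induction_on with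
  | C r => rw [hc, ← slashHom_apply, AlgHom.commutes, MvPolynomial.aeval_C,
      MvPolynomial.algebraMap_eq, hc]
  | add p q hp hq => rw [polyToSeries_add, slash_add, hp, hq, map_add, polyToSeries_add]
  | mul_X p t hp =>
    rw [polyToSeries_mul, slash_mul, hp, map_mul, polyToSeries_mul, MvPolynomial.aeval_X,
      polyToSeries_X, slash_eq_ratSubst, ratSubst, subst_X hs]

theorem slash_pairSubst {a b : MvPolynomial (Fin 4) ℚ} (ha : a.IsHomogeneous 1)
    (hb : b.IsHomogeneous 1) (T : Series₁) (γ : GL (Fin 2) ℤ) :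
    slash (pairSubst a b T) γ = pairSubst (MvPolynomial.aeval (slashPoly γ) a)
      (MvPolynomial.aeval (slashPoly γ) b) T := by
  rw [pairSubst, ratSubst, slash_eq_subst, subst_comp_subst_apply
    (hasSubst_polyToSeries (isHomogeneous_pair ha hb)) (hasSubst_slashVec γ), pairSubst, ratSubst]
  congr 1
  funext s
  rw [← slash_eq_subst, slash_polyToSeries]
  fin_cases s <;> rfl

theorem subst_eq_pairSubst (s t : Fin 4) (T : Series₁) :
    subst (S := ℚ⟦X⟧) ![(MvPowerSeries.X s : Series₂), MvPowerSeries.X t] T =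
      pairSubst (MvPolynomial.X s) (MvPolynomial.X t) T := by
  rw [pairSubst, ratSubst]
  congr 1
  funext k
  fin_cases k
  · exact (polyToSeries_X s).symm
  · exact (polyToSeries_X t).symm

theorem coeff_pairSubst {a b : MvPolynomial (Fin 4) ℚ} (ha : a.IsHomogeneous 1)
    (hb : b.IsHomogeneous 1) (T : Series₁) (e : Fin 4 →₀ ℕ) (r s : ℕ)
    (h : ∀ r' s', ¬ (r' = r ∧ s' = s) → MvPolynomial.coeff e (a ^ r' * b ^ s') = 0) :
    coeff e (pairSubst a b T) =
      MvPolynomial.coeff e (a ^ r * b ^ s) • coeff (exponent₁ r s) T := by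
  have hp : ∀ d : Fin 2 →₀ ℕ, ∏ s, (![a, b] : Fin 2 → MvPolynomial (Fin 4) ℚ) s ^ d s =
      a ^ d 0 * b ^ d 1 := fun d => by rw [Fin.prod_univ_two]; rfl
  rw [pairSubst, coeff_ratSubst (isHomogeneous_pair ha hb), finsum_eq_single _ (exponent₁ r s)]
  · rw [hp]; rfl
  · intro d hd
    rw [hp, h, zero_smul]
    rintro ⟨rfl, rfl⟩
    exact hd (exponent₁_eq d).symm

local notation "𝕩₁" => (MvPolynomial.X 0 : MvPolynomial (Fin 4) ℚ)
local notation "𝕩₂" => (MvPolynomial.X 1 : MvPolynomial (Fin 4) ℚ)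
local notation "𝕪₁" => (MvPolynomial.X 2 : MvPolynomial (Fin 4) ℚ)
local notation "𝕪₂" => (MvPolynomial.X 3 : MvPolynomial (Fin 4) ℚ)

theorem isHomogeneous_X_add_X (s t : Fin 4) :
    (MvPolynomial.X s + MvPolynomial.X t : MvPolynomial (Fin 4) ℚ).IsHomogeneous 1 :=
  (MvPolynomial.isHomogeneous_X ℚ s).add (MvPolynomial.isHomogeneous_X ℚ t)

theorem isHomogeneous_X_sub_X (s t : Fin 4) :
    (MvPolynomial.X s - MvPolynomial.X t : MvPolynomial (Fin 4) ℚ).IsHomogeneous 1 :=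
  (MvPolynomial.isHomogeneous_X ℚ s).sub (MvPolynomial.isHomogeneous_X ℚ t)

theorem coeff_pairSubst_left (T : Series₁) (i j a b : ℕ) :
    coeff (exponent₂ i j a b) (pairSubst 𝕩₁ 𝕪₁ T) =
      if j = 0 ∧ b = 0 then coeff (exponent₁ i a) T else 0 := by
  have hm : ∀ r s : ℕ, 𝕩₁ ^ r * 𝕪₁ ^ s = MvPolynomial.monomial (exponent₂ r 0 s 0) 1 := by
    intro r s; rw [monomial_exponent₂]; simp
  rw [coeff_pairSubst (MvPolynomial.isHomogeneous_X _ _) (MvPolynomial.isHomogeneous_X _ _) T _ i a]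
  · rw [hm, MvPolynomial.coeff_monomial]
    simp only [exponent₂_inj, true_and]
    by_cases h : j = 0 ∧ b = 0
    · rw [if_pos ⟨h.1.symm, h.2.symm⟩, if_pos h, one_smul]
    · rw [if_neg (fun h' => h ⟨h'.1.symm, h'.2.symm⟩), if_neg h, zero_smul]
  · intro r s h
    rw [hm, MvPolynomial.coeff_monomial, if_neg]
    rw [exponent₂_inj]
    tauto

theorem coeff_pairSubst_stuffle (T : Series₁) (i j a b : ℕ) :
    coeff (exponent₂ i j a b) (pairSubst 𝕩₁ (𝕪₁ + 𝕪₂) T) =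
      if j = 0 then ((a + b).choose a : ℚ) • coeff (exponent₁ i (a + b)) T else 0 := by
  have hm : ∀ r s : ℕ, MvPolynomial.coeff (exponent₂ i j a b) (𝕩₁ ^ r * (𝕪₁ + 𝕪₂) ^ s) =
      if r = i ∧ j = 0 ∧ a + b = s then (s.choose a : ℚ) else 0 := by
    intro r s
    have : 𝕩₁ ^ r * (𝕪₁ + 𝕪₂) ^ s = ∑ p ∈ Finset.HasAntidiagonal.antidiagonal s,
        MvPolynomial.monomial (exponent₂ r 0 p.1 p.2) (s.choose p.1 : ℚ) := by
      rw [(Commute.all _ _).add_pow', Finset.mul_sum]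
      refine Finset.sum_congr rfl fun p _ => ?_
      rw [monomial_exponent₂]
      simp only [map_natCast, nsmul_eq_mul]
      ring
    rw [this, MvPolynomial.coeff_sum]
    simp only [MvPolynomial.coeff_monomial, exponent₂_inj]
    split_ifs with h
    · obtain ⟨rfl, rfl, rfl⟩ := h
      rw [Finset.sum_eq_single (a, b)]
      · simp
      · rintro ⟨p, q⟩ _ hne
        rw [if_neg]
        rintro ⟨-, -, rfl, rfl⟩
        exact hne rfl
      · intro hn; exact absurd (by simp) hn
    · refine Finset.sum_eq_zero fun p hp => if_neg ?_
      rw [Finset.HasAntidiagonal.mem_antidiagonal] at hp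
      rintro ⟨rfl, rfl, rfl, rfl⟩
      exact h ⟨rfl, rfl, hp⟩
  rw [coeff_pairSubst (MvPolynomial.isHomogeneous_X _ _) (isHomogeneous_X_add_X _ _) T _ i (a + b)]
  · rw [hm]
    by_cases h : j = 0 <;> simp [h]
  · intro r s h
    rw [hm, if_neg]
    rintro ⟨rfl, -, rfl⟩
    exact h ⟨rfl, rfl⟩

theorem coeff_pairSubst_shuffle (T : Series₁) (i j a b : ℕ) :
    coeff (exponent₂ i j a b) (pairSubst (𝕩₁ + 𝕩₂) 𝕪₁ T) =
      if b = 0 then ((i + j).choose i : ℚ) • coeff (exponent₁ (i + j) a) T else 0 := by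
  have hm : ∀ r s : ℕ, MvPolynomial.coeff (exponent₂ i j a b) ((𝕩₁ + 𝕩₂) ^ r * 𝕪₁ ^ s) =
      if s = a ∧ b = 0 ∧ i + j = r then (r.choose i : ℚ) else 0 := by
    intro r s
    have : (𝕩₁ + 𝕩₂) ^ r * 𝕪₁ ^ s = ∑ p ∈ Finset.HasAntidiagonal.antidiagonal r,
        MvPolynomial.monomial (exponent₂ p.1 p.2 s 0) (r.choose p.1 : ℚ) := by
      rw [(Commute.all _ _).add_pow', Finset.sum_mul]
      refine Finset.sum_congr rfl fun p _ => ?_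
      rw [monomial_exponent₂]
      simp only [map_natCast, nsmul_eq_mul]
      ring
    rw [this, MvPolynomial.coeff_sum]
    simp only [MvPolynomial.coeff_monomial, exponent₂_inj]
    split_ifs with h
    · obtain ⟨rfl, rfl, rfl⟩ := h
      rw [Finset.sum_eq_single (i, j)]
      · simp
      · rintro ⟨p, q⟩ _ hne
        rw [if_neg]
        rintro ⟨rfl, rfl, -, -⟩
        exact hne rfl
      · intro hn; exact absurd (by simp) hn
    · refine Finset.sum_eq_zero fun p hp => if_neg ?_
      rw [Finset.HasAntidiagonal.mem_antidiagonal] at hp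
      rintro ⟨rfl, rfl, rfl, rfl⟩
      exact h ⟨rfl, rfl, hp⟩
  rw [coeff_pairSubst (isHomogeneous_X_add_X _ _) (MvPolynomial.isHomogeneous_X _ _) T _ (i + j) a]
  · rw [hm]
    by_cases h : b = 0 <;> simp [h]
  · intro r s h
    rw [hm, if_neg]
    rintro ⟨rfl, -, rfl⟩
    exact h ⟨rfl, rfl⟩

theorem slashPoly_matε : slashPoly matε = ![𝕩₂, 𝕩₁, 𝕪₂, 𝕪₁] := by
  funext s; fin_cases s <;> simp [slashPoly, matε, Matrix.det_fin_two]

theorem slashPoly_matT : slashPoly matT = ![𝕩₁ + 𝕩₂, 𝕩₂, 𝕪₁, 𝕪₂ - 𝕪₁] := by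
  funext s; fin_cases s <;> simp [slashPoly, matT, Matrix.det_fin_two, neg_add_eq_sub]

theorem slashPoly_matδ : slashPoly matδ = ![𝕩₁, -𝕩₂, 𝕪₁, -𝕪₂] := by
  funext s; fin_cases s <;> simp [slashPoly, matδ, Matrix.det_fin_two]

theorem pairSubst_right_eq_slash (T : Series₁) :
    pairSubst 𝕩₂ 𝕪₂ T = slash (pairSubst 𝕩₁ 𝕪₁ T) matε := by
  rw [slash_pairSubst (MvPolynomial.isHomogeneous_X _ _) (MvPolynomial.isHomogeneous_X _ _),
    slashPoly_matε]
  simp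

theorem pairSubst_stuffle_eq_slash (T : Series₁) :
    pairSubst 𝕩₂ (𝕪₁ + 𝕪₂) T = slash (pairSubst 𝕩₁ (𝕪₁ + 𝕪₂) T) matε := by
  rw [slash_pairSubst (MvPolynomial.isHomogeneous_X _ _) (isHomogeneous_X_add_X _ _),
    slashPoly_matε]
  simp [add_comm]

theorem pairSubst_shuffle_eq_slash (T : Series₁) :
    pairSubst (𝕩₁ + 𝕩₂) 𝕪₂ T = slash (pairSubst (𝕩₁ + 𝕩₂) 𝕪₁ T) matε := by
  rw [slash_pairSubst (isHomogeneous_X_add_X _ _) (MvPolynomial.isHomogeneous_X _ _),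
    slashPoly_matε]
  simp [add_comm]

theorem coeff_X_mul_exponent (t : Fin 4) (R : Series₂) (n : Fin 4 →₀ ℕ) :
    coeff n (MvPowerSeries.X t * R) =
      if n t = 0 then 0 else coeff (n - Finsupp.single t 1) R := by
  classical
  rw [MvPowerSeries.X, coeff_monomial_mul, one_mul]
  by_cases h : n t = 0
  · rw [if_pos h, if_neg]
    intro h'
    have := h' t
    simp at this
    omega
  · rw [if_neg h, if_pos]
    intro s
    by_cases hs : s = t
    · subst hs; simp; omega
    · simp [hs]

/-- Justifies the coefficientwise definition of the quotient: multiplying by X₁ - X₂ telescopes, and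
only the terms free of X₁ or free of X₂ remain. -/
theorem X_sub_X_mul_stuffleQuotient (T : Series₁) :
    (MvPowerSeries.X 0 - MvPowerSeries.X 1) * stuffleQuotient T =
      pairSubst 𝕩₁ (𝕪₁ + 𝕪₂) T - pairSubst 𝕩₂ (𝕪₁ + 𝕪₂) T := by
  have hc : ∀ i j a b, coeff (exponent₂ i j a b) (stuffleQuotient T) =
      ((a + b).choose a : ℚ) • coeff (exponent₁ (i + j + 1) (a + b)) T := fun _ _ _ _ => rfl
  refine ext_exponent₂ fun i j a b => ?_
  rw [sub_mul, map_sub, map_sub, pairSubst_stuffle_eq_slash, coeff_slash_matε,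
    coeff_pairSubst_stuffle, coeff_pairSubst_stuffle, coeff_X_mul_exponent, coeff_X_mul_exponent,
    exponent₂_zero, exponent₂_one]
  have e0 : ∀ i, exponent₂ (i + 1) j a b - Finsupp.single 0 1 = exponent₂ i j a b := fun i => by
    rw [single_eq_exponent₂_zero]; ext k; fin_cases k <;> simp [exponent₂]
  have e1 : ∀ j, exponent₂ i (j + 1) a b - Finsupp.single 1 1 = exponent₂ i j a b := fun i => by
    rw [single_eq_exponent₂_one]; ext k; fin_cases k <;> simp [exponent₂]
  have hs : ((a + b).choose b : ℚ) = (a + b).choose a := by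
    rw [Nat.choose_symm_add]
  cases i with
  | zero =>
    cases j with
    | zero => simp [hs, add_comm b a]
    | succ j =>
      rw [e1, hc]
      simp [hs, add_comm b a]
  | succ i =>
    cases j with
    | zero => rw [e0, hc]; simp
    | succ j =>
      rw [e0, e1, hc, hc]
      simp only [Nat.add_eq_zero_iff, one_ne_zero, and_false, if_false]
      rw [show i + (j + 1) + 1 = i + 1 + j + 1 by ring]
      simp

theorem Y_sub_Y_mul_shuffleQuotient (T : Series₁) :
    (MvPowerSeries.X 2 - MvPowerSeries.X 3) * shuffleQuotient T =
      pairSubst (𝕩₁ + 𝕩₂) 𝕪₁ T - pairSubst (𝕩₁ + 𝕩₂) 𝕪₂ T := by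
  have hc : ∀ i j a b, coeff (exponent₂ i j a b) (shuffleQuotient T) =
      ((i + j).choose i : ℚ) • coeff (exponent₁ (i + j) (a + b + 1)) T := fun _ _ _ _ => rfl
  refine ext_exponent₂ fun i j a b => ?_
  rw [sub_mul, map_sub, map_sub, pairSubst_shuffle_eq_slash, coeff_slash_matε,
    coeff_pairSubst_shuffle, coeff_pairSubst_shuffle, coeff_X_mul_exponent, coeff_X_mul_exponent,
    exponent₂_two, exponent₂_three]
  have e0 : ∀ a, exponent₂ i j (a + 1) b - Finsupp.single 2 1 = exponent₂ i j a b := fun i => by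
    rw [single_eq_exponent₂_two]; ext k; fin_cases k <;> simp [exponent₂]
  have e1 : ∀ b, exponent₂ i j a (b + 1) - Finsupp.single 3 1 = exponent₂ i j a b := fun i => by
    rw [single_eq_exponent₂_three]; ext k; fin_cases k <;> simp [exponent₂]
  have hs : ((i + j).choose j : ℚ) = (i + j).choose i := by
    rw [Nat.choose_symm_add]
  cases a with
  | zero =>
    cases b with
    | zero => simp [hs, add_comm j i]
    | succ b =>
      rw [e1, hc]
      simp [hs, add_comm j i]
  | succ a =>
    cases b with
    | zero => rw [e0, hc]; simp
    | succ b =>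
      rw [e0, e1, hc, hc]
      simp only [Nat.add_eq_zero_iff, one_ne_zero, and_false, if_false]
      rw [show a + (b + 1) + 1 = a + 1 + b + 1 by ring]
      simp

theorem kroneckerP_eq :
    kroneckerP = pairSubst 𝕩₁ 𝕪₁ kronecker₁ * pairSubst 𝕩₂ 𝕪₂ kronecker₁ := by
  rw [kroneckerP, ← subst_eq_pairSubst, ← subst_eq_pairSubst]
  rfl

theorem coeff_kroneckerP (i j a b : ℕ) :
    coeff (exponent₂ i j a b) kroneckerP =
      coeff (exponent₁ i a) kronecker₁ * coeff (exponent₁ j b) kronecker₁ := by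
  classical
  rw [kroneckerP_eq, pairSubst_right_eq_slash, coeff_mul,
    Finset.sum_eq_single (exponent₂ i 0 a 0, exponent₂ 0 j 0 b)]
  · simp [coeff_slash_matε, coeff_pairSubst_left]
  · rintro ⟨p, q⟩ hpq hne
    rw [Finset.HasAntidiagonal.mem_antidiagonal] at hpq
    dsimp only at hpq ⊢
    rw [← exponent₂_eq p, ← exponent₂_eq q] at hpq hne ⊢
    rw [exponent₂_add, exponent₂_inj] at hpq
    rw [coeff_slash_matε, coeff_pairSubst_left, coeff_pairSubst_left]
    by_cases h1 : p 1 = 0 ∧ p 3 = 0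
    · by_cases h2 : q 0 = 0 ∧ q 2 = 0
      · refine absurd ?_ hne
        rw [Prod.mk.injEq, exponent₂_inj, exponent₂_inj]
        omega
      · rw [if_neg h2, mul_zero]
    · rw [if_neg h1, zero_mul]
  · intro h
    refine absurd ?_ h
    rw [Finset.HasAntidiagonal.mem_antidiagonal, exponent₂_add]
    simp

end PairSubst

/-! ### Coefficients in `q` -/

section QCoeff

open MvPowerSeries

theorem coeff_qDeriv (N : ℕ) (f : ℚ⟦X⟧) :
    PowerSeries.coeff N (qDeriv f) = (N : ℚ) * PowerSeries.coeff N f := by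
  have : qDeriv f = PowerSeries.X * PowerSeries.derivative (R := ℚ) f := rfl
  rw [this]
  cases N with
  | zero => simp
  | succ N =>
    rw [PowerSeries.coeff_succ_X_mul, PowerSeries.coeff_derivative]
    push_cast
    ring

theorem coeff_qDeriv_pow (m N : ℕ) (f : ℚ⟦X⟧) :
    PowerSeries.coeff N ((qDeriv ^ m) f) = (N : ℚ) ^ m * PowerSeries.coeff N f := by
  induction m with
  | zero => simp
  | succ m ih => rw [pow_succ', Module.End.mul_apply, coeff_qDeriv, ih]; ring

/-- The coefficient of `q^N` in a power series over `ℚ⟦q⟧`. -/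
def qCoeff {σ : Type*} (N : ℕ) : MvPowerSeries σ ℚ⟦X⟧ →ₗ[ℚ] MvPowerSeries σ ℚ where
  toFun f n := PowerSeries.coeff N (coeff n f)
  map_add' f g := by ext n; simp only [coeff_apply]; exact map_add _ _ _
  map_smul' c f := by ext n; simp only [coeff_apply]; exact map_smul (PowerSeries.coeff (R := ℚ) N) c _

variable {σ τ : Type*}

theorem coeff_qCoeff (N : ℕ) (f : MvPowerSeries σ ℚ⟦X⟧) (n : σ →₀ ℕ) :
    coeff n (qCoeff N f) = PowerSeries.coeff N (coeff n f) := rfl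

theorem ext_qCoeff {f g : MvPowerSeries σ ℚ⟦X⟧} (h : ∀ N, qCoeff N f = qCoeff N g) : f = g := by
  ext n N
  rw [← coeff_qCoeff, h, coeff_qCoeff]

theorem qCoeff_mul (N : ℕ) (f g : MvPowerSeries σ ℚ⟦X⟧) :
    qCoeff N (f * g) =
      ∑ i ∈ Finset.HasAntidiagonal.antidiagonal N, qCoeff i.1 f * qCoeff i.2 g := by
  classical
  ext n
  rw [coeff_qCoeff, coeff_mul, map_sum, map_sum]
  simp only [PowerSeries.coeff_mul, coeff_mul, coeff_qCoeff]
  exact Finset.sum_comm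

theorem qCoeff_polyToSeries_mul (N : ℕ) (p : MvPolynomial σ ℚ) (f : MvPowerSeries σ ℚ⟦X⟧) :
    qCoeff N (polyToSeries p * f) = (p : MvPowerSeries σ ℚ) * qCoeff N f := by
  classical
  ext n
  rw [coeff_qCoeff, coeff_mul, map_sum, coeff_mul]
  refine Finset.sum_congr rfl fun d _ => ?_
  rw [coeff_polyToSeries, ← Algebra.smul_def, map_smul, smul_eq_mul, MvPolynomial.coeff_coe,
    coeff_qCoeff]

theorem constantCoeff_coe_of_isHomogeneous {a : MvPolynomial τ ℚ} (ha : a.IsHomogeneous 1) :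
    constantCoeff (a : MvPowerSeries τ ℚ) = 0 := by
  rw [← coeff_zero_eq_constantCoeff_apply, MvPolynomial.coeff_coe, ha.coeff_eq_zero (by simp)]

/-- The substituted forms are free of q. Finite support is needed to move the coefficient of q^N
inside the sum. -/
theorem qCoeff_ratSubst [Fintype σ] (N : ℕ) {a : σ → MvPolynomial τ ℚ}
    (ha : ∀ s, (a s).IsHomogeneous 1) (f : MvPowerSeries σ ℚ⟦X⟧) :
    qCoeff N (ratSubst a f) = subst (S := ℚ) (fun s => (a s : MvPowerSeries τ ℚ)) (qCoeff N f) := by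
  have hs : HasSubst fun s => (a s : MvPowerSeries τ ℚ) :=
    hasSubst_of_constantCoeff_zero fun s => constantCoeff_coe_of_isHomogeneous (ha s)
  ext e
  have hfin : (fun d : σ →₀ ℕ =>
      MvPolynomial.coeff e (∏ s, a s ^ d s) • coeff d f).HasFiniteSupport := by
    refine (coeff_subst_finite (hasSubst_polyToSeries ha) f e).subset fun d hd h0 => hd ?_
    dsimp only at h0
    rw [Finsupp.prod_fintype _ _ (by simp)] at h0
    have : ∏ s, polyToSeries (a s) ^ d s = polyToSeries (∏ s, a s ^ d s) := by
      simp only [← polyToSeriesHom_apply, map_prod, map_pow]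
    rwa [this, coeff_polyToSeries, smul_eq_mul, mul_comm, ← Algebra.smul_def] at h0
  rw [coeff_qCoeff, coeff_ratSubst ha, coeff_subst hs]
  refine (AddMonoidHom.map_finsum (PowerSeries.coeff (R := ℚ) N).toAddMonoidHom hfin).trans
    (finsum_congr fun d => ?_)
  rw [Finsupp.prod_fintype _ _ (by simp)]
  have : ∏ s, (a s : MvPowerSeries τ ℚ) ^ d s = ((∏ s, a s ^ d s : MvPolynomial τ ℚ) :
      MvPowerSeries τ ℚ) := by
    simp only [← MvPolynomial.coeToMvPowerSeries.ringHom_apply, map_prod, map_pow]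
  rw [this, MvPolynomial.coeff_coe, coeff_qCoeff, smul_eq_mul, mul_comm]
  exact map_smul (PowerSeries.coeff (R := ℚ) N) _ _

end QCoeff

/-! ### Exponentials of power series without constant term -/

section Exponential

variable {τ : Type*}

/-- The power series `exp (m a)`. -/
def expSeries (a : MvPowerSeries τ ℚ) (m : ℚ) : MvPowerSeries τ ℚ :=
  PowerSeries.subst a (PowerSeries.rescale m (PowerSeries.exp ℚ))

variable {a b : MvPowerSeries τ ℚ}

theorem expSeries_add_right (ha : a.constantCoeff = 0) (m n : ℚ) :
    expSeries a (m + n) = expSeries a m * expSeries a n := by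
  rw [expSeries, ← PowerSeries.exp_mul_exp_eq_exp_add,
    PowerSeries.subst_mul (PowerSeries.HasSubst.of_constantCoeff_zero ha)]
  rfl

theorem expSeries_natCast (ha : a.constantCoeff = 0) (n : ℕ) :
    expSeries a n = expSeries a 1 ^ n := by
  rw [expSeries, ← PowerSeries.exp_pow_eq_rescale_exp,
    PowerSeries.subst_pow (PowerSeries.HasSubst.of_constantCoeff_zero ha), expSeries,
    PowerSeries.rescale_one, RingHom.id_apply]

theorem expSeries_mul_neg (ha : a.constantCoeff = 0) (m : ℚ) :
    expSeries a m * expSeries a (-m) = 1 := by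
  rw [← expSeries_add_right ha, add_neg_cancel, ← Nat.cast_zero, expSeries_natCast ha, pow_zero]

theorem subst_expSeries_X {s : Fin 2} (ha : a.constantCoeff = 0) (hb : b.constantCoeff = 0)
    (m : ℚ) : MvPowerSeries.subst (S := ℚ) ![a, b] (expSeries (MvPowerSeries.X s) m) =
      expSeries ((![a, b] : Fin 2 → MvPowerSeries τ ℚ) s) m := by
  have hab : MvPowerSeries.HasSubst ![a, b] := MvPowerSeries.hasSubst_of_constantCoeff_zero
    fun s => by fin_cases s <;> simp [ha, hb]
  rw [expSeries, PowerSeries.subst, MvPowerSeries.subst_comp_subst_apply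
    (PowerSeries.HasSubst.X s).const hab, expSeries, PowerSeries.subst]
  congr 1
  funext _
  rw [MvPowerSeries.subst_X hab]

/-- Checked on coefficients for two independent variables, then specialized to a and b. -/
theorem expSeries_add_left (ha : a.constantCoeff = 0) (hb : b.constantCoeff = 0) :
    expSeries (a + b) 1 = expSeries a 1 * expSeries b 1 := by
  have hab : MvPowerSeries.HasSubst ![a, b] := MvPowerSeries.hasSubst_of_constantCoeff_zero
    fun s => by fin_cases s <;> simp [ha, hb]
  have hX : MvPowerSeries.constantCoeff
      (MvPowerSeries.X 0 + MvPowerSeries.X 1 : MvPowerSeries (Fin 2) ℚ) = 0 := by simp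
  have h : expSeries (MvPowerSeries.X 0 + MvPowerSeries.X 1 : MvPowerSeries (Fin 2) ℚ) 1 =
      expSeries (MvPowerSeries.X 0) 1 * expSeries (MvPowerSeries.X 1) 1 := by
    ext e
    simp only [expSeries, PowerSeries.rescale_one, RingHom.id_apply]
    rw [PowerSeries.coeff_subst_X_zero_add_X_one, PowerSeries.coeff_subst_X_zero_subst_mul_X_one]
    simp only [PowerSeries.coeff_exp, Algebra.algebraMap_self, RingHom.id_apply]
    rw [Nat.cast_add_choose]
    have := Nat.cast_ne_zero (R := ℚ).mpr (Nat.factorial_ne_zero (e 0 + e 1))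
    field_simp
  have h' := congrArg (MvPowerSeries.subst (S := ℚ) ![a, b]) h
  rw [MvPowerSeries.subst_mul hab, subst_expSeries_X ha hb, subst_expSeries_X ha hb] at h'
  rw [expSeries, PowerSeries.subst, MvPowerSeries.subst_comp_subst_apply
    (PowerSeries.HasSubst.of_constantCoeff_zero hX).const hab] at h'
  rw [MvPowerSeries.subst_add hab, MvPowerSeries.subst_X hab, MvPowerSeries.subst_X hab] at h'
  exact h'

theorem coeff_expSeries_mul (m n : ℚ) (r s : ℕ) :
    MvPowerSeries.coeff (exponent₁ r s)
      (expSeries (MvPowerSeries.X 0) m * expSeries (MvPowerSeries.X 1) n) =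
      m ^ r * n ^ s / (r.factorial * s.factorial) := by
  classical
  have hc : ∀ (t : Fin 2) (m : ℚ) (p : Fin 2 →₀ ℕ),
      MvPowerSeries.coeff p (expSeries (MvPowerSeries.X t) m) =
        if p = Finsupp.single t (p t) then m ^ p t / (p t).factorial else 0 := fun t m p => by
    rw [expSeries, PowerSeries.coeff_subst_single, PowerSeries.coeff_rescale,
      PowerSeries.coeff_exp]
    simp [div_eq_mul_inv]
  have h0 : ∀ p : Fin 2 →₀ ℕ, p = Finsupp.single 0 (p 0) ↔ p 1 = 0 := fun p => by
    constructor
    · intro h; rw [h]; simp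
    · intro h; ext i; fin_cases i <;> simp [h]
  have h1 : ∀ p : Fin 2 →₀ ℕ, p = Finsupp.single 1 (p 1) ↔ p 0 = 0 := fun p => by
    constructor
    · intro h; rw [h]; simp
    · intro h; ext i; fin_cases i <;> simp [h]
  simp only [MvPowerSeries.coeff_mul, hc, h0, h1]
  rw [Finset.sum_eq_single (exponent₁ r 0, exponent₁ 0 s)]
  · simp
    ring
  · rintro ⟨p, q⟩ hpq hne
    rw [Finset.HasAntidiagonal.mem_antidiagonal] at hpq
    dsimp only at hpq ⊢
    have e0 := DFunLike.congr_fun hpq 0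
    have e1 := DFunLike.congr_fun hpq 1
    simp only [Finsupp.add_apply, exponent₁_zero, exponent₁_one] at e0 e1
    by_cases hp : p 1 = 0
    · by_cases hq : q 0 = 0
      · refine absurd ?_ hne
        rw [← exponent₁_eq p, ← exponent₁_eq q, Prod.mk.injEq, exponent₁_inj, exponent₁_inj]
        omega
      · rw [if_neg hq, mul_zero]
    · rw [if_neg hp, zero_mul]
  · intro h
    refine absurd ?_ h
    rw [Finset.HasAntidiagonal.mem_antidiagonal]
    ext i; fin_cases i <;> simp

end Exponential

/-! ### The coefficients of the Kronecker function -/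

section KroneckerCoefficients

open MvPowerSeries

theorem coeff_kronecker₁ (r s : ℕ) :
    coeff (exponent₁ r s) kronecker₁ = if Odd (r + s) then
      (((Nat.dist r s).factorial : ℚ) / ((r.factorial : ℚ) * (s.factorial : ℚ))) •
      (qDeriv ^ min r s) (eisenstein (Nat.dist r s + 1)) else 0 := rfl

theorem coeff_eisenstein {k : ℕ} (hk : Odd k) (N : ℕ) :
    PowerSeries.coeff N (eisenstein (k + 1)) =
      if N = 0 then -(bernoulli (k + 1)) / (2 * ((k + 1).factorial : ℚ))
      else (ArithmeticFunction.sigma k N : ℚ) / (k.factorial : ℚ) := by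
  rw [eisenstein, if_neg (Nat.not_odd_iff_even.mpr hk.add_one), PowerSeries.coeff_mk]
  rfl

theorem odd_dist {r s : ℕ} (h : Odd (r + s)) : Odd (Nat.dist r s) := by
  rw [Nat.dist, Nat.odd_iff] at *
  omega

/-- For mn = N the smaller power can be pulled out as a power of N. On q-series this is an iterated
q d/dq, whence the shape of the coefficients of 𝔅₁. -/
theorem sum_divisorsAntidiagonal_pow (N r s : ℕ) :
    ∑ p ∈ N.divisorsAntidiagonal, (p.1 : ℚ) ^ r * (p.2 : ℚ) ^ s =
      (N : ℚ) ^ min r s * ArithmeticFunction.sigma (Nat.dist r s) N := by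
  wlog h : s ≤ r generalizing r s
  · rw [min_comm, Nat.dist_comm, ← this s r (by omega),
      Nat.sum_divisorsAntidiagonal (fun m n => (m : ℚ) ^ r * (n : ℚ) ^ s),
      Nat.sum_divisorsAntidiagonal' (fun m n => (m : ℚ) ^ s * (n : ℚ) ^ r)]
    exact Finset.sum_congr rfl fun p _ => mul_comm _ _
  · rw [min_eq_right h, Nat.dist_eq_sub_of_le_right h, ArithmeticFunction.sigma_apply,
      Nat.cast_sum, Finset.mul_sum,
      Nat.sum_divisorsAntidiagonal (fun m n => (m : ℚ) ^ r * (n : ℚ) ^ s)]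
    refine Finset.sum_congr rfl fun d hd => ?_
    obtain ⟨⟨e, rfl⟩, hN⟩ := Nat.mem_divisors.mp hd
    have hd0 : 0 < d := Nat.pos_of_ne_zero (by rintro rfl; simp at hN)
    obtain ⟨k, rfl⟩ := Nat.exists_eq_add_of_le h
    rw [Nat.mul_div_cancel_left e hd0, Nat.add_sub_cancel_left]
    push_cast
    ring

/-- The Lambert part of F at x = e^X, y = e^Y. Antisymmetrization kills even total degree and
doubles odd total degree, hence the factor 2. -/
theorem two_smul_qCoeff_kronecker₁ {N : ℕ} (hN : N ≠ 0) :
    (2 : ℚ) • qCoeff N kronecker₁ = ∑ p ∈ N.divisorsAntidiagonal,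
      (expSeries (X 0) p.1 * expSeries (X 1) p.2 - expSeries (X 0) (-p.1) * expSeries (X 1) (-p.2)) := by
  refine ext_exponent₁ fun r s => ?_
  rw [map_smul, coeff_qCoeff, coeff_kronecker₁, map_sum]
  simp only [map_sub, coeff_expSeries_mul]
  have hs : ∀ p : ℕ × ℕ, (p.1 : ℚ) ^ r * (p.2 : ℚ) ^ s / (r.factorial * s.factorial) -
      (-(p.1 : ℚ)) ^ r * (-(p.2 : ℚ)) ^ s / (r.factorial * s.factorial) =
      (1 - (-1) ^ (r + s)) / (r.factorial * s.factorial) * ((p.1 : ℚ) ^ r * (p.2 : ℚ) ^ s) :=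
    fun p => by rw [neg_pow, neg_pow (p.2 : ℚ), pow_add]; ring
  simp only [hs]
  rw [← Finset.mul_sum, sum_divisorsAntidiagonal_pow]
  split_ifs with h
  · rw [map_smul, coeff_qDeriv_pow, coeff_eisenstein (odd_dist h), if_neg hN, h.neg_one_pow]
    have := Nat.cast_ne_zero (R := ℚ).mpr (Nat.factorial_ne_zero (Nat.dist r s))
    simp only [smul_eq_mul]
    field_simp
    ring
  · rw [(Nat.not_odd_iff_even.mp h).neg_one_pow]
    simp

/-- The constant term of the Kronecker function, `∑_{r odd} -B_{r+1} / (2 (r+1)!) x^r`. -/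
def bernoulliTail : ℚ⟦X⟧ := PowerSeries.mk fun r =>
  if Odd r then -(bernoulli (r + 1)) / (2 * ((r + 1).factorial : ℚ)) else 0

theorem qCoeff_zero_kronecker₁ : qCoeff 0 kronecker₁ =
    PowerSeries.subst (X 0 : MvPowerSeries (Fin 2) ℚ) bernoulliTail +
      PowerSeries.subst (X 1 : MvPowerSeries (Fin 2) ℚ) bernoulliTail := by
  classical
  refine ext_exponent₁ fun r s => ?_
  rw [coeff_qCoeff, coeff_kronecker₁, map_add, PowerSeries.coeff_subst_single,
    PowerSeries.coeff_subst_single]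
  have h0 : exponent₁ r s = Finsupp.single 0 r ↔ s = 0 := by
    constructor
    · intro h; simpa using DFunLike.congr_fun h 1
    · rintro rfl; ext i; fin_cases i <;> simp
  have h1 : exponent₁ r s = Finsupp.single 1 s ↔ r = 0 := by
    constructor
    · intro h; simpa using DFunLike.congr_fun h 0
    · rintro rfl; ext i; fin_cases i <;> simp
  simp only [exponent₁_zero, exponent₁_one, h0, h1, bernoulliTail, PowerSeries.coeff_mk]
  by_cases h : Odd (r + s)
  · rw [if_pos h, map_smul, coeff_qDeriv_pow, coeff_eisenstein (odd_dist h), if_pos rfl]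
    have hr := Nat.cast_ne_zero (R := ℚ).mpr (Nat.factorial_ne_zero r)
    have hs := Nat.cast_ne_zero (R := ℚ).mpr (Nat.factorial_ne_zero s)
    rcases Nat.eq_zero_or_pos r with rfl | hr0
    · rw [zero_add] at h
      rw [if_neg (by rintro rfl; simp at h), if_pos rfl, if_pos h, Nat.dist_eq_sub_of_le s.zero_le]
      simp [hs]
    · rw [if_neg hr0.ne', add_zero]
      rcases Nat.eq_zero_or_pos s with rfl | hs0
      · rw [add_zero] at h
        rw [if_pos rfl, if_pos h, Nat.dist_eq_sub_of_le_right r.zero_le]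
        simp [hr]
      · rw [if_neg hs0.ne', Nat.cast_zero, zero_pow (by omega), zero_mul, smul_zero]
  · rw [if_neg h, map_zero]
    have h1 : ¬ (s = 0 ∧ Odd r) := by rintro ⟨rfl, h'⟩; exact h (by simpa using h')
    have h2 : ¬ (r = 0 ∧ Odd s) := by rintro ⟨rfl, h'⟩; exact h (by simpa using h')
    rw [← ite_and, ← ite_and, if_neg h1, if_neg h2, add_zero]

/-- The identity 2X·tail = 1 - X/2 - X/(e^X - 1), with the denominator cleared. In X/(e^X - 1) the
terms with B₀ and B₁ = -1/2 are split off, and the later Bernoulli numbers of odd index vanish. -/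
theorem two_mul_X_mul_bernoulliTail :
    2 * PowerSeries.X * bernoulliTail * (PowerSeries.exp ℚ - 1) =
      (1 - PowerSeries.C (1 / 2 : ℚ) * PowerSeries.X) * (PowerSeries.exp ℚ - 1) -
        PowerSeries.X := by
  have h : 2 * PowerSeries.X * bernoulliTail =
      1 - PowerSeries.C (1 / 2 : ℚ) * PowerSeries.X - bernoulliPowerSeries ℚ := by
    have h2 : (2 : ℚ⟦X⟧) = PowerSeries.C 2 := rfl
    ext n
    rw [h2, mul_assoc, PowerSeries.coeff_C_mul]
    cases n with
    | zero => simp [bernoulliPowerSeries]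
    | succ n =>
      rw [PowerSeries.coeff_succ_X_mul, bernoulliTail, PowerSeries.coeff_mk, map_sub, map_sub,
        PowerSeries.coeff_C_mul, PowerSeries.coeff_X, PowerSeries.coeff_one, bernoulliPowerSeries,
        PowerSeries.coeff_mk, if_neg n.succ_ne_zero]
      have hn := Nat.cast_ne_zero (R := ℚ).mpr (Nat.factorial_ne_zero (n + 1))
      simp only [Algebra.algebraMap_self, RingHom.id_apply]
      rcases Nat.eq_zero_or_pos n with rfl | hn0
      · norm_num [bernoulli_one]
      · rw [if_neg (by omega : ¬ n + 1 = 1)]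
        split_ifs with hodd
        · field_simp
          ring
        · rw [bernoulli_eq_zero_of_odd (Nat.not_odd_iff_even.mp hodd).add_one (by omega)]
          simp
  rw [h, sub_mul _ (bernoulliPowerSeries ℚ), bernoulliPowerSeries_mul_exp_sub_one]

end KroneckerCoefficients

/-! ### The regularized Fay identity -/

section RegularFay

open MvPowerSeries

variable {τ : Type*}

local notation "ι" => algebraMap (MvPowerSeries τ ℚ) (FractionRing (MvPowerSeries τ ℚ))

instance : CharZero (FractionRing (MvPowerSeries τ ℚ)) :=
  haveI : CharZero (MvPowerSeries τ ℚ) := algebraRat.charZero _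
  charZero_of_injective_algebraMap
    (IsFractionRing.injective (MvPowerSeries τ ℚ) (FractionRing (MvPowerSeries τ ℚ)))

variable {a b : MvPowerSeries τ ℚ}

/-- Substituting a into X = (X/(e^X - 1))·(e^X - 1) shows that e^a = 1 forces a = 0. -/
theorem expSeries_ne_one (ha : a.constantCoeff = 0) (ha0 : a ≠ 0) : expSeries a 1 ≠ 1 := by
  intro h
  have hs := PowerSeries.HasSubst.of_constantCoeff_zero ha
  have := congrArg (PowerSeries.substAlgHom hs) (bernoulliPowerSeries_mul_exp_sub_one ℚ)
  rw [map_mul, map_sub, map_one, PowerSeries.coe_substAlgHom, PowerSeries.subst_X hs] at this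
  rw [expSeries, PowerSeries.rescale_one, RingHom.id_apply] at h
  rw [h, sub_self, mul_zero] at this
  exact ha0 this.symm

theorem algebraMap_expSeries_ne_zero (ha : a.constantCoeff = 0) : ι (expSeries a 1) ≠ 0 := by
  intro h
  have := congrArg ι (expSeries_mul_neg ha 1)
  rw [map_mul, h, zero_mul, map_one] at this
  exact zero_ne_one this

theorem algebraMap_expSeries_ne_one (ha : a.constantCoeff = 0) (ha0 : a ≠ 0) :
    ι (expSeries a 1) ≠ 1 := by
  intro h
  rw [← map_one ι] at h
  exact expSeries_ne_one ha ha0 (IsFractionRing.injective _ _ h)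

theorem algebraMap_expSeries_natCast (ha : a.constantCoeff = 0) (n : ℕ) :
    ι (expSeries a n) = ι (expSeries a 1) ^ (n : ℤ) := by
  rw [expSeries_natCast ha, map_pow, zpow_natCast]

theorem algebraMap_expSeries_neg_natCast (ha : a.constantCoeff = 0) (n : ℕ) :
    ι (expSeries a (-n)) = ι (expSeries a 1) ^ (-n : ℤ) := by
  rw [zpow_neg, ← algebraMap_expSeries_natCast ha]
  refine eq_inv_of_mul_eq_one_right ?_
  rw [← map_mul, expSeries_mul_neg ha, map_one]

theorem algebraMap_expSeries_sub (ha : a.constantCoeff = 0) (hb : b.constantCoeff = 0) :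
    ι (expSeries (a - b) 1) = ι (expSeries a 1) / ι (expSeries b 1) := by
  rw [eq_div_iff (algebraMap_expSeries_ne_zero hb), ← map_mul,
    ← expSeries_add_left (by rw [map_sub, ha, hb, sub_zero]) hb, sub_add_cancel]

theorem two_mul_algebraMap_bernoulliTail (ha : a.constantCoeff = 0) (ha0 : a ≠ 0) :
    2 * ι (PowerSeries.subst a bernoulliTail) =
      (ι a)⁻¹ + geomTail (ι (expSeries a 1)) - 1 / 2 := by
  have hs := PowerSeries.HasSubst.of_constantCoeff_zero ha
  have h := congrArg (fun f => ι (PowerSeries.substAlgHom hs f)) two_mul_X_mul_bernoulliTail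
  have hC : ι (PowerSeries.substAlgHom hs (PowerSeries.C (1 / 2 : ℚ))) = 1 / 2 := by
    have : (2 : ℚ⟦X⟧) * PowerSeries.C (1 / 2 : ℚ) = 1 := by
      have h2 : (2 : ℚ⟦X⟧) = PowerSeries.C 2 := rfl
      rw [h2, ← map_mul]
      norm_num
    have := congrArg (fun f => ι (PowerSeries.substAlgHom hs f)) this
    simp only [map_mul, map_ofNat, map_one] at this
    rw [eq_div_iff two_ne_zero, mul_comm, this]
  simp only [map_mul, map_sub, map_one, map_ofNat, hC] at h
  simp only [PowerSeries.coe_substAlgHom, PowerSeries.subst_X hs] at h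
  have he : PowerSeries.subst a (PowerSeries.exp ℚ) = expSeries a 1 := by
    rw [expSeries, PowerSeries.rescale_one, RingHom.id_apply]
  rw [he] at h
  have h1 : ι (expSeries a 1) - 1 ≠ 0 := sub_ne_zero.mpr (algebraMap_expSeries_ne_one ha ha0)
  have h1' : 1 - ι (expSeries a 1) ≠ 0 :=
    sub_ne_zero.mpr (algebraMap_expSeries_ne_one ha ha0).symm
  have h2 : ι a ≠ 0 := by
    rw [Ne, ← map_zero ι]
    exact fun h => ha0 (IsFractionRing.injective _ _ h)
  rw [geomTail]
  generalize ι (PowerSeries.subst a bernoulliTail) = B at *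
  generalize ι (expSeries a 1) = x at *
  generalize ι a = A at *
  have : 2 * B = ((1 - 1 / 2 * A) * (x - 1) - A) / (A * (x - 1)) := by
    rw [eq_div_iff (mul_ne_zero h2 h1), ← h]
    ring
  rw [this]
  field_simp
  ring

theorem hasSubst_pair (ha : a.constantCoeff = 0) (hb : b.constantCoeff = 0) :
    HasSubst ![a, b] :=
  hasSubst_of_constantCoeff_zero fun s => by fin_cases s <;> simp [ha, hb]

/-- The coefficient of `q^N` of the Kronecker function at two given power series. -/
def kroneckerAt (N : ℕ) (a b : MvPowerSeries τ ℚ) : MvPowerSeries τ ℚ :=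
  subst (S := ℚ) ![a, b] (qCoeff N kronecker₁)

/-- This is F(e^a, e^b) = 2𝔅₁(a;b) - 1/a - 1/b. The fraction field gives meaning to the poles, which
occur only in the coefficient of q^0. -/
theorem kroneckerCoeff_eq (ha : a.constantCoeff = 0) (hb : b.constantCoeff = 0)
    (ha0 : a ≠ 0) (hb0 : b ≠ 0) (N : ℕ) :
    kroneckerCoeff (ι (expSeries a 1)) (ι (expSeries b 1)) N =
      2 * ι (kroneckerAt N a b) - if N = 0 then (ι a)⁻¹ + (ι b)⁻¹ else 0 := by
  have hab := hasSubst_pair ha hb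
  rw [kroneckerCoeff, kroneckerAt]
  by_cases hN : N = 0
  · subst hN
    have hX : ∀ s : Fin 2, subst (S := ℚ) ![a, b]
        (PowerSeries.subst (X s : MvPowerSeries (Fin 2) ℚ) bernoulliTail) =
        PowerSeries.subst ((![a, b] : Fin 2 → MvPowerSeries τ ℚ) s) bernoulliTail := fun s => by
      rw [PowerSeries.subst, subst_comp_subst_apply (PowerSeries.HasSubst.X s).const hab,
        PowerSeries.subst]
      congr 1
      funext _
      rw [subst_X hab]
    rw [if_pos rfl, if_pos rfl, qCoeff_zero_kronecker₁, subst_add hab, hX, hX, map_add, mul_add]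
    simp only [Matrix.cons_val_zero, Matrix.cons_val_one]
    rw [two_mul_algebraMap_bernoulliTail ha ha0, two_mul_algebraMap_bernoulliTail hb hb0]
    simp only [lambertCoeff, Nat.divisorsAntidiagonal_zero, Finset.sum_empty]
    ring
  · have h := congrArg (fun f => ι (substAlgHom hab f)) (two_smul_qCoeff_kronecker₁ hN)
    simp only [map_sum, map_sub, map_mul] at h
    simp only [substAlgHom_apply] at h
    have h2 : ι (subst ![a, b] ((2 : ℚ) • qCoeff N kronecker₁)) =
        2 * ι (subst ![a, b] (qCoeff N kronecker₁)) := by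
      rw [subst_smul hab, two_smul, map_add, two_mul]
    rw [h2] at h
    rw [h, if_neg hN, if_neg hN, zero_add, sub_zero, lambertCoeff]
    refine Finset.sum_congr rfl fun p _ => ?_
    simp only [subst_expSeries_X ha hb, Matrix.cons_val_zero, Matrix.cons_val_one,
      algebraMap_expSeries_natCast, algebraMap_expSeries_neg_natCast, ha, hb]

theorem sum_sub_ite_mul {K : Type*} [CommRing K] (f g : ℕ → K) (c d : K) (N : ℕ) :
    ∑ i ∈ Finset.HasAntidiagonal.antidiagonal N, (f i.1 - if i.1 = 0 then c else 0) *
      (g i.2 - if i.2 = 0 then d else 0) =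
      ∑ i ∈ Finset.HasAntidiagonal.antidiagonal N, f i.1 * g i.2 - c * g N - d * f N +
        if N = 0 then c * d else 0 := by
  have h1 : ∑ i ∈ Finset.HasAntidiagonal.antidiagonal N, (if i.1 = 0 then c else 0) * g i.2 =
      c * g N := by
    rw [Finset.sum_eq_single (0, N)]
    · simp
    · rintro ⟨p, q⟩ h hne
      rw [Finset.HasAntidiagonal.mem_antidiagonal] at h
      rw [if_neg, zero_mul]
      rintro rfl
      exact hne (by simpa using h)
    · intro h; exact absurd (by simp) h
  have h2 : ∑ i ∈ Finset.HasAntidiagonal.antidiagonal N, f i.1 * (if i.2 = 0 then d else 0) =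
      d * f N := by
    rw [Finset.sum_eq_single (N, 0)]
    · simp [mul_comm]
    · rintro ⟨p, q⟩ h hne
      rw [Finset.HasAntidiagonal.mem_antidiagonal] at h
      rw [if_neg, mul_zero]
      rintro rfl
      exact hne (by simpa using h)
    · intro h; exact absurd (by simp) h
  have h3 : ∑ i ∈ Finset.HasAntidiagonal.antidiagonal N,
      (if i.1 = 0 then c else 0) * (if i.2 = 0 then d else 0) = if N = 0 then c * d else 0 := by
    split_ifs with hN
    · subst hN; simp
    · refine Finset.sum_eq_zero ?_
      rintro ⟨p, q⟩ h
      rw [Finset.HasAntidiagonal.mem_antidiagonal] at h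
      by_cases hp : p = 0
      · rw [if_neg (by omega : ¬ q = 0), mul_zero]
      · rw [if_neg hp, zero_mul]
  simp only [sub_mul, mul_sub, Finset.sum_sub_distrib, h1, h2, h3]
  ring

/-- Expand the Fay identity with F = 2𝔅₁ - polar part. The terms with one polar factor regroup into
six difference quotients; dividing by 4 leaves the factor 1/2. -/
theorem kroneckerAt_fay {a₁ a₂ b₁ b₂ : MvPowerSeries τ ℚ} (ha₁ : a₁.constantCoeff = 0)
    (ha₂ : a₂.constantCoeff = 0) (hb₁ : b₁.constantCoeff = 0) (hb₂ : b₂.constantCoeff = 0)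
    (ha₁' : a₁ ≠ 0) (ha₂' : a₂ ≠ 0) (ha' : a₁ + a₂ ≠ 0) (hb₁' : b₁ ≠ 0) (hb₂' : b₂ ≠ 0)
    (hb' : b₁ - b₂ ≠ 0) (N : ℕ) :
    ∑ i ∈ Finset.HasAntidiagonal.antidiagonal N,
        ι (kroneckerAt i.1 a₁ b₁) * ι (kroneckerAt i.2 a₂ b₂) -
      ∑ i ∈ Finset.HasAntidiagonal.antidiagonal N,
        ι (kroneckerAt i.1 (a₁ + a₂) b₁) * ι (kroneckerAt i.2 a₂ (b₂ - b₁)) -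
      ∑ i ∈ Finset.HasAntidiagonal.antidiagonal N,
        ι (kroneckerAt i.1 (a₁ + a₂) b₂) * ι (kroneckerAt i.2 a₁ (b₁ - b₂)) =
    1 / 2 * ((ι (kroneckerAt N a₂ b₂) - ι (kroneckerAt N (a₁ + a₂) b₂)) / ι a₁ +
      (ι (kroneckerAt N a₁ b₁) - ι (kroneckerAt N (a₁ + a₂) b₁)) / ι a₂ -
      (ι (kroneckerAt N a₁ (b₁ - b₂)) + ι (kroneckerAt N a₂ (b₂ - b₁))) / ι (a₁ + a₂) +
      (ι (kroneckerAt N (a₁ + a₂) b₁) - ι (kroneckerAt N (a₁ + a₂) b₂)) / ι (b₁ - b₂) +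
      (ι (kroneckerAt N a₁ b₁) - ι (kroneckerAt N a₁ (b₁ - b₂))) / ι b₂ +
      (ι (kroneckerAt N a₂ b₂) - ι (kroneckerAt N a₂ (b₂ - b₁))) / ι b₁) := by
  have hne : ∀ {c : MvPowerSeries τ ℚ}, c ≠ 0 → ι c ≠ 0 := fun hc h =>
    hc (IsFractionRing.injective _ (FractionRing (MvPowerSeries τ ℚ)) (h.trans (map_zero ι).symm))
  have hb'' : b₂ - b₁ ≠ 0 := fun h => hb' (by rw [← neg_sub, h, neg_zero])
  have ha : (a₁ + a₂).constantCoeff = 0 := by rw [map_add, ha₁, ha₂, add_zero]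
  have hb : (b₁ - b₂).constantCoeff = 0 := by rw [map_sub, hb₁, hb₂, sub_zero]
  have hbn : (b₂ - b₁).constantCoeff = 0 := by rw [map_sub, hb₁, hb₂, sub_zero]
  have hadd : ι (expSeries a₁ 1) * ι (expSeries a₂ 1) = ι (expSeries (a₁ + a₂) 1) := by
    rw [← map_mul, expSeries_add_left ha₁ ha₂]
  have hF := kroneckerCoeff_fay (algebraMap_expSeries_ne_zero ha₁)
    (algebraMap_expSeries_ne_zero ha₂) (algebraMap_expSeries_ne_zero hb₁)
    (algebraMap_expSeries_ne_zero hb₂) (algebraMap_expSeries_ne_one ha₁ ha₁')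
    (algebraMap_expSeries_ne_one ha₂ ha₂')
    (by rw [hadd]; exact algebraMap_expSeries_ne_one ha ha')
    (algebraMap_expSeries_ne_one hb₁ hb₁') (algebraMap_expSeries_ne_one hb₂ hb₂')
    (by rw [← algebraMap_expSeries_sub hb₂ hb₁]; exact algebraMap_expSeries_ne_one hbn hb'') N
  rw [hadd, ← algebraMap_expSeries_sub hb₂ hb₁, ← algebraMap_expSeries_sub hb₁ hb₂] at hF
  simp only [kroneckerCoeff_eq ha₁ hb₁ ha₁' hb₁', kroneckerCoeff_eq ha₂ hb₂ ha₂' hb₂',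
    kroneckerCoeff_eq ha hb₁ ha' hb₁', kroneckerCoeff_eq ha hb₂ ha' hb₂',
    kroneckerCoeff_eq ha₁ hb ha₁' hb', kroneckerCoeff_eq ha₂ hbn ha₂' hb''] at hF
  rw [sum_sub_ite_mul (fun n => 2 * ι (kroneckerAt n a₁ b₁))
      (fun n => 2 * ι (kroneckerAt n a₂ b₂)),
    sum_sub_ite_mul (fun n => 2 * ι (kroneckerAt n (a₁ + a₂) b₁))
      (fun n => 2 * ι (kroneckerAt n a₂ (b₂ - b₁))),
    sum_sub_ite_mul (fun n => 2 * ι (kroneckerAt n (a₁ + a₂) b₂))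
      (fun n => 2 * ι (kroneckerAt n a₁ (b₁ - b₂)))] at hF
  -- The rational function 1/a + 1/b satisfies the Fay identity itself, so no term with two poles is
  -- left.
  have hpolar : ((ι a₁)⁻¹ + (ι b₁)⁻¹) * ((ι a₂)⁻¹ + (ι b₂)⁻¹) -
      ((ι (a₁ + a₂))⁻¹ + (ι b₁)⁻¹) * ((ι a₂)⁻¹ + (ι (b₂ - b₁))⁻¹) -
      ((ι (a₁ + a₂))⁻¹ + (ι b₂)⁻¹) * ((ι a₁)⁻¹ + (ι (b₁ - b₂))⁻¹) = 0 := by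
    have e1 := hne ha'
    have e2 := hne hb'
    rw [← neg_sub b₁ b₂]
    rw [map_neg]
    rw [map_add] at e1 ⊢
    rw [map_sub] at e2 ⊢
    have := hne ha₁'
    have := hne ha₂'
    have := hne hb₁'
    have := hne hb₂'
    field_simp
    ring
  have hpolar' : (if N = 0 then ((ι a₁)⁻¹ + (ι b₁)⁻¹) * ((ι a₂)⁻¹ + (ι b₂)⁻¹) else 0) -
      (if N = 0 then ((ι (a₁ + a₂))⁻¹ + (ι b₁)⁻¹) * ((ι a₂)⁻¹ + (ι (b₂ - b₁))⁻¹) else 0) -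
      (if N = 0 then ((ι (a₁ + a₂))⁻¹ + (ι b₂)⁻¹) * ((ι a₁)⁻¹ + (ι (b₁ - b₂))⁻¹) else 0) = 0 := by
    split_ifs
    · exact hpolar
    · simp
  have hneg : (ι (b₂ - b₁))⁻¹ = -(ι (b₁ - b₂))⁻¹ := by rw [← neg_sub, map_neg, inv_neg]
  have h4 : ∀ f g : ℕ → FractionRing (MvPowerSeries τ ℚ),
      ∑ i ∈ Finset.HasAntidiagonal.antidiagonal N, 2 * f i.1 * (2 * g i.2) =
      4 * ∑ i ∈ Finset.HasAntidiagonal.antidiagonal N, f i.1 * g i.2 := fun f g => by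
    rw [Finset.mul_sum]
    exact Finset.sum_congr rfl fun i _ => by ring
  rw [h4 (fun n => ι (kroneckerAt n a₁ b₁)) (fun n => ι (kroneckerAt n a₂ b₂)),
    h4 (fun n => ι (kroneckerAt n (a₁ + a₂) b₁)) (fun n => ι (kroneckerAt n a₂ (b₂ - b₁))),
    h4 (fun n => ι (kroneckerAt n (a₁ + a₂) b₂)) (fun n => ι (kroneckerAt n a₁ (b₁ - b₂)))] at hF
  rw [hneg] at hF hpolar'
  simp only [div_eq_mul_inv]
  linear_combination (1 / 4) * hF - (1 / 4) * hpolar'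

end RegularFay

/-! ### The Fay identity in terms of the action of `GL₂(ℤ)` -/

section SlashFay

open MvPowerSeries

local notation "𝕩₁" => (MvPolynomial.X 0 : MvPolynomial (Fin 4) ℚ)
local notation "𝕩₂" => (MvPolynomial.X 1 : MvPolynomial (Fin 4) ℚ)
local notation "𝕪₁" => (MvPolynomial.X 2 : MvPolynomial (Fin 4) ℚ)
local notation "𝕪₂" => (MvPolynomial.X 3 : MvPolynomial (Fin 4) ℚ)
local notation "κ[" a ", " b "]" => pairSubst a b kronecker₁

/-- 𝔅₁ has only terms of odd total degree. This absorbs the signs that δ introduces. -/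
theorem pairSubst_neg_neg {a b : MvPolynomial (Fin 4) ℚ} (ha : a.IsHomogeneous 1)
    (hb : b.IsHomogeneous 1) : κ[-a, -b] = -κ[a, b] := by
  ext1 e
  rw [map_neg, pairSubst, pairSubst, coeff_ratSubst (isHomogeneous_pair ha hb),
    coeff_ratSubst (isHomogeneous_pair ha.neg hb.neg), ← finsum_neg_distrib]
  refine finsum_congr fun d => ?_
  rw [← exponent₁_eq d, coeff_kronecker₁]
  split_ifs with h
  · rw [← neg_smul, Fin.prod_univ_two, Fin.prod_univ_two]
    simp only [Matrix.cons_val_zero, Matrix.cons_val_one, exponent₁_zero, exponent₁_one]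
    rw [neg_pow a, neg_pow b, mul_mul_mul_comm, ← pow_add, h.neg_one_pow, neg_one_mul,
      MvPolynomial.coeff_neg]
  · simp

theorem qCoeff_pairSubst (N : ℕ) {a b : MvPolynomial (Fin 4) ℚ} (ha : a.IsHomogeneous 1)
    (hb : b.IsHomogeneous 1) :
    qCoeff N κ[a, b] = kroneckerAt N (a : MvPowerSeries (Fin 4) ℚ) (b : MvPowerSeries (Fin 4) ℚ) := by
  rw [pairSubst, qCoeff_ratSubst N (isHomogeneous_pair ha hb), kroneckerAt]
  congr 1
  funext s
  fin_cases s <;> rfl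

theorem slash_mul_eq {R S : Series₂} {p : MvPolynomial (Fin 4) ℚ} (h : polyToSeries p * R = S)
    (γ : GL (Fin 2) ℤ) :
    polyToSeries (MvPolynomial.aeval (slashPoly γ) p) * slash R γ = slash S γ := by
  rw [← h, slash_mul, slash_polyToSeries]

local notation "R⋆" => stuffleQuotient kronecker₁
local notation "Rш" => shuffleQuotient kronecker₁

theorem isHomogeneous_X (s : Fin 4) : (MvPolynomial.X s : MvPolynomial (Fin 4) ℚ).IsHomogeneous 1 :=
  MvPolynomial.isHomogeneous_X ℚ s

theorem polyToSeries_mul_stuffleQuotient :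
    polyToSeries (𝕩₁ - 𝕩₂) * R⋆ = κ[𝕩₁, 𝕪₁ + 𝕪₂] - κ[𝕩₂, 𝕪₁ + 𝕪₂] := by
  rw [polyToSeries_sub, polyToSeries_X, polyToSeries_X, X_sub_X_mul_stuffleQuotient]

theorem polyToSeries_mul_shuffleQuotient :
    polyToSeries (𝕪₁ - 𝕪₂) * Rш = κ[𝕩₁ + 𝕩₂, 𝕪₁] - κ[𝕩₁ + 𝕩₂, 𝕪₂] := by
  rw [polyToSeries_sub, polyToSeries_X, polyToSeries_X, Y_sub_Y_mul_shuffleQuotient]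

theorem stuffleQuotient_slash_T :
    polyToSeries 𝕩₁ * slash R⋆ matT = κ[𝕩₁ + 𝕩₂, 𝕪₂] - κ[𝕩₂, 𝕪₂] := by
  have h := slash_mul_eq polyToSeries_mul_stuffleQuotient matT
  rw [slash_sub, slash_pairSubst (isHomogeneous_X _) (isHomogeneous_X_add_X _ _),
    slash_pairSubst (isHomogeneous_X _) (isHomogeneous_X_add_X _ _), slashPoly_matT] at h
  simpa using h

theorem stuffleQuotient_slash_Tε :
    polyToSeries 𝕩₂ * slash R⋆ (matT * matε) = κ[𝕩₁ + 𝕩₂, 𝕪₁] - κ[𝕩₁, 𝕪₁] := by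
  have h := slash_mul_eq stuffleQuotient_slash_T matε
  rw [slash_slash, slash_sub, slash_pairSubst (isHomogeneous_X_add_X _ _) (isHomogeneous_X _),
    slash_pairSubst (isHomogeneous_X _) (isHomogeneous_X _), slashPoly_matε] at h
  simpa [add_comm] using h

theorem stuffleQuotient_slash_δ :
    polyToSeries (𝕩₁ + 𝕩₂) * slash R⋆ matδ = κ[𝕩₁, 𝕪₁ - 𝕪₂] + κ[𝕩₂, 𝕪₂ - 𝕪₁] := by
  have h := slash_mul_eq polyToSeries_mul_stuffleQuotient matδ
  rw [slash_sub, slash_pairSubst (isHomogeneous_X _) (isHomogeneous_X_add_X _ _),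
    slash_pairSubst (isHomogeneous_X _) (isHomogeneous_X_add_X _ _), slashPoly_matδ] at h
  have e := pairSubst_neg_neg (isHomogeneous_X 1) (isHomogeneous_X_sub_X 3 2)
  rw [neg_sub] at e
  simpa [← sub_eq_add_neg, e] using h

theorem shuffleQuotient_slash_δT :
    polyToSeries 𝕪₂ * slash Rш (matδ * matT) = κ[𝕩₁, 𝕪₁] - κ[𝕩₁, 𝕪₁ - 𝕪₂] := by
  have h := slash_mul_eq (slash_mul_eq polyToSeries_mul_shuffleQuotient matδ) matT
  rw [slash_slash, slash_sub, slash_sub,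
    slash_pairSubst (isHomogeneous_X_add_X _ _) (isHomogeneous_X _),
    slash_pairSubst (isHomogeneous_X_add_X _ _) (isHomogeneous_X _), slashPoly_matδ] at h
  simp only [map_add, map_sub, MvPolynomial.aeval_X, Matrix.cons_val] at h
  rw [← sub_eq_add_neg, slash_pairSubst (isHomogeneous_X_sub_X _ _) (isHomogeneous_X _),
    slash_pairSubst (isHomogeneous_X_sub_X _ _) (isHomogeneous_X _).neg, slashPoly_matT] at h
  simpa using h

theorem shuffleQuotient_slash_δTε :
    polyToSeries 𝕪₁ * slash Rш (matδ * matT * matε) = κ[𝕩₂, 𝕪₂] - κ[𝕩₂, 𝕪₂ - 𝕪₁] := by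
  have h := slash_mul_eq shuffleQuotient_slash_δT matε
  rw [slash_slash, slash_sub, slash_pairSubst (isHomogeneous_X _) (isHomogeneous_X _),
    slash_pairSubst (isHomogeneous_X _) (isHomogeneous_X_sub_X _ _), slashPoly_matε] at h
  simpa using h

theorem kroneckerP_slash_T :
    slash kroneckerP matT = κ[𝕩₁ + 𝕩₂, 𝕪₁] * κ[𝕩₂, 𝕪₂ - 𝕪₁] := by
  rw [kroneckerP_eq, slash_mul, slash_pairSubst (isHomogeneous_X _) (isHomogeneous_X _),
    slash_pairSubst (isHomogeneous_X _) (isHomogeneous_X _), slashPoly_matT]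
  simp

theorem kroneckerP_slash_Tε :
    slash kroneckerP (matT * matε) = κ[𝕩₁ + 𝕩₂, 𝕪₂] * κ[𝕩₁, 𝕪₁ - 𝕪₂] := by
  rw [← slash_slash, kroneckerP_slash_T, slash_mul,
    slash_pairSubst (isHomogeneous_X_add_X _ _) (isHomogeneous_X _),
    slash_pairSubst (isHomogeneous_X _) (isHomogeneous_X_sub_X _ _), slashPoly_matε]
  simp [add_comm]

theorem X_add_X_ne_zero {s t : Fin 4} (h : s ≠ t) :
    (MvPolynomial.X s + MvPolynomial.X t : MvPolynomial (Fin 4) ℚ) ≠ 0 := fun h0 => by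
  have := congrArg (MvPolynomial.eval fun i => if i = s then (1 : ℚ) else 0) h0
  simp [h.symm] at this

theorem X_sub_X_ne_zero {s t : Fin 4} (h : s ≠ t) :
    (MvPolynomial.X s - MvPolynomial.X t : MvPolynomial (Fin 4) ℚ) ≠ 0 := fun h0 => by
  have := congrArg (MvPolynomial.eval fun i => if i = s then (1 : ℚ) else 0) h0
  simp [h.symm] at this

/-- The Fay identity for the Kronecker function without its polar part. -/
theorem kroneckerP_fay :
    slash kroneckerP matT + slash kroneckerP (matT * matε) = kroneckerP +
      (1 / 2 : ℚ) • (slash R⋆ matT + slash R⋆ (matT * matε) + slash R⋆ matδ) -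
      (1 / 2 : ℚ) • (Rш + slash Rш (matδ * matT) + slash Rш (matδ * matT * matε)) := by
  refine ext_qCoeff fun N => ?_
  refine IsFractionRing.injective (MvPowerSeries (Fin 4) ℚ)
    (FractionRing (MvPowerSeries (Fin 4) ℚ)) ?_
  have hcc : ∀ {p : MvPolynomial (Fin 4) ℚ}, p.IsHomogeneous 1 →
      constantCoeff (p : MvPowerSeries (Fin 4) ℚ) = 0 := constantCoeff_coe_of_isHomogeneous
  have hne : ∀ {p : MvPolynomial (Fin 4) ℚ}, p ≠ 0 → (p : MvPowerSeries (Fin 4) ℚ) ≠ 0 :=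
    fun hp h => hp (MvPolynomial.coe_injective (Fin 4) ℚ (by rw [h, MvPolynomial.coe_zero]))
  have hsub : ∀ p q : MvPolynomial (Fin 4) ℚ, ((p - q : MvPolynomial (Fin 4) ℚ) :
      MvPowerSeries (Fin 4) ℚ) = p - q := fun p q => by
    simp only [← MvPolynomial.coeToMvPowerSeries.ringHom_apply, map_sub]
  have hF := kroneckerAt_fay (hcc (isHomogeneous_X 0)) (hcc (isHomogeneous_X 1))
    (hcc (isHomogeneous_X 2)) (hcc (isHomogeneous_X 3)) (hne (MvPolynomial.X_ne_zero 0))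
    (hne (MvPolynomial.X_ne_zero 1))
    (by rw [← MvPolynomial.coe_add]; exact hne (X_add_X_ne_zero (by decide)))
    (hne (MvPolynomial.X_ne_zero 2)) (hne (MvPolynomial.X_ne_zero 3))
    (by rw [← hsub]; exact hne (X_sub_X_ne_zero (by decide))) N
  rw [← hsub, ← hsub, ← MvPolynomial.coe_add] at hF
  simp only [← qCoeff_pairSubst, isHomogeneous_X, isHomogeneous_X_add_X, isHomogeneous_X_sub_X]
    at hF
  -- Translates each of the six quotients in the fraction field into a translate of R^* or R^ш,
  -- through the product formulas proved before.
  have hquot : ∀ {p : MvPolynomial (Fin 4) ℚ} {R S : Series₂}, p ≠ 0 → polyToSeries p * R = S →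
      algebraMap _ (FractionRing (MvPowerSeries (Fin 4) ℚ)) (qCoeff N R) =
        algebraMap _ (FractionRing (MvPowerSeries (Fin 4) ℚ)) (qCoeff N S) /
          algebraMap _ (FractionRing (MvPowerSeries (Fin 4) ℚ))
            (p : MvPowerSeries (Fin 4) ℚ) := fun {p R S} hp h => by
    rw [eq_div_iff, ← h, qCoeff_polyToSeries_mul, map_mul, mul_comm]
    intro h0
    exact hne hp (IsFractionRing.injective _ (FractionRing (MvPowerSeries (Fin 4) ℚ))
      (h0.trans (map_zero _).symm))
  have h1 := hquot (MvPolynomial.X_ne_zero 0) stuffleQuotient_slash_T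
  have h2 := hquot (MvPolynomial.X_ne_zero 1) stuffleQuotient_slash_Tε
  have h3 := hquot (X_add_X_ne_zero (by decide)) stuffleQuotient_slash_δ
  have h4 := hquot (X_sub_X_ne_zero (by decide)) polyToSeries_mul_shuffleQuotient
  have h5 := hquot (MvPolynomial.X_ne_zero 3) shuffleQuotient_slash_δT
  have h6 := hquot (MvPolynomial.X_ne_zero 2) shuffleQuotient_slash_δTε
  have hhalf : ∀ f : MvPowerSeries (Fin 4) ℚ,
      algebraMap _ (FractionRing (MvPowerSeries (Fin 4) ℚ)) ((1 / 2 : ℚ) • f) =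
        1 / 2 * algebraMap _ (FractionRing (MvPowerSeries (Fin 4) ℚ)) f := fun f => by
    have : (2 : MvPowerSeries (Fin 4) ℚ) * ((1 / 2 : ℚ) • f) = f := by
      rw [two_mul, ← add_smul]; norm_num
    have := congrArg (algebraMap _ (FractionRing (MvPowerSeries (Fin 4) ℚ))) this
    rw [map_mul, map_ofNat] at this
    rw [← this]
    ring
  rw [kroneckerP_slash_T, kroneckerP_slash_Tε, kroneckerP_eq]
  simp only [map_add, map_sub, map_smul, qCoeff_mul, hhalf, map_sum, map_mul, h1, h2, h3, h4, h5,
    h6]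
  linear_combination -hF

end SlashFay

/-! ### The double shuffle relations -/

section DoubleShuffle

open MvPowerSeries

local notation "R⋆" => stuffleQuotient kronecker₁
local notation "Rш" => shuffleQuotient kronecker₁
local notation "𝐏" => kroneckerP

theorem coeff_kronecker₁_of_even {r s : ℕ} (h : Even (r + s)) :
    coeff (exponent₁ r s) kronecker₁ = 0 := by
  rw [coeff_kronecker₁, if_neg (Nat.not_odd_iff_even.mpr h)]

theorem coeff_stuffleQuotient (i j a b : ℕ) (T : Series₁) :
    coeff (exponent₂ i j a b) (stuffleQuotient T) =
      ((a + b).choose a : ℚ) • coeff (exponent₁ (i + j + 1) (a + b)) T := rfl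

theorem coeff_shuffleQuotient (i j a b : ℕ) (T : Series₁) :
    coeff (exponent₂ i j a b) (shuffleQuotient T) =
      ((i + j).choose i : ℚ) • coeff (exponent₁ (i + j) (a + b + 1)) T := rfl

theorem kroneckerP_slash_ε : slash 𝐏 matε = 𝐏 :=
  ext_exponent₂ fun i j a b => by
    rw [coeff_slash_matε, coeff_kroneckerP, coeff_kroneckerP, mul_comm]

theorem kroneckerP_slash_δ : slash 𝐏 matδ = -𝐏 :=
  ext_exponent₂ fun i j a b => by
    rw [coeff_slash_matδ, map_neg, coeff_kroneckerP]
    rcases Nat.even_or_odd (j + b) with h | h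
    · rw [coeff_kronecker₁_of_even h, mul_zero, smul_zero, neg_zero]
    · rw [h.neg_one_pow, neg_one_smul]

theorem kroneckerP_slash_neg_one : slash 𝐏 (-1) = 𝐏 :=
  ext_exponent₂ fun i j a b => by
    rw [coeff_slash_neg_one, coeff_kroneckerP]
    rcases Nat.even_or_odd (j + b) with h | h
    · rw [coeff_kronecker₁_of_even h, mul_zero, smul_zero]
    rcases Nat.even_or_odd (i + a) with h' | h'
    · rw [coeff_kronecker₁_of_even h', zero_mul, smul_zero]
    · rw [show i + j + a + b = i + a + (j + b) by ring, (h'.add_odd h).neg_one_pow, one_smul]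

theorem stuffleQuotient_slash_ε (T : Series₁) :
    slash (stuffleQuotient T) matε = stuffleQuotient T :=
  ext_exponent₂ fun i j a b => by
    rw [coeff_slash_matε, coeff_stuffleQuotient, coeff_stuffleQuotient, add_comm j i,
      add_comm b a, Nat.choose_symm_add]

theorem shuffleQuotient_slash_ε (T : Series₁) :
    slash (shuffleQuotient T) matε = shuffleQuotient T :=
  ext_exponent₂ fun i j a b => by
    rw [coeff_slash_matε, coeff_shuffleQuotient, coeff_shuffleQuotient, add_comm j i,
      add_comm b a, Nat.choose_symm_add]

theorem stuffleQuotient_slash_neg_one : slash R⋆ (-1) = R⋆ :=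
  ext_exponent₂ fun i j a b => by
    rw [coeff_slash_neg_one, coeff_stuffleQuotient]
    rcases Nat.even_or_odd (i + j + a + b) with h | h
    · rw [h.neg_one_pow, one_smul]
    · rw [coeff_kronecker₁_of_even (by rw [show i + j + 1 + (a + b) = i + j + a + b + 1 by ring]
                                       exact h.add_one), smul_zero, smul_zero]

theorem shuffleQuotient_slash_neg_one : slash Rш (-1) = Rш :=
  ext_exponent₂ fun i j a b => by
    rw [coeff_slash_neg_one, coeff_shuffleQuotient]
    rcases Nat.even_or_odd (i + j + a + b) with h | h
    · rw [h.neg_one_pow, one_smul]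
    · rw [coeff_kronecker₁_of_even (by rw [show i + j + (a + b + 1) = i + j + a + b + 1 by ring]
                                       exact h.add_one), smul_zero, smul_zero]

theorem slash_mul_left {R : Series₂} {γ : GL (Fin 2) ℤ} (h : slash R γ = R) (γ' : GL (Fin 2) ℤ) :
    slash R (γ * γ') = slash R γ' := by
  rw [← slash_slash, h]

theorem slash_neg_right {R : Series₂} (h : slash R (-1) = R) (γ : GL (Fin 2) ℤ) :
    slash R (-γ) = slash R γ := by
  rw [← neg_one_mul, slash_mul_left h]

/-- The translate of `kroneckerP_fay` by T⁻¹, reduced by the invariance of 𝔓, R^* and R^ш under ε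
and, where needed, under -1. -/
theorem kroneckerP_slash_T_inv :
    slash 𝐏 matT⁻¹ + slash 𝐏 (matT⁻¹ * matε) = 𝐏 -
      (1 / 2 : ℚ) • (R⋆ + slash R⋆ matU + slash R⋆ (matU * matε)) +
      (1 / 2 : ℚ) • (slash Rш matT⁻¹ + slash Rш matδ + slash Rш (matT⁻¹ * matε)) := by
  have h := congrArg (fun R => slash R matT⁻¹) kroneckerP_fay
  simp only [slash_add, slash_sub, slash_smul, slash_slash] at h
  have e1 : matT * matT⁻¹ = 1 := mul_inv_cancel _
  have e2 : matT * matε * matT⁻¹ = matε * matU := Units.ext (by decide)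
  have e3 : matδ * matT⁻¹ = -(matU * matε) := Units.ext (by decide)
  have e4 : matδ * matT * matT⁻¹ = matδ := mul_inv_cancel_right _ _
  have e5 : matδ * matT * matε * matT⁻¹ = matε * (matT⁻¹ * matε) := Units.ext (by decide)
  have e6 : matδ * (matT⁻¹ * matε) = -matU := Units.ext (by decide)
  -- T⁻¹ε and -U differ by δ on the left, under which 𝔓 changes sign because 𝔅₁ is odd.
  have hP : slash 𝐏 (matT⁻¹ * matε) = -slash 𝐏 matU := by
    rw [← slash_neg_right kroneckerP_slash_neg_one matU, ← e6, ← slash_slash 𝐏 matδ,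
      kroneckerP_slash_δ, slash_neg, neg_neg]
  rw [e1, e2, e3, e4, e5, slash_one, slash_one, slash_mul_left kroneckerP_slash_ε,
    slash_mul_left (stuffleQuotient_slash_ε _), slash_neg_right stuffleQuotient_slash_neg_one,
    slash_mul_left (shuffleQuotient_slash_ε _)] at h
  rw [hP]
  linear_combination (exp := 1) -h

/-- The stuffle relation for `kronecker₂`. -/
theorem kronecker₂_stuffle : 𝐏 = kronecker₂ + slash kronecker₂ matε + R⋆ := by
  have e1 : matU * matε * matε = matU := Units.ext (by decide)
  have e2 : matT⁻¹ * matε * matε = matT⁻¹ := Units.ext (by decide)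
  have e3 : matT⁻¹ * matU = matε * matδ := Units.ext (by decide)
  have e4 : matε * matδ * matε = -matδ := Units.ext (by decide)
  simp only [kronecker₂, slash_add, slash_sub, slash_smul, slash_slash]
  rw [e1, e2, e3, e4, stuffleQuotient_slash_ε, kroneckerP_slash_ε,
    slash_mul_left (shuffleQuotient_slash_ε _), slash_neg_right shuffleQuotient_slash_neg_one]
  -- Eliminating 𝔓|T⁻¹ adds -1/6 to every R^*-term and +1/6 to every R^ш-term. The symmetrized
  -- weights 5, -3, 1 of 𝔅₂ cancel these, except for the full R^*.
  have h := kroneckerP_slash_T_inv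
  rw [← eq_sub_iff_add_eq] at h
  rw [h]
  module

/-- The shuffle relation for `kronecker₂`. -/
theorem kronecker₂_shuffle :
    𝐏 = slash kronecker₂ matT + slash (slash kronecker₂ matT) matε + Rш := by
  have e1 : matT⁻¹ * matT = 1 := inv_mul_cancel _
  have e2 : matU * matT = matε * (matT * matε) := Units.ext (by decide)
  have e3 : matU * matε * matT = -matδ := Units.ext (by decide)
  have e4 : matT⁻¹ * matU * matT = matε * (matδ * matT) := Units.ext (by decide)
  have e5 : matT⁻¹ * matε * matT = matε * (matδ * matT * matε) := Units.ext (by decide)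
  have e6 : matε * (matT * matε) * matε = matε * matT := Units.ext (by decide)
  have e7 : -matδ * matε = matε * matδ := Units.ext (by decide)
  have e8 : matε * (matδ * matT) * matε = matε * (matδ * matT * matε) := Units.ext (by decide)
  have e9 : matε * (matδ * matT * matε) * matε = matε * (matδ * matT) := Units.ext (by decide)
  simp only [kronecker₂, slash_add, slash_sub, slash_smul, slash_slash]
  rw [e1, e2, e3, e4, e5, e6, e7, e8, e9, one_mul]
  simp only [slash_one, slash_mul_left (stuffleQuotient_slash_ε _),
    slash_mul_left (shuffleQuotient_slash_ε _), slash_neg_right stuffleQuotient_slash_neg_one,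
    shuffleQuotient_slash_ε, kroneckerP_slash_ε]
  -- The same bookkeeping with the roles exchanged: after elimination of 𝔓|T only R^ш survives.
  have h := kroneckerP_fay
  rw [← eq_sub_iff_add_eq] at h
  rw [h]
  module

end DoubleShuffle

/-! ### Eisenstein series are quasimodular -/

section Quasimodular

open MvPowerSeries

local notation "R⋆" => stuffleQuotient kronecker₁
local notation "Rш" => shuffleQuotient kronecker₁

theorem coeff_rat_smul {σ : Type*} (n : σ →₀ ℕ) (c : ℚ) (f : MvPowerSeries σ ℚ⟦X⟧) :
    coeff n (c • f) = c • coeff n f := rfl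

theorem eisenstein_of_odd {k : ℕ} (hk : Odd k) : eisenstein k = 0 := if_pos hk

theorem coeff_kronecker₁_zero_right (r : ℕ) :
    coeff (exponent₁ r 0) kronecker₁ = eisenstein (r + 1) := by
  rw [coeff_kronecker₁, add_zero]
  split_ifs with h
  · have := Nat.cast_ne_zero (R := ℚ).mpr (Nat.factorial_ne_zero r)
    rw [Nat.dist_eq_sub_of_le_right r.zero_le, Nat.sub_zero, Nat.min_zero]
    simp [this]
  · rw [eisenstein_of_odd (Nat.not_odd_iff_even.mp h).add_one]

theorem coeff_kronecker₁_one_right (n : ℕ) :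
    coeff (exponent₁ (n + 1) 1) kronecker₁ =
      (1 / ((n : ℚ) + 1)) • qDeriv (eisenstein (n + 1)) := by
  rw [coeff_kronecker₁]
  split_ifs with h
  · have := Nat.cast_ne_zero (R := ℚ).mpr (Nat.factorial_ne_zero n)
    rw [Nat.dist_eq_sub_of_le_right (by omega), Nat.add_sub_cancel, min_eq_right (by omega),
      pow_one, Nat.factorial_succ, Nat.factorial_one]
    congr 1
    push_cast
    field_simp
  · rw [eisenstein_of_odd, map_zero, smul_zero]
    rw [Nat.odd_iff] at *
    omega

theorem coeff_slash_matT_zero (R : Series₂) (i j : ℕ) :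
    coeff (exponent₂ i j 0 0) (slash R matT) =
      ∑ l ∈ Finset.HasAntidiagonal.antidiagonal (i + j),
        (l.1.choose i : ℚ) • coeff (exponent₂ l.1 l.2 0 0) R := by
  rw [coeff_slash_matT]
  simp

theorem coeff_slash_matT_matε_zero (R : Series₂) (i j : ℕ) :
    coeff (exponent₂ i j 0 0) (slash R (matT * matε)) =
      ∑ l ∈ Finset.HasAntidiagonal.antidiagonal (i + j),
        (l.1.choose j : ℚ) • coeff (exponent₂ l.1 l.2 0 0) R := by
  rw [← slash_slash, coeff_slash_matε, coeff_slash_matT_zero, add_comm]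

theorem sum_antidiagonal_choose (n i : ℕ) :
    ∑ l ∈ Finset.HasAntidiagonal.antidiagonal n, (l.1.choose i : ℚ) = (n + 1).choose (i + 1) := by
  rw [Finset.Nat.sum_antidiagonal_eq_sum_range_succ_mk]
  induction n with
  | zero => cases i <;> simp [Nat.choose_eq_zero_of_lt]
  | succ n ih => rw [Finset.sum_range_succ, ih, Nat.choose_succ_succ (n + 1) i]; push_cast; ring

local notation "𝕩₁" => (MvPolynomial.X 0 : MvPolynomial (Fin 4) ℚ)
local notation "𝕪₁" => (MvPolynomial.X 2 : MvPolynomial (Fin 4) ℚ)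
local notation "𝕪₂" => (MvPolynomial.X 3 : MvPolynomial (Fin 4) ℚ)

/-- Read off at Y₂¹ in the product of Y₂ with this series, so the substitution by δT need not be
expanded. -/
theorem coeff_shuffleQuotient_slash_δT (i j : ℕ) :
    coeff (exponent₂ i j 0 0) (slash Rш (matδ * matT)) =
      if j = 0 then coeff (exponent₁ i 1) kronecker₁ else 0 := by
  have h := congrArg (coeff (exponent₂ i j 0 1)) shuffleQuotient_slash_δT
  have hδ : pairSubst 𝕩₁ (𝕪₁ - 𝕪₂) kronecker₁ =
      slash (pairSubst 𝕩₁ (𝕪₁ + 𝕪₂) kronecker₁) matδ := by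
    rw [slash_pairSubst (isHomogeneous_X _) (isHomogeneous_X_add_X _ _), slashPoly_matδ]
    simp [sub_eq_add_neg]
  have he : exponent₂ i j 0 1 - Finsupp.single 3 1 = exponent₂ i j 0 0 := by
    rw [single_eq_exponent₂_three]; ext k; fin_cases k <;> simp [exponent₂]
  rw [polyToSeries_X, coeff_X_mul_exponent, exponent₂_three, if_neg one_ne_zero, he, map_sub, hδ,
    coeff_pairSubst_left, coeff_slash_matδ, coeff_pairSubst_stuffle] at h
  rw [h]
  by_cases hj : j = 0 <;> simp [hj]

/-- The coefficient of X₁^i X₂^j in the Fay identity at Y₁ = Y₂ = 0. The R^*-terms give an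
Eisenstein series, the R^ш-terms its derivative companions. -/
theorem sum_choose_eisenstein_mul_eisenstein (i j : ℕ) :
    ∑ l ∈ Finset.HasAntidiagonal.antidiagonal (i + j),
        (l.1.choose i : ℚ) • (eisenstein (l.1 + 1) * eisenstein (l.2 + 1)) +
      ∑ l ∈ Finset.HasAntidiagonal.antidiagonal (i + j),
        (l.1.choose j : ℚ) • (eisenstein (l.1 + 1) * eisenstein (l.2 + 1)) =
    eisenstein (i + 1) * eisenstein (j + 1) +
      (1 / 2 * ((i + j + 1).choose (i + 1) + (i + j + 1).choose (j + 1) + (-1) ^ j) : ℚ) •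
        eisenstein (i + j + 2) -
      (1 / 2 : ℚ) • (((i + j).choose i : ℚ) • coeff (exponent₁ (i + j) 1) kronecker₁ +
        (if j = 0 then coeff (exponent₁ i 1) kronecker₁ else 0) +
        (if i = 0 then coeff (exponent₁ j 1) kronecker₁ else 0)) := by
  have h := congrArg (coeff (exponent₂ i j 0 0)) kroneckerP_fay
  have hsum : ∀ m : ℕ, ∑ l ∈ Finset.HasAntidiagonal.antidiagonal (i + j),
      (l.1.choose m : ℚ) • coeff (exponent₂ l.1 l.2 0 0) R⋆ =
      ((i + j + 1).choose (m + 1) : ℚ) • eisenstein (i + j + 2) := fun m => by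
    rw [← sum_antidiagonal_choose, Finset.sum_smul]
    refine Finset.sum_congr rfl fun l hl => ?_
    rw [Finset.HasAntidiagonal.mem_antidiagonal] at hl
    rw [coeff_stuffleQuotient, hl, add_zero, coeff_kronecker₁_zero_right]
    simp
  simp only [map_add, map_sub, coeff_rat_smul] at h
  rw [coeff_slash_matT_zero, coeff_slash_matT_matε_zero, coeff_slash_matT_zero,
    coeff_slash_matT_matε_zero, hsum, hsum, coeff_slash_matδ, coeff_stuffleQuotient,
    coeff_shuffleQuotient, coeff_shuffleQuotient_slash_δT, ← slash_slash, coeff_slash_matε,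
    coeff_shuffleQuotient_slash_δT] at h
  simp only [coeff_kroneckerP, coeff_kronecker₁_zero_right, add_zero, zero_add] at h
  rw [h, Nat.choose_self, Nat.cast_one, one_smul]
  module

/-- The case (i, j) = (n + 1, 0), a Ramanujan-type formula. The second sum and the separate product
vanish because G₁ = 0. -/
theorem sum_eisenstein_mul_eisenstein (n : ℕ) :
    ∑ l ∈ Finset.HasAntidiagonal.antidiagonal (n + 1),
        eisenstein (l.1 + 1) * eisenstein (l.2 + 1) =
      (((n : ℚ) + 4) / 2) • eisenstein (n + 3) -
        (1 / ((n : ℚ) + 1)) • qDeriv (eisenstein (n + 1)) := by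
  have h := sum_choose_eisenstein_mul_eisenstein (n + 1) 0
  have h1 : eisenstein 1 = 0 := eisenstein_of_odd odd_one
  have h0 : ∑ l ∈ Finset.HasAntidiagonal.antidiagonal (n + 1),
      (l.1.choose (n + 1) : ℚ) • (eisenstein (l.1 + 1) * eisenstein (l.2 + 1)) = 0 := by
    refine Finset.sum_eq_zero fun l hl => ?_
    rw [Finset.HasAntidiagonal.mem_antidiagonal] at hl
    rcases Nat.eq_zero_or_pos l.2 with h2 | h2
    · rw [h2, zero_add, h1, mul_zero, smul_zero]
    · rw [Nat.choose_eq_zero_of_lt (by omega), Nat.cast_zero, zero_smul]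
  simp only [add_zero, zero_add, h1, h0, Nat.choose_zero_right, Nat.cast_one, one_smul, mul_zero,
    Nat.choose_self, if_true, Nat.succ_ne_zero, if_false, Nat.choose_one_right, pow_zero,
    coeff_kronecker₁_one_right] at h
  rw [h]
  push_cast
  module

/-! ### Closure of quasimodular forms under products and under q d/dq. -/

theorem qDeriv_mul (f g : ℚ⟦X⟧) : qDeriv (f * g) = f * qDeriv g + qDeriv f * g := by
  have h : ∀ f : ℚ⟦X⟧, qDeriv f = PowerSeries.X * PowerSeries.derivative (R := ℚ) f := fun _ => rfl
  rw [h, h, h, Derivation.leibniz, smul_eq_mul, smul_eq_mul]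
  ring

theorem quasimodular_mul {k l : ℕ} {f g : ℚ⟦X⟧} (hf : f ∈ quasimodular k)
    (hg : g ∈ quasimodular l) : f * g ∈ quasimodular (k + l) := by
  induction hf, hg using Submodule.span_induction₂ with
  | mem_mem x y hx hy =>
    obtain ⟨a, b, c, h, rfl⟩ := hx
    obtain ⟨a', b', c', h', rfl⟩ := hy
    exact Submodule.subset_span ⟨a + a', b + b', c + c', by omega, by ring⟩
  | zero_left y hy => rw [zero_mul]; exact Submodule.zero_mem _
  | zero_right x hx => rw [mul_zero]; exact Submodule.zero_mem _
  | add_left x y z _ _ _ h1 h2 => rw [add_mul]; exact Submodule.add_mem _ h1 h2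
  | add_right x y z _ _ _ h1 h2 => rw [mul_add]; exact Submodule.add_mem _ h1 h2
  | smul_left r x y _ _ h => rw [smul_mul_assoc]; exact Submodule.smul_mem _ _ h
  | smul_right r x y _ _ h => rw [mul_smul_comm]; exact Submodule.smul_mem _ _ h

/-- The Fay coefficients at (m + 2, 2) and (m + 3, 0) involve the same derivative. Eliminating it
leaves G_{m+6} with the factor -m(m+5)(m+7)/24, which vanishes at m = 0: weight 6 gives no relation
of this kind, so G₆ must be a generator. -/
theorem eisenstein_mem_of_mul_sum {W : Submodule ℚ ℚ⟦X⟧} {m : ℕ} (hm : 2 ≤ m)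
    (hW : ∀ l ∈ Finset.HasAntidiagonal.antidiagonal (m + 4),
      eisenstein (l.1 + 1) * eisenstein (l.2 + 1) ∈ W) : eisenstein (m + 6) ∈ W := by
  have hA := sum_choose_eisenstein_mul_eisenstein (m + 2) 2
  have hB := sum_eisenstein_mul_eisenstein (m + 3)
  have e0 : m + 2 + 2 = m + 4 := by ring
  have e1 : m + 3 + 1 = m + 4 := by ring
  have c1 : ((m + 2 + 2 + 1).choose (m + 2 + 1) : ℚ) = (m + 5) * (m + 4) / 2 := by
    rw [← Nat.choose_symm_of_eq_add (show m + 2 + 2 + 1 = 2 + (m + 2 + 1) by ring),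
      Nat.cast_choose_two]
    push_cast
    ring
  have c2 : ((m + 2 + 2).choose (m + 2) : ℚ) = (m + 4) * (m + 3) / 2 := by
    rw [Nat.choose_symm_add, Nat.cast_choose_two]
    push_cast
    ring
  have c3 : ((m + 2 + 2 + 1).choose (2 + 1) : ℚ) = (m + 5) * (m + 4) * (m + 3) / 6 := by
    have h := congrArg (Nat.cast (R := ℚ)) (Nat.add_one_mul_choose_eq (m + 2 + 2) 2)
    push_cast at h ⊢
    rw [Nat.cast_choose_two] at h
    push_cast at h
    linarith
  rw [c1, c2, c3, if_neg two_ne_zero, if_neg (by omega), add_zero, add_zero,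
    show m + 2 + 2 = m + 3 + 1 by ring, coeff_kronecker₁_one_right] at hA
  set S₁ := ∑ l ∈ Finset.HasAntidiagonal.antidiagonal (m + 3 + 1),
    (l.1.choose (m + 2) : ℚ) • (eisenstein (l.1 + 1) * eisenstein (l.2 + 1)) with hS₁
  set S₂ := ∑ l ∈ Finset.HasAntidiagonal.antidiagonal (m + 3 + 1),
    (l.1.choose 2 : ℚ) • (eisenstein (l.1 + 1) * eisenstein (l.2 + 1)) with hS₂
  set S₀ := ∑ l ∈ Finset.HasAntidiagonal.antidiagonal (m + 3 + 1),
    eisenstein (l.1 + 1) * eisenstein (l.2 + 1) with hS₀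
  -- The coefficient (m+4)(m+3)/4 is the one that cancels the derivative of G_{m+4}.
  have hmem : S₁ + S₂ - (((m : ℚ) + 4) * (m + 3) / 4) • S₀ -
      eisenstein (m + 2 + 1) * eisenstein (2 + 1) ∈ W := by
    refine Submodule.sub_mem _ (Submodule.sub_mem _ (Submodule.add_mem _ ?_ ?_)
      (Submodule.smul_mem _ _ ?_)) ?_
    · exact Submodule.sum_mem _ fun l hl => Submodule.smul_mem _ _ (hW l hl)
    · exact Submodule.sum_mem _ fun l hl => Submodule.smul_mem _ _ (hW l hl)
    · exact Submodule.sum_mem _ fun l hl => hW l hl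
    · exact hW (m + 2, 2) (by simp)
  have hm0 : (m : ℚ) ≠ 0 := Nat.cast_ne_zero.mpr (by omega)
  have h5 : (m : ℚ) + 5 ≠ 0 := by positivity
  have h7 : (m : ℚ) + 7 ≠ 0 := by positivity
  have hkey : eisenstein (m + 6) = (-24 / (((m : ℚ) + 5) * m * (m + 7))) •
      (S₁ + S₂ - (((m : ℚ) + 4) * (m + 3) / 4) • S₀ -
      eisenstein (m + 2 + 1) * eisenstein (2 + 1)) := by
    rw [hA, hB, show m + 3 + 1 + 2 = m + 6 by ring, show m + 3 + 3 = m + 6 by ring]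
    push_cast
    match_scalars <;> field_simp <;> ring
  rw [hkey]
  exact Submodule.smul_mem _ _ hmem

theorem eisenstein_mem_quasimodular {k : ℕ} (hk : 1 ≤ k) : eisenstein k ∈ quasimodular k := by
  induction k using Nat.strong_induction_on with
  | _ k ih =>
    rcases Nat.even_or_odd k with he | ho
    · by_cases h2 : k = 2
      · subst h2; exact Submodule.subset_span ⟨1, 0, 0, by simp⟩
      by_cases h4 : k = 4
      · subst h4; exact Submodule.subset_span ⟨0, 1, 0, by simp⟩
      by_cases h6 : k = 6
      · subst h6; exact Submodule.subset_span ⟨0, 0, 1, by simp⟩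
      rw [Nat.even_iff] at he
      obtain ⟨m, rfl⟩ : ∃ m, k = m + 6 := ⟨k - 6, by omega⟩
      -- Here k is even and different from 2, 4, 6, so m ≥ 2; both factors of each product have
      -- weight less than k.
      refine eisenstein_mem_of_mul_sum (by omega) fun l hl => ?_
      rw [Finset.HasAntidiagonal.mem_antidiagonal] at hl
      have := quasimodular_mul (ih (l.1 + 1) (by omega) (by omega))
        (ih (l.2 + 1) (by omega) (by omega))
      rwa [show l.1 + 1 + (l.2 + 1) = m + 6 by omega] at this
    · rw [eisenstein_of_odd ho]
      exact Submodule.zero_mem _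

theorem qDeriv_eisenstein_mem {k : ℕ} (hk : 1 ≤ k) :
    qDeriv (eisenstein k) ∈ quasimodular (k + 2) := by
  obtain ⟨n, rfl⟩ : ∃ n, k = n + 1 := ⟨k - 1, by omega⟩
  have hn : (n : ℚ) + 1 ≠ 0 := by positivity
  have h : qDeriv (eisenstein (n + 1)) = ((n : ℚ) + 1) •
      ((((n : ℚ) + 4) / 2) • eisenstein (n + 3) -
      ∑ l ∈ Finset.HasAntidiagonal.antidiagonal (n + 1),
        eisenstein (l.1 + 1) * eisenstein (l.2 + 1)) := by
    rw [sum_eisenstein_mul_eisenstein, sub_sub_cancel, smul_smul, mul_one_div_cancel hn, one_smul]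
  rw [h]
  refine Submodule.smul_mem _ _ (Submodule.sub_mem _
    (Submodule.smul_mem _ _ (eisenstein_mem_quasimodular (by omega)))
    (Submodule.sum_mem _ fun l hl => ?_))
  rw [Finset.HasAntidiagonal.mem_antidiagonal] at hl
  have := quasimodular_mul (eisenstein_mem_quasimodular (show 1 ≤ l.1 + 1 by omega))
    (eisenstein_mem_quasimodular (show 1 ≤ l.2 + 1 by omega))
  rwa [show l.1 + 1 + (l.2 + 1) = n + 1 + 2 by omega] at this

theorem qDeriv_mul_mem {k l : ℕ} {f g : ℚ⟦X⟧}
    (hf : f ∈ quasimodular k ∧ qDeriv f ∈ quasimodular (k + 2))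
    (hg : g ∈ quasimodular l ∧ qDeriv g ∈ quasimodular (l + 2)) :
    f * g ∈ quasimodular (k + l) ∧ qDeriv (f * g) ∈ quasimodular (k + l + 2) := by
  refine ⟨quasimodular_mul hf.1 hg.1, ?_⟩
  rw [qDeriv_mul]
  have h := quasimodular_mul hf.1 hg.2
  rw [← add_assoc] at h
  refine Submodule.add_mem _ h ?_
  rw [add_right_comm]
  exact quasimodular_mul hf.2 hg.1

theorem qDeriv_pow_mem {k : ℕ} {f : ℚ⟦X⟧}
    (hf : f ∈ quasimodular k ∧ qDeriv f ∈ quasimodular (k + 2)) (n : ℕ) :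
    f ^ n ∈ quasimodular (n * k) ∧ qDeriv (f ^ n) ∈ quasimodular (n * k + 2) := by
  induction n with
  | zero =>
    have h1 : (1 : ℚ⟦X⟧) ∈ quasimodular 0 := Submodule.subset_span ⟨0, 0, 0, by simp⟩
    have h2 : qDeriv (1 : ℚ⟦X⟧) = 0 := by
      have := qDeriv_mul 1 1
      simpa using this
    rw [zero_mul, pow_zero, h2]
    exact ⟨h1, Submodule.zero_mem _⟩
  | succ n ih =>
    rw [pow_succ, Nat.succ_mul]
    exact qDeriv_mul_mem ih hf

theorem qDeriv_mem_quasimodular {k : ℕ} {f : ℚ⟦X⟧} (hf : f ∈ quasimodular k) :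
    qDeriv f ∈ quasimodular (k + 2) := by
  have hE : ∀ {k : ℕ}, 1 ≤ k →
      eisenstein k ∈ quasimodular k ∧ qDeriv (eisenstein k) ∈ quasimodular (k + 2) :=
    fun hk => ⟨eisenstein_mem_quasimodular hk, qDeriv_eisenstein_mem hk⟩
  induction hf using Submodule.span_induction with
  | mem x hx =>
    obtain ⟨a, b, c, rfl, rfl⟩ := hx
    have := (qDeriv_mul_mem (qDeriv_mul_mem (qDeriv_pow_mem (hE (k := 2) (by omega)) a)
      (qDeriv_pow_mem (hE (k := 4) (by omega)) b)) (qDeriv_pow_mem (hE (k := 6) (by omega)) c)).2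
    rwa [mul_comm a, mul_comm b, mul_comm c] at this
  | zero => rw [map_zero]; exact Submodule.zero_mem _
  | add x y _ _ hx hy => rw [map_add]; exact Submodule.add_mem _ hx hy
  | smul r x _ hx => rw [map_smul]; exact Submodule.smul_mem _ _ hx

theorem qDeriv_pow_mem_quasimodular {k : ℕ} {f : ℚ⟦X⟧} (hf : f ∈ quasimodular k) (m : ℕ) :
    (qDeriv ^ m) f ∈ quasimodular (k + 2 * m) := by
  induction m with
  | zero => simpa using hf
  | succ m ih =>
    rw [pow_succ', Module.End.mul_apply]
    exact qDeriv_mem_quasimodular ih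

theorem coeff_kronecker₁_mem (r s : ℕ) :
    coeff (exponent₁ r s) kronecker₁ ∈ quasimodular (r + s + 1) := by
  rw [coeff_kronecker₁]
  split_ifs
  · refine Submodule.smul_mem _ _ ?_
    have := qDeriv_pow_mem_quasimodular
      (eisenstein_mem_quasimodular (show 1 ≤ Nat.dist r s + 1 by omega)) (min r s)
    rwa [show Nat.dist r s + 1 + 2 * min r s = r + s + 1 by rw [Nat.dist]; omega] at this
  · exact Submodule.zero_mem _

theorem coeff_kroneckerP_mem (d : Fin 4 →₀ ℕ) :
    coeff d kroneckerP ∈ quasimodular (d.degree + 2) := by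
  rw [← exponent₂_eq d, coeff_kroneckerP, degree_exponent₂]
  have := quasimodular_mul (coeff_kronecker₁_mem (d 0) (d 2)) (coeff_kronecker₁_mem (d 1) (d 3))
  rwa [show d 0 + d 2 + 1 + (d 1 + d 3 + 1) = d 0 + d 1 + d 2 + d 3 + 2 by ring] at this

theorem coeff_stuffleQuotient_mem (d : Fin 4 →₀ ℕ) :
    coeff d R⋆ ∈ quasimodular (d.degree + 2) := by
  rw [← exponent₂_eq d, coeff_stuffleQuotient, degree_exponent₂]
  have := coeff_kronecker₁_mem (d 0 + d 1 + 1) (d 2 + d 3)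
  rw [show d 0 + d 1 + 1 + (d 2 + d 3) + 1 = d 0 + d 1 + d 2 + d 3 + 2 by ring] at this
  exact Submodule.smul_mem _ _ this

theorem coeff_shuffleQuotient_mem (d : Fin 4 →₀ ℕ) :
    coeff d Rш ∈ quasimodular (d.degree + 2) := by
  rw [← exponent₂_eq d, coeff_shuffleQuotient, degree_exponent₂]
  have := coeff_kronecker₁_mem (d 0 + d 1) (d 2 + d 3 + 1)
  rw [show d 0 + d 1 + (d 2 + d 3 + 1) + 1 = d 0 + d 1 + d 2 + d 3 + 2 by ring] at this
  exact Submodule.smul_mem _ _ this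

theorem coeff_kronecker₂_mem (d : Fin 4 →₀ ℕ) :
    coeff d kronecker₂ ∈ quasimodular (d.degree + 2) := by
  have hP := fun γ => coeff_slash_mem (W := fun n => quasimodular (n + 2)) coeff_kroneckerP_mem γ d
  have hR := fun γ =>
    coeff_slash_mem (W := fun n => quasimodular (n + 2)) coeff_stuffleQuotient_mem γ d
  have hS := fun γ =>
    coeff_slash_mem (W := fun n => quasimodular (n + 2)) coeff_shuffleQuotient_mem γ d
  simp only [kronecker₂, map_add, map_sub, coeff_rat_smul]
  refine Submodule.sub_mem _ (Submodule.sub_mem _ (Submodule.smul_mem _ _ (Submodule.add_mem _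
    (coeff_kroneckerP_mem d) (hP _))) (Submodule.smul_mem _ _ (Submodule.add_mem _
    (Submodule.sub_mem _ (Submodule.smul_mem _ _ (coeff_stuffleQuotient_mem d))
      (Submodule.smul_mem _ _ (hR _))) (hR _)))) (Submodule.smul_mem _ _ (Submodule.add_mem _
    (Submodule.sub_mem _ (Submodule.smul_mem _ _ (hS _)) (Submodule.smul_mem _ _ (hS _))) (hS _)))

end Quasimodular

/-! ### The heat equation -/

section HeatEquation

open MvPowerSeries

/-- The heat equation for 𝔅₁: raising r and s together keeps |r - s| and raises the minimum by one.
-/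
theorem coeff_kronecker₁_succ_succ (r s : ℕ) :
    (((r : ℚ) + 1) * ((s : ℚ) + 1)) • coeff (exponent₁ (r + 1) (s + 1)) kronecker₁ =
      qDeriv (coeff (exponent₁ r s) kronecker₁) := by
  have h : Odd (r + 1 + (s + 1)) ↔ Odd (r + s) := by
    rw [Nat.odd_iff, Nat.odd_iff]; omega
  rw [coeff_kronecker₁, coeff_kronecker₁]
  by_cases hrs : Odd (r + s)
  · have hr := Nat.cast_ne_zero (R := ℚ).mpr (Nat.factorial_ne_zero r)
    have hs := Nat.cast_ne_zero (R := ℚ).mpr (Nat.factorial_ne_zero s)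
    rw [if_pos (h.mpr hrs), if_pos hrs, map_smul, Nat.dist_succ_succ, Nat.succ_min_succ, pow_succ',
      Module.End.mul_apply, smul_smul, Nat.factorial_succ, Nat.factorial_succ]
    congr 1
    push_cast
    field_simp
  · rw [if_neg (mt h.mp hrs), if_neg hrs, smul_zero, map_zero]

/-- The power series `R` for which the heat operator acts as `q d/dq` on the coefficients. -/
def heatSolutions : Submodule ℚ Series₂ where
  carrier := {R | ∀ N, qCoeff N (heat R) = (N : ℚ) • qCoeff N R}
  add_mem' {R S} hR hS N := by
    have h : heat (R + S) = heat R + heat S := by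
      simp only [heat, map_add]; abel
    rw [h, map_add, hR, hS, map_add, smul_add]
  zero_mem' N := by
    have h : heat 0 = 0 := by simp only [heat, map_zero, add_zero]
    rw [h, map_zero, smul_zero]
  smul_mem' c R hR N := by
    have h : heat (c • R) = c • heat R := by
      have hc : ∀ (i : Fin 4) (S : Series₂), pderiv ℚ⟦X⟧ i (c • S) = c • pderiv ℚ⟦X⟧ i S :=
        fun i S => (pderiv ℚ⟦X⟧ i).map_smul_of_tower c S
      simp only [heat, hc, smul_add]
    rw [h, map_smul, hR, map_smul, smul_comm]

theorem mem_heatSolutions_iff {R : Series₂} : R ∈ heatSolutions ↔ ∀ i j a b,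
    coeff (exponent₂ i j a b) (heat R) = qDeriv (coeff (exponent₂ i j a b) R) := by
  constructor
  · intro h i j a b
    ext N
    rw [← coeff_qCoeff, h, coeff_qDeriv]
    rfl
  · intro h N
    refine ext_exponent₂ fun i j a b => ?_
    rw [coeff_qCoeff, h, coeff_qDeriv]
    rfl

/-- On the coefficient of q^N the operator q d/dq is multiplication by N, which commutes with a
rational substitution. -/
theorem slash_mem_heatSolutions {R : Series₂} (hR : R ∈ heatSolutions) (γ : GL (Fin 2) ℤ) :
    slash R γ ∈ heatSolutions := by
  intro N
  have hs : HasSubst fun s => (slashPoly γ s : MvPowerSeries (Fin 4) ℚ) :=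
    hasSubst_of_constantCoeff_zero fun s =>
      constantCoeff_coe_of_isHomogeneous (isHomogeneous_slashPoly γ s)
  rw [heat_slash, slash_eq_ratSubst, slash_eq_ratSubst,
    qCoeff_ratSubst N (isHomogeneous_slashPoly γ), qCoeff_ratSubst N (isHomogeneous_slashPoly γ),
    hR, subst_smul hs]

theorem kroneckerP_mem_heatSolutions : kroneckerP ∈ heatSolutions := by
  refine mem_heatSolutions_iff.mpr fun i j a b => ?_
  rw [coeff_heat, coeff_kroneckerP, coeff_kroneckerP, coeff_kroneckerP, qDeriv_mul,
    ← coeff_kronecker₁_succ_succ, ← coeff_kronecker₁_succ_succ, smul_mul_assoc, mul_smul_comm,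
    add_comm]

theorem succ_mul_choose_add (m n : ℕ) :
    ((m : ℚ) + 1) * ((m + 1 + n).choose (m + 1) : ℚ) = ((m : ℚ) + n + 1) * (m + n).choose m ∧
    ((n : ℚ) + 1) * ((m + (n + 1)).choose m : ℚ) = ((m : ℚ) + n + 1) * (m + n).choose m := by
  constructor
  · have := congrArg (Nat.cast (R := ℚ)) (Nat.add_one_mul_choose_eq (m + n) m)
    push_cast at this
    rw [show m + 1 + n = m + n + 1 by ring]
    linarith
  · have := congrArg (Nat.cast (R := ℚ)) (Nat.add_one_mul_choose_eq (m + n) n)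
    rw [Nat.choose_symm_add, ← Nat.choose_symm_of_eq_add (show m + n = n + m by ring)]
    push_cast at this
    rw [← Nat.add_assoc]
    linarith

/-- Both terms of the heat operator acquire the same binomial, and their weights i + 1 and j + 1 add
up to the factor for the exponent i + j + 1 of X in 𝔅₁. For R^ш the Y-degrees play this part. -/
theorem stuffleQuotient_mem_heatSolutions : stuffleQuotient kronecker₁ ∈ heatSolutions := by
  refine mem_heatSolutions_iff.mpr fun i j a b => ?_
  obtain ⟨h1, h2⟩ := succ_mul_choose_add a b
  rw [coeff_heat, coeff_stuffleQuotient, coeff_stuffleQuotient, coeff_stuffleQuotient, map_smul,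
    ← coeff_kronecker₁_succ_succ, show i + 1 + j + 1 = i + j + 1 + 1 by ring,
    show i + (j + 1) + 1 = i + j + 1 + 1 by ring, show a + 1 + b = a + b + 1 by ring,
    show a + (b + 1) = a + b + 1 by ring, smul_smul, smul_smul, smul_smul, ← add_smul]
  rw [show a + 1 + b = a + b + 1 by ring] at h1
  congr 1
  push_cast
  linear_combination ((i : ℚ) + 1) * h1 + ((j : ℚ) + 1) * h2

theorem shuffleQuotient_mem_heatSolutions : shuffleQuotient kronecker₁ ∈ heatSolutions := by
  refine mem_heatSolutions_iff.mpr fun i j a b => ?_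
  obtain ⟨h1, h2⟩ := succ_mul_choose_add i j
  rw [coeff_heat, coeff_shuffleQuotient, coeff_shuffleQuotient, coeff_shuffleQuotient, map_smul,
    ← coeff_kronecker₁_succ_succ, show i + 1 + j = i + j + 1 by ring,
    show i + (j + 1) = i + j + 1 by ring, show a + 1 + b + 1 = a + b + 1 + 1 by ring,
    show a + (b + 1) + 1 = a + b + 1 + 1 by ring, smul_smul, smul_smul, smul_smul, ← add_smul]
  rw [show i + 1 + j = i + j + 1 by ring] at h1
  congr 1
  push_cast
  linear_combination ((a : ℚ) + 1) * h1 + ((b : ℚ) + 1) * h2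

theorem kronecker₂_mem_heatSolutions : kronecker₂ ∈ heatSolutions := by
  have hP := fun γ => slash_mem_heatSolutions kroneckerP_mem_heatSolutions γ
  have hR := fun γ => slash_mem_heatSolutions stuffleQuotient_mem_heatSolutions γ
  have hS := fun γ => slash_mem_heatSolutions shuffleQuotient_mem_heatSolutions γ
  exact Submodule.sub_mem _ (Submodule.sub_mem _ (Submodule.smul_mem _ _ (Submodule.add_mem _
    kroneckerP_mem_heatSolutions (hP _))) (Submodule.smul_mem _ _ (Submodule.add_mem _
    (Submodule.sub_mem _ (Submodule.smul_mem _ _ stuffleQuotient_mem_heatSolutions)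
      (Submodule.smul_mem _ _ (hR _))) (hR _)))) (Submodule.smul_mem _ _ (Submodule.add_mem _
    (Submodule.sub_mem _ (Submodule.smul_mem _ _ (hS _)) (Submodule.smul_mem _ _ (hS _))) (hS _)))

end HeatEquation

/-! ### The Kronecker realization -/

section Realization

open MvPowerSeries

/-- The value of the Kronecker realization on a symbol. -/
def kroneckerValue : Sym → ℚ⟦X⟧
  | .G₁ k d => (d.factorial : ℚ) • coeff (exponent₁ (k - 1) d) kronecker₁
  | .G₂ k₁ k₂ d₁ d₂ => ((d₁.factorial : ℚ) * (d₂.factorial : ℚ)) •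
      coeff (exponent₂ (k₁ - 1) (k₂ - 1) d₁ d₂) kronecker₂
  | .P k₁ k₂ d₁ d₂ => ((d₁.factorial : ℚ) * (d₂.factorial : ℚ)) •
      coeff (exponent₂ (k₁ - 1) (k₂ - 1) d₁ d₂) kroneckerP

theorem kroneckerValue_mem {K : ℕ} {s : Sym} (hs : s.IsGenerator K) :
    kroneckerValue s ∈ quasimodular K := by
  cases s with
  | G₁ k d =>
    obtain ⟨hk, rfl⟩ := hs
    have := coeff_kronecker₁_mem (k - 1) d
    rw [show k - 1 + d + 1 = k + d by omega] at this
    exact Submodule.smul_mem _ _ this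
  | G₂ k₁ k₂ d₁ d₂ =>
    obtain ⟨h₁, h₂, rfl⟩ := hs
    have := coeff_kronecker₂_mem (exponent₂ (k₁ - 1) (k₂ - 1) d₁ d₂)
    rw [degree_exponent₂, show k₁ - 1 + (k₂ - 1) + d₁ + d₂ + 2 = k₁ + k₂ + d₁ + d₂ by omega] at this
    exact Submodule.smul_mem _ _ this
  | P k₁ k₂ d₁ d₂ =>
    obtain ⟨h₁, h₂, rfl⟩ := hs
    have := coeff_kroneckerP_mem (exponent₂ (k₁ - 1) (k₂ - 1) d₁ d₂)
    rw [degree_exponent₂, show k₁ - 1 + (k₂ - 1) + d₁ + d₂ + 2 = k₁ + k₂ + d₁ + d₂ by omega] at this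
    exact Submodule.smul_mem _ _ this

theorem kroneckerValue_stuffle (i j d₁ d₂ : ℕ) :
    kroneckerValue (.P (i + 1) (j + 1) d₁ d₂) = kroneckerValue (.G₂ (i + 1) (j + 1) d₁ d₂) +
      kroneckerValue (.G₂ (j + 1) (i + 1) d₂ d₁) + kroneckerValue (.G₁ (i + j + 2) (d₁ + d₂)) := by
  have h := congrArg (coeff (exponent₂ i j d₁ d₂)) kronecker₂_stuffle
  rw [map_add, map_add, coeff_slash_matε, coeff_stuffleQuotient] at h
  have hd : ((d₁ + d₂).factorial : ℚ) =
      (d₁.factorial : ℚ) * (d₂.factorial : ℚ) * (d₁ + d₂).choose d₁ := by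
    have := Nat.add_choose_mul_factorial_mul_factorial d₁ d₂
    rw [← this, Nat.choose_symm_add]
    push_cast
    ring
  simp only [kroneckerValue, Nat.add_sub_cancel]
  rw [h, hd, show i + j + 2 - 1 = i + j + 1 by omega]
  module

/-- The normalization Y^d/d! turns the binomial of the T-action into that of the shuffle relation:
with c = e₂ - d₂ = d₁ - e₁ both sides are ± d₁! e₂!/c!. -/
theorem factorial_mul_choose (d₁ d₂ e₁ e₂ : ℕ) (h : e₁ + e₂ = d₁ + d₂) :
    (d₁.factorial : ℚ) * (d₂.factorial : ℚ) * ((e₂.choose d₂ : ℚ) * (-1) ^ (e₂ - d₂)) =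
      (d₁.choose e₁ : ℚ) * (-1) ^ (d₁ - e₁) * ((e₁.factorial : ℚ) * (e₂.factorial : ℚ)) := by
  rcases le_or_gt d₂ e₂ with hle | hlt
  · obtain ⟨c, rfl⟩ := Nat.exists_eq_add_of_le hle
    obtain rfl : d₁ = e₁ + c := by omega
    have h1 := congrArg (Nat.cast (R := ℚ)) (Nat.add_choose_mul_factorial_mul_factorial d₂ c)
    have h2 := congrArg (Nat.cast (R := ℚ)) (Nat.add_choose_mul_factorial_mul_factorial e₁ c)
    push_cast at h1 h2
    rw [Nat.add_sub_cancel_left, Nat.add_sub_cancel_left, ← h1, ← h2, Nat.choose_symm_add,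
      Nat.choose_symm_add (a := e₁)]
    ring
  · rw [Nat.choose_eq_zero_of_lt hlt, Nat.choose_eq_zero_of_lt (show d₁ < e₁ by omega)]
    simp

theorem factorial_smul_coeff_kronecker₂_slash_matT (i j d₁ d₂ : ℕ) :
    ((d₁.factorial : ℚ) * (d₂.factorial : ℚ)) •
        coeff (exponent₂ i j d₁ d₂) (slash kronecker₂ matT) =
      ∑ p ∈ Finset.HasAntidiagonal.antidiagonal (i + j),
        ∑ e ∈ Finset.HasAntidiagonal.antidiagonal (d₁ + d₂), shuffleCoeff i d₁ p.1 e.1 •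
          kroneckerValue (.G₂ (p.1 + 1) (p.2 + 1) e.1 e.2) := by
  rw [coeff_slash_matT]
  simp only [Finset.smul_sum]
  refine Finset.sum_congr rfl fun p _ => Finset.sum_congr rfl fun e he => ?_
  rw [Finset.HasAntidiagonal.mem_antidiagonal] at he
  simp only [kroneckerValue, Nat.add_sub_cancel]
  rw [smul_smul, smul_smul, shuffleCoeff]
  congr 1
  linear_combination (p.1.choose i : ℚ) * factorial_mul_choose d₁ d₂ e.1 e.2 he

theorem kroneckerValue_shuffle (i j d₁ d₂ : ℕ) :
    kroneckerValue (.P (i + 1) (j + 1) d₁ d₂) = shuffleValue kroneckerValue i j d₁ d₂ := by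
  have h := congrArg (coeff (exponent₂ i j d₁ d₂)) kronecker₂_shuffle
  rw [map_add, map_add, coeff_slash_matε, coeff_shuffleQuotient] at h
  have h1 := factorial_smul_coeff_kronecker₂_slash_matT i j d₁ d₂
  have h2 := factorial_smul_coeff_kronecker₂_slash_matT j i d₂ d₁
  rw [add_comm j i, add_comm d₂ d₁, mul_comm (d₂.factorial : ℚ)] at h2
  have hd := Nat.cast_ne_zero (R := ℚ).mpr (Nat.factorial_ne_zero (d₁ + d₂ + 1))
  rw [shuffleValue]
  simp only [add_smul, Finset.sum_add_distrib]
  rw [← h1, ← h2]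
  simp only [kroneckerValue, Nat.add_sub_cancel]
  rw [h, smul_add, smul_add, smul_smul, smul_smul]
  congr 2
  field_simp

theorem exists_isKroneckerRealization (K : ℕ) : ∃ ρ, IsKroneckerRealization K ρ := by
  classical
  set φ : Sym → quasimodular K := fun s =>
    if h : s.IsGenerator K then ⟨kroneckerValue s, kroneckerValue_mem h⟩ else 0 with hφ
  have hval : ∀ s : Sym, s.IsGenerator K → (φ s : ℚ⟦X⟧) = kroneckerValue s := fun s hs => by
    rw [hφ]
    simp only [dif_pos hs]
  obtain ⟨ρ, hρ⟩ := exists_linearMap_of_relations K φ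
    (fun i j d₁ d₂ h => by
      refine Subtype.ext ?_
      rw [Submodule.coe_add, Submodule.coe_add,
        hval (.P _ _ _ _) ⟨by omega, by omega, h⟩, hval (.G₂ _ _ _ _) ⟨by omega, by omega, h⟩,
        hval (.G₂ _ _ _ _) ⟨by omega, by omega, by omega⟩, hval (.G₁ _ _) ⟨by omega, by omega⟩,
        kroneckerValue_stuffle])
    (fun i j d₁ d₂ h => by
      refine Subtype.ext ?_
      rw [hval (.P _ _ _ _) ⟨by omega, by omega, h⟩, kroneckerValue_shuffle]
      exact ((map_shuffleValue (quasimodular K).subtype φ i j d₁ d₂).trans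
        (shuffleValue_congr h hval)).symm)
  refine ⟨ρ, fun k d hk h => ?_, fun k₁ k₂ d₁ d₂ h₁ h₂ h => ?_, fun k₁ k₂ d₁ d₂ h₁ h₂ h => ?_⟩
  · have hs : (Sym.G₁ k d).IsGenerator K := ⟨hk, h⟩
    rw [hρ _ hs, hval _ hs, kroneckerValue]
  · have hs : (Sym.G₂ k₁ k₂ d₁ d₂).IsGenerator K := ⟨h₁, h₂, h⟩
    rw [hρ _ hs, hval _ hs, kroneckerValue]
  · have hs : (Sym.P k₁ k₂ d₁ d₂).IsGenerator K := ⟨h₁, h₂, h⟩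
    rw [hρ _ hs, hval _ hs, kroneckerValue]

theorem isKroneckerRealization_unique {K : ℕ} {ρ ρ' : Space K →ₗ[ℚ] quasimodular K}
    (h : IsKroneckerRealization K ρ) (h' : IsKroneckerRealization K ρ') : ρ = ρ' :=
  linearMap_ext_gen (fun k d hk hK => Subtype.ext ((h.1 k d hk hK).trans (h'.1 k d hk hK).symm))
    fun k₁ k₂ d₁ d₂ h₁ h₂ hK => Subtype.ext
      ((h.2.1 k₁ k₂ d₁ d₂ h₁ h₂ hK).trans (h'.2.1 k₁ k₂ d₁ d₂ h₁ h₂ hK).symm)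

theorem exists_isQDeriv (K : ℕ) : ∃ θ, IsQDeriv K θ :=
  ⟨qDeriv.restrict fun _ => qDeriv_mem_quasimodular, fun _ => rfl⟩

theorem isQDeriv_unique {K : ℕ} {θ θ' : quasimodular K →ₗ[ℚ] quasimodular (K + 2)}
    (h : IsQDeriv K θ) (h' : IsQDeriv K θ') : θ = θ' :=
  LinearMap.ext fun f => Subtype.ext ((h f).trans (h' f).symm)

/-- Only the G's need to be compared. There ∂ is the heat operator on coefficients, the factor d + 1
being absorbed by (d+1)!, so the heat equations of 𝔅₁ and 𝔅₂ give the claim. -/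
theorem realization_comp_derivation {K : ℕ} {D : Space K →ₗ[ℚ] Space (K + 2)}
    {ρ : Space K →ₗ[ℚ] quasimodular K} {ρ' : Space (K + 2) →ₗ[ℚ] quasimodular (K + 2)}
    {θ : quasimodular K →ₗ[ℚ] quasimodular (K + 2)} (hD : IsDerivation K D)
    (hρ : IsKroneckerRealization K ρ) (hρ' : IsKroneckerRealization (K + 2) ρ')
    (hθ : IsQDeriv K θ) : ρ' ∘ₗ D = θ ∘ₗ ρ := by
  refine linearMap_ext_gen (fun k d hk h => Subtype.ext ?_)
    fun k₁ k₂ d₁ d₂ h₁ h₂ h => Subtype.ext ?_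
  · obtain ⟨r, rfl⟩ : ∃ r, k = r + 1 := ⟨k - 1, by omega⟩
    rw [LinearMap.comp_apply, LinearMap.comp_apply, hθ, hρ.1 _ _ hk h, hD.1 _ _ hk h, map_smul,
      Submodule.coe_smul, hρ'.1 _ _ (by omega) (by omega), map_smul, Nat.add_sub_cancel,
      Nat.add_sub_cancel, ← coeff_kronecker₁_succ_succ, Nat.factorial_succ]
    push_cast
    module
  · obtain ⟨i, rfl⟩ : ∃ i, k₁ = i + 1 := ⟨k₁ - 1, by omega⟩
    obtain ⟨j, rfl⟩ : ∃ j, k₂ = j + 1 := ⟨k₂ - 1, by omega⟩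
    rw [LinearMap.comp_apply, LinearMap.comp_apply, hθ, hρ.2.1 _ _ _ _ h₁ h₂ h,
      hD.2 _ _ _ _ h₁ h₂ h, map_add, map_smul, map_smul, Submodule.coe_add, Submodule.coe_smul,
      Submodule.coe_smul, hρ'.2.1 _ _ _ _ (by omega) (by omega) (by omega),
      hρ'.2.1 _ _ _ _ (by omega) (by omega) (by omega), map_smul]
    simp only [Nat.add_sub_cancel]
    rw [← mem_heatSolutions_iff.mp kronecker₂_mem_heatSolutions, coeff_heat, Nat.factorial_succ,
      Nat.factorial_succ]
    push_cast
    module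

end Realization

end DoubleEisenstein

end

/-! ### Existence, uniqueness and the commuting square. -/

theorem proposition3p8 (k : ℕ) (hk : 1 ≤ k) :
    (∃! D : DoubleEisenstein.Space k →ₗ[ℚ] DoubleEisenstein.Space (k + 2),
      DoubleEisenstein.IsDerivation k D) ∧
    (∃! ρ : DoubleEisenstein.Space k →ₗ[ℚ] DoubleEisenstein.quasimodular k,
      DoubleEisenstein.IsKroneckerRealization k ρ) ∧
    (∃! ρ' : DoubleEisenstein.Space (k + 2) →ₗ[ℚ] DoubleEisenstein.quasimodular (k + 2),
      DoubleEisenstein.IsKroneckerRealization (k + 2) ρ') ∧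
    (∃! θ : DoubleEisenstein.quasimodular k →ₗ[ℚ] DoubleEisenstein.quasimodular (k + 2),
      DoubleEisenstein.IsQDeriv k θ) ∧
    ∀ (D : DoubleEisenstein.Space k →ₗ[ℚ] DoubleEisenstein.Space (k + 2))
      (ρ : DoubleEisenstein.Space k →ₗ[ℚ] DoubleEisenstein.quasimodular k)
      (ρ' : DoubleEisenstein.Space (k + 2) →ₗ[ℚ] DoubleEisenstein.quasimodular (k + 2))
      (θ : DoubleEisenstein.quasimodular k →ₗ[ℚ] DoubleEisenstein.quasimodular (k + 2)),
      DoubleEisenstein.IsDerivation k D →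
      DoubleEisenstein.IsKroneckerRealization k ρ →
      DoubleEisenstein.IsKroneckerRealization (k + 2) ρ' →
      DoubleEisenstein.IsQDeriv k θ →
      ρ' ∘ₗ D = θ ∘ₗ ρ := by
  obtain ⟨D, hD⟩ := DoubleEisenstein.exists_isDerivation k
  obtain ⟨ρ, hρ⟩ := DoubleEisenstein.exists_isKroneckerRealization k
  obtain ⟨ρ', hρ'⟩ := DoubleEisenstein.exists_isKroneckerRealization (k + 2)
  obtain ⟨θ, hθ⟩ := DoubleEisenstein.exists_isQDeriv k
  exact ⟨⟨D, hD, fun _ h => DoubleEisenstein.isDerivation_unique h hD⟩,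
    ⟨ρ, hρ, fun _ h => DoubleEisenstein.isKroneckerRealization_unique h hρ⟩,
    ⟨ρ', hρ', fun _ h => DoubleEisenstein.isKroneckerRealization_unique h hρ'⟩,
    ⟨θ, hθ, fun _ h => DoubleEisenstein.isQDeriv_unique h hθ⟩,
    fun _ _ _ _ => DoubleEisenstein.realization_comp_derivation⟩
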